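/- Let $M=\mathbb R_t\times[0,\infty)_r\times\mathbb S^2$ be the blow-up of $\mathbb R^{1,3}$ along $\{x=0\}$, with volume form $r^2\,dt\,dr\,d\theta$ and interior $M^\circ\simeq\{(t,x)\in\mathbb R^{1,3}: x\neq0\}$. Call b-vector fields the vector fields on $M$ tangent to $\{r=0\}$; they are generated over $C^\infty(M)$ by $\partial_t$, $r\partial_r$ and the infinitesimal rotations. For $k\in\mathbb N$ let $H^{0,k}_{\rm b}(M;\mathbb C^4)$ be the space of $u\in L^2(M;\mathbb C^4)$ all of whose b-derivatives of order $\le k$ are in $L^2$, and let $H^{0,-k}_{\rm b}(M;\mathbb C^4)$ be its dual. Let $H^{0,-\infty}_{\rm b,c}(M;\mathbb C^4)$ be the union, over $k$ and over compact $K\subset M$ (which may meet $r=0$), of the spaces of elements of $H^{0,-k}_{\rm b}(M;\mathbb C^4)$ supported in $K$, with the inductive limit topology. Let $H^{1,\infty}_{\rm b,loc}(M;\mathbb C^4)$ be the space of $u$ such that $V_1\cdots V_Nu\in H^1_{\rm loc}(M;\mathbb C^4)$ for all $N\ge 0$ and all b-vector fields $V_1,\dots,V_N$, with the topology of the seminorms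 $\|V_1\cdots V_Nu\|_{H^1(K)}$, $K\subset M$ compact. Here $H^1$ is the ordinary first order Sobolev space on $\mathbb R^{1,3}$, and "loc" means near every point of $M$, including those with $r=0$. **Proposition.** Suppose that the linear map $$\Lambda: H^{0,-\infty}_{\rm b,c}(M;\mathbb C^4)\to H^{1,\infty}_{\rm b,loc}(M;\mathbb C^4)$$ is continuous. Then $\Lambda$ has a locally integrable trace density. More precisely, $\Lambda$ has a Schwartz kernel $\Lambda(p,q)\in{\rm End}(\mathbb C^4)$ that is continuous on $M^\circ\times M^\circ$, that is, $(\Lambda f)(p)=\int\Lambda(p,q)f(q)\,dq$ on $M^\circ$ for all $f\in C_{\rm c}^\infty(M^\circ;\mathbb C^4)$, and for any such kernel the trace density $$\rho(p)=\operatorname{Tr}_{\mathbb C^4}\Lambda(p,p)$$ is locally integrable on $\mathbb R^{1,3}$ (including near $r=0$) and satisfies, for every $\delta>0$, $$\rho(t,x)=O\big(|x|^{-2-2\delta}\big)\quad\text{as } |x|\to0,\ \text{locally uniformly in } t;$$ more precisely, for all $\delta>0$ and $R$ there is $C$ such that $|\rho(t,x)|\le C|x|^{-2-2\delta}$ whenever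 $|t|\le R$ and $0<|x|\le R$. -/

import Mathlib

open MeasureTheory Set
open scoped Distributions LineDeriv ENNReal NNReal

noncomputable section

namespace DiracCoulomb

/-- Points `(t, x)` of Minkowski space `ℝ^{1,3}`; `volume` is Lebesgue measure,
i.e. `r ^ 2 dt dr dθ` in polar coordinates `x = r θ`. -/
abbrev Spacetime : Type := ℝ × EuclideanSpace ℝ (Fin 3)

/-- The fibre `ℂ⁴`. -/
abbrev Spinor : Type := EuclideanSpace ℂ (Fin 4)

/-- The interior `M° = ℝ_t × (0, ∞)_r × S²` of the blown-up spacetime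
`M = ℝ_t × [0, ∞)_r × S²`, identified by the blow-down map with `{(t, x) | x ≠ 0}`.
A subset of `M°` is relatively compact in `M` iff it is bounded in `ℝ^{1,3}`. -/
def interiorM : TopologicalSpace.Opens Spacetime :=
  ⟨{p | p.2 ≠ 0}, isOpen_ne.preimage continuous_snd⟩

/-- Scalar real-valued test functions on `M°`. -/
abbrev Test : Type := 𝓓(interiorM, ℝ)

/-- `ℂ⁴`-valued distributions on `M°` (continuous real-linear maps on real test functions, as in
Mathlib's `𝓓'`; only the underlying complex vector space is needed). -/
abbrev Distr : Type := Test →L[ℝ] Spinor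

/-! ### b-vector fields -/

/-- Generators over `C^∞(M)` of the vector fields on `M` tangent to the boundary `r = 0`:
`∂_t`, `r ∂_r = x · ∇`, and the three infinitesimal rotations (which span the vector fields
on the sphere). -/
def bField : Fin 5 → Spacetime → Spacetime
  | 0, _ => (1, 0)
  | 1, p => (0, p.2)
  | 2, p => (0, !₂[0, -p.2 2, p.2 1])
  | 3, p => (0, !₂[p.2 2, 0, -p.2 0])
  | 4, p => (0, !₂[-p.2 1, p.2 0, 0])

/-- The divergence of `bField i`, a constant. -/
def bDiv : Fin 5 → ℝ := ![0, 3, 0, 0, 0]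

theorem contDiff_bField (i : Fin 5) : ContDiff ℝ (⊤ : ℕ∞) (bField i) := by
  have h : ∀ j : Fin 3, ContDiff ℝ (⊤ : ℕ∞) fun p : Spacetime => p.2 j := fun j =>
    ((EuclideanSpace.proj (𝕜 := ℝ) j).contDiff).comp contDiff_snd
  have h3 : ∀ f : Spacetime → Fin 3 → ℝ, (∀ j, ContDiff ℝ (⊤ : ℕ∞) fun p => f p j) →
      ContDiff ℝ (⊤ : ℕ∞) fun p => ((0 : ℝ), WithLp.toLp 2 (f p)) := fun f hf =>
    contDiff_const.prodMk ((contDiff_euclidean).2 hf)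
  fin_cases i
  · exact contDiff_const
  · exact contDiff_const.prodMk contDiff_snd
  · refine h3 (fun p => ![0, -p.2 2, p.2 1]) fun j => ?_
    fin_cases j
    exacts [contDiff_const, (h 2).neg, h 1]
  · refine h3 (fun p => ![p.2 2, 0, -p.2 0]) fun j => ?_
    fin_cases j
    exacts [h 2, contDiff_const, (h 0).neg]
  · refine h3 (fun p => ![-p.2 1, p.2 0, 0]) fun j => ?_
    fin_cases j
    exacts [(h 1).neg, h 0, contDiff_const]

/-- The derivative `V_i φ` of a test function along the b-vector field `V_i = bField i`. -/
def bDeriv (i : Fin 5) (φ : Test) : Test where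
  toFun p := fderiv ℝ φ p (bField i p)
  contDiff' := (φ.contDiff.fderiv_right (by simp)).clm_apply (contDiff_bField i)
  hasCompactSupport' := (φ.hasCompactSupport.fderiv ℝ).mono fun p hp h => hp (by simp [h])
  tsupport_subset' := by
    have h : Function.support (fun p => fderiv ℝ φ p (bField i p)) ⊆
        Function.support (fderiv ℝ φ) := fun p hp h => hp (by simp [h])
    exact (closure_mono h).trans ((tsupport_fderiv_subset ℝ).trans φ.tsupport_subset)

/-- The formal transpose of `V_i`: `∫ (V_i f) φ = ∫ f (V_iᵗ φ)`. -/
def bTranspose (i : Fin 5) (φ : Test) : Test := -bDeriv i φ - bDiv i • φ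

/-- `V_{i₁} ⋯ V_{iₙ} φ` for the word `w = [i₁, …, iₙ]`. -/
def bDerivWord (w : List (Fin 5)) (φ : Test) : Test := w.foldr bDeriv φ

/-- The transpose `V_{iₙ}ᵗ ⋯ V_{i₁}ᵗ φ` of `V_{i₁} ⋯ V_{iₙ}` for the word `w = [i₁, …, iₙ]`. -/
def bTransposeWord (w : List (Fin 5)) (φ : Test) : Test :=
  w.foldl (fun ψ i => bTranspose i ψ) φ

/-! ### The space `H_{b,c}^{0,-∞}` -/

/-- The norm of `H_b^{0,k}(M)`: the sum of the `L²` norms of all b-derivatives of order `≤ k`. -/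
def bNorm (k : ℕ) (φ : Test) : ℝ≥0∞ :=
  ∑ n ∈ Finset.range (k + 1), ∑ w : Fin n → Fin 5,
    eLpNorm (bDerivWord (List.ofFn w) φ) 2 volume

/-- The norm of `H_b^{0,-k}(M; ℂ⁴)`, the dual of `H_b^{0,k}` (in which the test functions
on `M°` are dense); it is infinite off `H_b^{0,-k}`. -/
def bDualNorm (k : ℕ) (u : Distr) : ℝ≥0∞ := ⨆ φ : Test, ‖u φ‖ₑ / bNorm k φ

/-- `u` is supported in `{|t| ≤ R, r ≤ R}`, a compact subset of `M` (which may meet `r = 0`). -/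
def SupportedInBall (R : ℝ) (u : Distr) : Prop :=
  ∀ φ : Test, Disjoint (tsupport φ) (Metric.closedBall 0 R) → u φ = 0

theorem bNorm_mono {k l : ℕ} (h : k ≤ l) (φ : Test) : bNorm k φ ≤ bNorm l φ :=
  Finset.sum_le_sum_of_subset (Finset.range_mono (by omega))

theorem bDualNorm_anti {k l : ℕ} (h : k ≤ l) (u : Distr) : bDualNorm l u ≤ bDualNorm k u :=
  iSup_mono fun φ => ENNReal.div_le_div_left (bNorm_mono h φ) _

theorem bDualNorm_add_le (k : ℕ) (u v : Distr) :
    bDualNorm k (u + v) ≤ bDualNorm k u + bDualNorm k v := by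
  refine iSup_le fun φ => ?_
  calc ‖(u + v) φ‖ₑ / bNorm k φ ≤ (‖u φ‖ₑ + ‖v φ‖ₑ) / bNorm k φ :=
        ENNReal.div_le_div_right (enorm_add_le _ _) _
    _ = ‖u φ‖ₑ / bNorm k φ + ‖v φ‖ₑ / bNorm k φ := ENNReal.add_div
    _ ≤ _ := add_le_add (le_iSup (fun φ => ‖u φ‖ₑ / bNorm k φ) φ)
        (le_iSup (fun φ => ‖v φ‖ₑ / bNorm k φ) φ)

theorem bDualNorm_smul_le (k : ℕ) (c : ℂ) (u : Distr) :
    bDualNorm k (c • u) ≤ ‖c‖ₑ * bDualNorm k u := by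
  refine iSup_le fun φ => ?_
  have : ‖(c • u) φ‖ₑ = ‖c‖ₑ * ‖u φ‖ₑ := by
    rw [smul_apply, enorm_smul]
  rw [this, mul_div_assoc]
  gcongr
  exact le_iSup (fun φ => ‖u φ‖ₑ / bNorm k φ) φ

/-- `H_{b,c}^{0,-∞}(M; ℂ⁴)`: the union over `k` and over compact `K ⊆ M` of the spaces of
elements of `H_b^{0,-k}(M; ℂ⁴)` supported in `K`. -/
def HbcNegInf : Submodule ℂ Distr where
  carrier := {u | (∃ k, bDualNorm k u < ∞) ∧ ∃ R, SupportedInBall R u}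
  zero_mem' := ⟨⟨0, by simp [bDualNorm]⟩, 0, fun _ _ => rfl⟩
  add_mem' := by
    rintro u v ⟨⟨k, hk⟩, R, hR⟩ ⟨⟨l, hl⟩, S, hS⟩
    refine ⟨⟨max k l, (bDualNorm_add_le _ u v).trans_lt (ENNReal.add_lt_top.2
      ⟨(bDualNorm_anti (le_max_left k l) u).trans_lt hk,
        (bDualNorm_anti (le_max_right k l) v).trans_lt hl⟩)⟩, max R S, fun φ hφ => ?_⟩
    have h1 := hR φ (hφ.mono_right (Metric.closedBall_subset_closedBall (le_max_left R S)))
    have h2 := hS φ (hφ.mono_right (Metric.closedBall_subset_closedBall (le_max_right R S)))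
    simp [h1, h2]
  smul_mem' := by
    rintro c u ⟨⟨k, hk⟩, R, hR⟩
    exact ⟨⟨k, (bDualNorm_smul_le k c u).trans_lt (ENNReal.mul_lt_top enorm_lt_top hk)⟩, R,
      fun φ hφ => by simp [hR φ hφ]⟩

/-! ### The space `H_{b,loc}^{1,∞}` -/

/-- The functional `T` on test functions is given by the function `f ∈ L²_loc(M; ℂ⁴)`
(square-integrable up to `r = 0`). -/
structure IsL2LocDensity (T : Test → Spinor) (f : Spacetime → Spinor) : Prop where
  memLp : ∀ R : ℝ, MemLp f 2 (volume.restrict (Metric.closedBall 0 R))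
  eq_integral : ∀ φ : Test, T φ = ∫ p, φ p • f p

/-- The `L²` norm of `T` over `{|t| ≤ R, r ≤ R}`; infinite if `T` is not in `L²_loc(M; ℂ⁴)`.
(The density of `T` is unique up to null sets.) -/
def localL2Norm (R : ℝ) (T : Test → Spinor) : ℝ≥0∞ :=
  ⨅ (f : Spacetime → Spinor) (_ : IsL2LocDensity T f),
    eLpNorm f 2 (volume.restrict (Metric.closedBall 0 R))

/-- The distribution `V_{i₁} ⋯ V_{iₙ} u` on `M°`, as a functional on test functions. -/
def bWeak (w : List (Fin 5)) (u : Distr) : Test → Spinor := fun φ => u (bTransposeWord w φ)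

/-- The distribution `∂_v V_{i₁} ⋯ V_{iₙ} u` on `M°`, where `∂_v` is the ordinary derivative in the
constant direction `v ∈ ℝ^{1,3}`. -/
def dbWeak (v : Spacetime) (w : List (Fin 5)) (u : Distr) : Test → Spinor :=
  fun φ => u (bTransposeWord w (-∂_{v} φ))

/-- `H_{b,loc}^{1,∞}(M; ℂ⁴)`: all `u` such that `V_{i₁} ⋯ V_{iₙ} u ∈ H¹_loc(M; ℂ⁴)` for
every choice of b-vector fields, where `H¹_loc` means that the distribution and its first order
(ordinary) derivatives are in `L²_loc(M; ℂ⁴)`. (Test functions on `M°` are dense in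
`H¹(ℝ^{1,3})`, so weak derivatives on `M°` and on `ℝ^{1,3}` define the same space `H¹`.) -/
def HbLocInf : Submodule ℂ Distr where
  carrier := {u | ∀ w : List (Fin 5), (∃ f, IsL2LocDensity (bWeak w u) f) ∧
    ∀ v : Spacetime, ∃ f, IsL2LocDensity (dbWeak v w u) f}
  zero_mem' := fun _ => ⟨⟨0, fun _ => MemLp.zero, fun φ => by simp [bWeak]⟩,
    fun _ => ⟨0, fun _ => MemLp.zero, fun φ => by simp [dbWeak]⟩⟩
  add_mem' := by
    have key : ∀ (S T : Test → Spinor), (∃ f, IsL2LocDensity S f) → (∃ f, IsL2LocDensity T f) →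
        ∃ f, IsL2LocDensity (S + T) f := by
      rintro S T ⟨f, hf, hf'⟩ ⟨g, hg, hg'⟩
      refine ⟨f + g, fun R => (hf R).add (hg R), fun φ => ?_⟩
      have hi : ∀ h : Spacetime → Spinor,
          (∀ R : ℝ, MemLp h 2 (volume.restrict (Metric.closedBall 0 R))) →
          Integrable (fun p => φ p • h p) := fun h hh => by
        have hloc : LocallyIntegrable h volume := fun p => by
          have : IsFiniteMeasure (volume.restrict
              (Metric.closedBall (0 : Spacetime) (‖p‖ + 1))) :=
            ⟨by simpa using measure_closedBall_lt_top⟩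
          exact ⟨Metric.closedBall 0 (‖p‖ + 1), Metric.closedBall_mem_nhds_of_mem (by simp),
            (hh _).integrable (by norm_num)⟩
        exact hloc.integrable_smul_left_of_hasCompactSupport φ.continuous φ.hasCompactSupport
      simp only [Pi.add_apply, smul_add]
      rw [integral_add (hi f hf) (hi g hg), hf', hg']
    exact fun {u v} hu hv w => ⟨key _ _ (hu w).1 (hv w).1, fun e => key _ _ ((hu w).2 e) ((hv w).2 e)⟩
  smul_mem' := by
    have key : ∀ (c : ℂ) (T : Test → Spinor), (∃ f, IsL2LocDensity T f) →
        ∃ f, IsL2LocDensity (c • T) f := by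
      rintro c T ⟨f, hf, hf'⟩
      refine ⟨c • f, fun R => (hf R).const_smul c, fun φ => ?_⟩
      simp only [Pi.smul_apply, smul_comm _ c]
      rw [integral_smul, hf']
    exact fun c u hu w => ⟨key c _ (hu w).1, fun e => key c _ ((hu w).2 e)⟩

/-! ### Continuous operators, Schwartz kernels, trace densities -/

/-- Continuity `H_{b,c}^{0,-∞}(M; ℂ⁴) → H_{b,loc}^{1,∞}(M; ℂ⁴)` of a linear map, the source with
the locally convex inductive limit topology over `k` and over compact subsets of `M`, the target with
the seminorms `‖V_{i₁} ⋯ V_{iₙ} u‖_{H¹(K)}`, `K ⊆ M` compact: on each step of the source, each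
seminorm of the image is bounded by the norm of that step. -/
def IsContinuousOperator (Λ : HbcNegInf →ₗ[ℂ] HbLocInf) : Prop :=
  ∀ (k : ℕ) (R : ℝ) (w : List (Fin 5)) (S : ℝ),
    (∃ C : ℝ≥0, ∀ u : HbcNegInf, SupportedInBall R u →
      localL2Norm S (bWeak w (Λ u : Distr)) ≤ C * bDualNorm k u) ∧
    ∀ v : Spacetime, ∃ C : ℝ≥0, ∀ u : HbcNegInf, SupportedInBall R u →
      localL2Norm S (dbWeak v w (Λ u : Distr)) ≤ C * bDualNorm k u

/-- The distribution `φ ↦ ∫ φ f` of a `ℂ⁴`-valued test function `f` on `M°`. -/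
def toDistr (f : 𝓓(interiorM, Spinor)) : Distr :=
  TestFunction.integralAgainstBilinCLM (ContinuousLinearMap.lsmul ℝ ℝ) volume f

theorem toDistr_apply (f : 𝓓(interiorM, Spinor)) (φ : Test) :
    toDistr f φ = ∫ p, φ p • f p := by
  have h : LocallyIntegrableOn (f : Spacetime → Spinor) interiorM volume :=
    (f.continuous.locallyIntegrable).locallyIntegrableOn _
  simp [toDistr, h]

theorem toDistr_mem (f : 𝓓(interiorM, Spinor)) : toDistr f ∈ HbcNegInf := by
  refine ⟨⟨0, ?_⟩, ?_⟩
  · have hf : eLpNorm f 2 volume < ∞ :=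
      (f.continuous.memLp_of_hasCompactSupport f.hasCompactSupport).2
    refine lt_of_le_of_lt (iSup_le fun φ => ENNReal.div_le_of_le_mul ?_) hf
    have hb : bNorm 0 φ = eLpNorm φ 2 volume := by simp [bNorm, bDerivWord]
    rw [hb, toDistr_apply, mul_comm]
    calc ‖∫ p, φ p • f p‖ₑ ≤ ∫⁻ p, ‖φ p • f p‖ₑ := enorm_integral_le_lintegral_enorm _
      _ = eLpNorm ((φ : Spacetime → ℝ) • (f : Spacetime → Spinor)) 1 volume := by
        rw [eLpNorm_one_eq_lintegral_enorm]; rfl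
      _ ≤ _ := eLpNorm_smul_le_mul_eLpNorm f.aestronglyMeasurable φ.aestronglyMeasurable
  · obtain ⟨R, hR⟩ := f.hasCompactSupport.isCompact.isBounded.subset_closedBall 0
    refine ⟨R, fun φ hφ => ?_⟩
    rw [toDistr_apply]
    refine integral_eq_zero_of_ae (Filter.Eventually.of_forall fun p => ?_)
    by_cases hp : p ∈ tsupport f
    · have : p ∉ tsupport φ := fun h => Set.disjoint_left.1 hφ h (hR hp)
      simp [image_eq_zero_of_notMem_tsupport this]
    · simp [image_eq_zero_of_notMem_tsupport hp]

/-- A `ℂ⁴`-valued test function on `M°`, seen as an element of `H_{b,c}^{0,-∞}(M; ℂ⁴)`. -/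
def ofTest (f : 𝓓(interiorM, Spinor)) : HbcNegInf := ⟨toDistr f, toDistr_mem f⟩

/-- `k` is the Schwartz kernel of `Λ`, and it is continuous on `M° × M°`:
`(Λ f)(p) = ∫ k(p, q) f(q) dq` on `M°`, in the sense of distributions. -/
structure IsContinuousKernel (Λ : HbcNegInf →ₗ[ℂ] HbLocInf)
    (k : Spacetime → Spacetime → Spinor →L[ℂ] Spinor) : Prop where
  continuousOn : ContinuousOn (fun z : Spacetime × Spacetime => k z.1 z.2)
    ((interiorM : Set Spacetime) ×ˢ (interiorM : Set Spacetime))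
  eq_integral : ∀ (f : 𝓓(interiorM, Spinor)) (φ : Test),
    (Λ (ofTest f) : Distr) φ = ∫ p, φ p • ∫ q, k p q (f q)

/-- The fibrewise trace `Tr_{ℂ⁴} k(p, p)` of the restriction of a kernel to the diagonal. -/
def traceDensity (k : Spacetime → Spacetime → Spinor →L[ℂ] Spinor) (p : Spacetime) : ℂ :=
  LinearMap.trace ℂ Spinor (k p p : Spinor →ₗ[ℂ] Spinor)

end DiracCoulomb

end

open MeasureTheory Set
open scoped Distributions LineDeriv ENNReal NNReal

noncomputable section

namespace DiracCoulomb

open Filter Metric ContinuousLinearMap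
open scoped Topology Convolution

/-! The kernel is obtained by applying `Λ` to Dirac distributions: `Λ(p,q) z = (Λ (δ_q z))(p)`.
Everything rests on one scale-invariant Sobolev inequality near the axis. With `r = |x|`, four
b-derivatives in `L²` give `|u(p)| ≤ C r^{-3/2} ‖u‖` (`exists_enorm_le_wordNorm`). Indeed, on a box
at `p` of unit length in time and side `r` in space, the coordinate derivatives are b-derivatives
with coefficients `O(1)` in time and `O(1/r)` in space. Four one-dimensional integrations produce
the factor `r^{-3}`, and Cauchy-Schwarz on a box of volume `O(r³)` gives back `r^{3/2}`.

The inequality is used twice. On the source side it is applied to test functions, and says that `δ_q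
z` lies in `H_b^{0,-4}` with norm `O(r_q^{-3/2} |z|)` (`exists_bDualNorm_dirac_le`). On the target
side it is applied to the gradient of `u ∈ H_{b,loc}^{1,∞}`, whose b-derivatives are in `L²_loc`
because b-fields have affine coefficients and so commute with constant fields up to constant fields.
Hence `|∇u| = O(r^{-3/2})`, and integration along rays gives `|u| = O(r^{-1/2})`
(`exists_val_le_rpow`). On the diagonal the two powers multiply to `r^{-2}`, which is locally
integrable in three space dimensions and stronger than each `O(r^{-2-2δ})`.

The remaining work makes this meaningful. Elements of the target are distributions with `L²_loc`
densities. They get smooth representatives on `M°` by mollification, since the smooth-coefficient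
module spanned by their b-derivatives is closed under weak derivatives (`exists_smooth_family`). The
kernel is jointly continuous because `q ↦ δ_q z` is locally Lipschitz into `H_b^{0,-5}`
(`continuousOn_kernel`). It represents `Λ` because `f = ∫ δ_q f(q) dq` as a Bochner integral in a
Banach space containing `H_b^{0,-k}`, and functionals on steps of the source extend to that space by
Hahn-Banach (`integral_apply_diracB`). Finally, a continuous kernel is determined on `M° × M°` by
the operator (`IsContinuousKernel.eq`), so the bound holds for any of them. -/

/-! ### A Sobolev inequality on coordinate boxes -/

/-- The standard basis of `ℝ^{1,3}`. -/
def dir : Fin 4 → Spacetime :=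
  Fin.cons (1, 0) fun j => (0, EuclideanSpace.single j 1)

/-- The coordinate box with corner `p` and signed side lengths `a`. -/
def box (p : Spacetime) (a : Fin 4 → ℝ) : Set Spacetime :=
  {z | ∃ s : Fin 4 → ℝ, (∀ i, s i ∈ uIcc 0 (a i)) ∧ z = p + ∑ i, s i • dir i}

theorem isCompact_box (p : Spacetime) (a : Fin 4 → ℝ) : IsCompact (box p a) := by
  have h : box p a = (fun s : Fin 4 → ℝ => p + ∑ i, s i • dir i) ''
      Set.pi univ fun i => uIcc 0 (a i) := by
    ext z
    simp only [box, mem_ofPred_eq, mem_image, mem_univ_pi]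
    exact exists_congr fun s => and_congr_right fun _ => eq_comm
  rw [h]
  exact (isCompact_univ_pi fun i => isCompact_uIcc).image (by fun_prop)

theorem measurableSet_box (p : Spacetime) (a : Fin 4 → ℝ) : MeasurableSet (box p a) :=
  (isCompact_box p a).measurableSet

instance : (volume : Measure Spacetime).IsAddHaarMeasure :=
  Measure.prod.instIsAddHaarMeasure volume volume

/-- Coordinates of `ℝ^{1,3}` as an iterated product. -/
def coordEquiv : (ℝ × ℝ × ℝ × ℝ) ≃L[ℝ] Spacetime :=
  LinearEquiv.toContinuousLinearEquiv
  { toFun := fun s => (s.1, !₂[s.2.1, s.2.2.1, s.2.2.2])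
    invFun := fun p => (p.1, p.2 0, p.2 1, p.2 2)
    map_add' := fun s t => by
      ext i
      · rfl
      · fin_cases i <;> simp
    map_smul' := fun c s => by
      ext i
      · rfl
      · fin_cases i <;> simp
    left_inv := fun s => by simp
    right_inv := fun p => by
      ext i
      · rfl
      · fin_cases i <;> simp }

theorem coordEquiv_apply (s : ℝ × ℝ × ℝ × ℝ) :
    coordEquiv s = s.1 • dir 0 + s.2.1 • dir 1 + s.2.2.1 • dir 2 + s.2.2.2 • dir 3 := by
  change ((s.1, !₂[s.2.1, s.2.2.1, s.2.2.2]) : Spacetime) = s.1 • (1, 0) +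
    s.2.1 • (0, EuclideanSpace.single 0 1) + s.2.2.1 • (0, EuclideanSpace.single 1 1) +
    s.2.2.2 • (0, EuclideanSpace.single 2 1)
  ext i
  · simp
  · fin_cases i <;> simp

/-- Tonelli, and uniqueness of Haar measure up to a scalar; the value of the scalar plays no role.
-/
theorem exists_lintegral_coord_le : ∃ K : ℝ≥0, ∀ (p : Spacetime) (f : Spacetime → ℝ≥0∞),
    Measurable f → ∫⁻ s₀ : ℝ, ∫⁻ s₁ : ℝ, ∫⁻ s₂ : ℝ, ∫⁻ s₃ : ℝ,
      f (p + s₀ • dir 0 + s₁ • dir 1 + s₂ • dir 2 + s₃ • dir 3) ≤ K * ∫⁻ z, f z := by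
  have h₂ : (volume : Measure (ℝ × ℝ)).IsAddHaarMeasure :=
    Measure.prod.instIsAddHaarMeasure volume volume
  have h₃ : (volume : Measure (ℝ × ℝ × ℝ)).IsAddHaarMeasure :=
    Measure.prod.instIsAddHaarMeasure volume volume
  have h₄ : (volume : Measure (ℝ × ℝ × ℝ × ℝ)).IsAddHaarMeasure :=
    Measure.prod.instIsAddHaarMeasure volume volume
  have := coordEquiv.isAddHaarMeasure_map (volume : Measure (ℝ × ℝ × ℝ × ℝ))
  obtain ⟨κ, hκ⟩ : ∃ κ : ℝ≥0, Measure.map coordEquiv volume = κ • (volume : Measure Spacetime) :=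
    ⟨_, Measure.isAddLeftInvariant_eq_smul _ _⟩
  refine ⟨κ, fun p f hf => ?_⟩
  have h1 : Measurable fun s : ℝ × ℝ × ℝ × ℝ => f (p + coordEquiv s) :=
    hf.comp (measurable_const.add coordEquiv.continuous.measurable)
  have h3 : ∫⁻ s : ℝ × ℝ × ℝ × ℝ, f (p + coordEquiv s) = κ * ∫⁻ z, f z := by
    rw [← lintegral_map (g := coordEquiv) (f := fun z => f (p + z))
      (hf.comp (measurable_const.add measurable_id)) coordEquiv.continuous.measurable,
      hκ, lintegral_smul_measure, lintegral_add_left_eq_self]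
    rfl
  rw [← h3, Measure.volume_eq_prod, lintegral_prod _ h1.aemeasurable]
  refine le_of_eq (lintegral_congr fun s₀ => ?_)
  have h4 : Measurable fun s => f (p + coordEquiv (s₀, s)) :=
    h1.comp (measurable_prodMk_left (x := s₀))
  rw [Measure.volume_eq_prod ℝ (ℝ × ℝ), lintegral_prod _ h4.aemeasurable]
  refine lintegral_congr fun s₁ => ?_
  have h5 : Measurable fun s => f (p + coordEquiv (s₀, s₁, s)) :=
    h4.comp (measurable_prodMk_left (x := s₁))
  rw [Measure.volume_eq_prod ℝ ℝ, lintegral_prod _ h5.aemeasurable]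
  refine lintegral_congr fun s₂ => lintegral_congr fun s₃ => ?_
  rw [coordEquiv_apply]
  simp only [add_assoc]

/-- Bookkeeping for a chain of four one-dimensional estimates, one per coordinate direction:
substituting each into the previous one turns a point value into an integral over the box. Only the
last function must be measurable, since the intermediate ones are compared by monotonicity and the
constants are finite. -/
theorem exists_le_lintegral_box : ∃ K : ℝ≥0, ∀ (p : Spacetime) (a : Fin 4 → ℝ) (c : Fin 4 → ℝ≥0)
    (h : Fin 5 → Spacetime → ℝ≥0∞), Measurable (h 4) →
    (∀ j q, (∀ s ∈ uIcc 0 (a j), q + s • dir j ∈ box p a) →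
      h (Fin.castSucc j) q ≤ c j * ∫⁻ s in uIcc 0 (a j), h (Fin.succ j) (q + s • dir j)) →
    h 0 p ≤ K * (∏ j, (c j : ℝ≥0∞)) * ∫⁻ z in box p a, h 4 z := by
  obtain ⟨K, hK⟩ := exists_lintegral_coord_le
  refine ⟨K, fun p a c h hm hs => ?_⟩
  have z (j) : (0 : ℝ) ∈ uIcc 0 (a j) := left_mem_uIcc
  have hmem : ∀ s₀ ∈ uIcc 0 (a 0), ∀ s₁ ∈ uIcc 0 (a 1), ∀ s₂ ∈ uIcc 0 (a 2),
      ∀ s₃ ∈ uIcc 0 (a 3),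
      p + s₀ • dir 0 + s₁ • dir 1 + s₂ • dir 2 + s₃ • dir 3 ∈ box p a := by
    intro s₀ h₀ s₁ h₁ s₂ h₂ s₃ h₃
    refine ⟨![s₀, s₁, s₂, s₃], fun i => ?_, by simp [Fin.sum_univ_four, add_assoc]⟩
    fin_cases i
    exacts [h₀, h₁, h₂, h₃]
  have mJ (j) : MeasurableSet (uIcc 0 (a j)) := measurableSet_uIcc
  calc h 0 p ≤ c 0 * ∫⁻ s₀ in uIcc 0 (a 0), h 1 (p + s₀ • dir 0) :=
        hs 0 p fun s h0 => by simpa using hmem s h0 0 (z 1) 0 (z 2) 0 (z 3)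
    _ ≤ c 0 * ∫⁻ s₀ in uIcc 0 (a 0), c 1 * ∫⁻ s₁ in uIcc 0 (a 1),
        h 2 (p + s₀ • dir 0 + s₁ • dir 1) := by
      refine mul_le_mul_right (setLIntegral_mono' (mJ 0) fun s₀ h0 => ?_) _
      exact hs 1 _ fun s h1 => by simpa using hmem s₀ h0 s h1 0 (z 2) 0 (z 3)
    _ ≤ c 0 * ∫⁻ s₀ in uIcc 0 (a 0), c 1 * ∫⁻ s₁ in uIcc 0 (a 1), c 2 *
        ∫⁻ s₂ in uIcc 0 (a 2), h 3 (p + s₀ • dir 0 + s₁ • dir 1 + s₂ • dir 2) := by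
      refine mul_le_mul_right (setLIntegral_mono' (mJ 0) fun s₀ h0 => ?_) _
      refine mul_le_mul_right (setLIntegral_mono' (mJ 1) fun s₁ h1 => ?_) _
      exact hs 2 _ fun s h2 => by simpa using hmem s₀ h0 s₁ h1 s h2 0 (z 3)
    _ ≤ c 0 * ∫⁻ s₀ in uIcc 0 (a 0), c 1 * ∫⁻ s₁ in uIcc 0 (a 1), c 2 *
        ∫⁻ s₂ in uIcc 0 (a 2), c 3 * ∫⁻ s₃ in uIcc 0 (a 3),
          h 4 (p + s₀ • dir 0 + s₁ • dir 1 + s₂ • dir 2 + s₃ • dir 3) := by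
      refine mul_le_mul_right (setLIntegral_mono' (mJ 0) fun s₀ h0 => ?_) _
      refine mul_le_mul_right (setLIntegral_mono' (mJ 1) fun s₁ h1 => ?_) _
      refine mul_le_mul_right (setLIntegral_mono' (mJ 2) fun s₂ h2 => ?_) _
      exact hs 3 _ fun s h3 => hmem s₀ h0 s₁ h1 s₂ h2 s h3
    -- Cutting off by the indicator of the box makes it harmless to extend the four integrals to
    -- whole lines.
    _ ≤ c 0 * ∫⁻ s₀ in uIcc 0 (a 0), c 1 * ∫⁻ s₁ in uIcc 0 (a 1), c 2 *
        ∫⁻ s₂ in uIcc 0 (a 2), c 3 * ∫⁻ s₃ in uIcc 0 (a 3),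
          (box p a).indicator (h 4)
            (p + s₀ • dir 0 + s₁ • dir 1 + s₂ • dir 2 + s₃ • dir 3) := by
      refine mul_le_mul_right (setLIntegral_mono' (mJ 0) fun s₀ h0 => ?_) _
      refine mul_le_mul_right (setLIntegral_mono' (mJ 1) fun s₁ h1 => ?_) _
      refine mul_le_mul_right (setLIntegral_mono' (mJ 2) fun s₂ h2 => ?_) _
      refine mul_le_mul_right (setLIntegral_mono' (mJ 3) fun s₃ h3 => ?_) _
      rw [indicator_of_mem (hmem s₀ h0 s₁ h1 s₂ h2 s₃ h3)]
    _ ≤ c 0 * ∫⁻ s₀, c 1 * ∫⁻ s₁, c 2 * ∫⁻ s₂, c 3 * ∫⁻ s₃, (box p a).indicator (h 4)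
            (p + s₀ • dir 0 + s₁ • dir 1 + s₂ • dir 2 + s₃ • dir 3) := by
      refine mul_le_mul_right ((setLIntegral_le_lintegral _ _).trans
        (lintegral_mono fun s₀ => ?_)) _
      refine mul_le_mul_right ((setLIntegral_le_lintegral _ _).trans
        (lintegral_mono fun s₁ => ?_)) _
      refine mul_le_mul_right ((setLIntegral_le_lintegral _ _).trans
        (lintegral_mono fun s₂ => ?_)) _
      exact mul_le_mul_right (setLIntegral_le_lintegral _ _) _
    _ = (c 0 * (c 1 * (c 2 * c 3))) * ∫⁻ s₀, ∫⁻ s₁, ∫⁻ s₂, ∫⁻ s₃, (box p a).indicator (h 4)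
            (p + s₀ • dir 0 + s₁ • dir 1 + s₂ • dir 2 + s₃ • dir 3) := by
      simp only [lintegral_const_mul' _ _ ENNReal.coe_ne_top, mul_assoc]
    _ ≤ (c 0 * (c 1 * (c 2 * c 3))) * (K * ∫⁻ z, (box p a).indicator (h 4) z) :=
      mul_le_mul_right (hK p _ (hm.indicator (measurableSet_box p a))) _
    _ = _ := by
      rw [lintegral_indicator (measurableSet_box p a), Fin.prod_univ_four]
      ring

/-- The fundamental theorem of calculus `g 0 = g s - ∫₀ˢ g'`, averaged over `s` between `0` and `a`.
The side `a` is signed so that boxes can point in any coordinate direction. -/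
theorem enorm_le_lintegral_uIcc {E : Type*} [NormedAddCommGroup E] [NormedSpace ℝ E] [CompleteSpace
    E]
    {a : ℝ} (ha : a ≠ 0) {g g' : ℝ → E}
    (hg : ∀ s ∈ uIcc 0 a, HasDerivAt g (g' s) s) (hg' : ContinuousOn g' (uIcc 0 a)) :
    ‖g 0‖ₑ ≤ ∫⁻ s in uIcc 0 a, (‖a‖ₑ⁻¹ * ‖g s‖ₑ + ‖g' s‖ₑ) := by
  have hmg : AEMeasurable (fun s => ‖g s‖ₑ) (volume.restrict (uIcc 0 a)) :=
    (ContinuousOn.aestronglyMeasurable_of_isCompact (fun s hs => (hg s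
        hs).continuousAt.continuousWithinAt)
      isCompact_uIcc measurableSet_uIcc).enorm
  have hvol : volume (uIcc 0 a) = ‖a‖ₑ := by
    rw [Real.volume_interval, sub_zero, ← Real.norm_eq_abs, ofReal_norm]
  have ha0 : ‖a‖ₑ ≠ 0 := by simpa using ha
  have key : ∀ s ∈ uIcc 0 a, ‖g 0‖ₑ ≤ ‖g s‖ₑ + ∫⁻ x in uIcc 0 a, ‖g' x‖ₑ := by
    intro s hs
    have hsub : uIcc 0 s ⊆ uIcc 0 a := uIcc_subset_uIcc left_mem_uIcc hs
    have h := intervalIntegral.integral_eq_sub_of_hasDerivAt (fun x hx => hg x (hsub hx))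
      (hg'.mono hsub).intervalIntegrable
    have h' : g 0 = g s - ∫ x in (0 : ℝ)..s, g' x := by rw [h]; abel
    rw [h']
    refine (enorm_sub_le).trans (add_le_add le_rfl ?_)
    have : ‖∫ x in (0 : ℝ)..s, g' x‖ₑ = ‖∫ x in uIoc 0 s, g' x‖ₑ := by
      simp only [enorm_eq_iff_norm_eq, intervalIntegral.norm_intervalIntegral_eq]
    rw [this]
    exact (enorm_integral_le_lintegral_enorm _).trans
      (lintegral_mono_set (uIoc_subset_uIcc.trans hsub))
  have h1 : ‖a‖ₑ * ‖g 0‖ₑ ≤ (∫⁻ s in uIcc 0 a, ‖g s‖ₑ) +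
      ‖a‖ₑ * ∫⁻ x in uIcc 0 a, ‖g' x‖ₑ := by
    calc ‖a‖ₑ * ‖g 0‖ₑ = ∫⁻ s in uIcc 0 a, ‖g 0‖ₑ := by
          rw [setLIntegral_const, hvol, mul_comm]
      _ ≤ ∫⁻ s in uIcc 0 a, (‖g s‖ₑ + ∫⁻ x in uIcc 0 a, ‖g' x‖ₑ) :=
          setLIntegral_mono' measurableSet_uIcc key
      _ = _ := by
          rw [lintegral_add_right _ measurable_const, setLIntegral_const, hvol, mul_comm ‖a‖ₑ]
  rw [lintegral_add_left' (hmg.const_mul _), lintegral_const_mul'' _ hmg]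
  calc ‖g 0‖ₑ = ‖a‖ₑ⁻¹ * (‖a‖ₑ * ‖g 0‖ₑ) := by
        rw [← mul_assoc, ENNReal.inv_mul_cancel ha0 enorm_ne_top, one_mul]
    _ ≤ ‖a‖ₑ⁻¹ * _ := mul_le_mul_right h1 _
    _ = _ := by
        rw [mul_add, ← mul_assoc _ ‖a‖ₑ, ENNReal.inv_mul_cancel ha0 enorm_ne_top, one_mul]

/-- The sum of `‖g_w‖` over the words `w` of length at most `n`. -/
def wordSum {ι E : Type*} [Fintype ι] [NormedAddCommGroup E] (g : List ι → Spacetime → E) (n : ℕ)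
    (z : Spacetime) : ℝ≥0∞ :=
  ∑ m ∈ Finset.range (n + 1), ∑ w : Fin m → ι, ‖g (List.ofFn w) z‖ₑ

/-- Prepending a letter is a bijection onto the words one letter longer. The words themselves and
the prolonged words each contribute at most one copy of the sum on the right. -/
theorem wordSum_succ_ge {ι E : Type*} [Fintype ι] [NormedAddCommGroup E]
    (g : List ι → Spacetime → E) (n : ℕ) (z : Spacetime) :
    ∑ m ∈ Finset.range (n + 1), ∑ w : Fin m → ι,
      (‖g (List.ofFn w) z‖ₑ + ∑ i, ‖g (i :: List.ofFn w) z‖ₑ) ≤ 2 * wordSum g (n + 1) z := by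
  have h1 : ∀ m, ∑ w : Fin m → ι, ∑ i, ‖g (i :: List.ofFn w) z‖ₑ =
      ∑ w : Fin (m + 1) → ι, ‖g (List.ofFn w) z‖ₑ := fun m => by
    rw [← (Fin.consEquiv fun _ => ι).sum_comp, Fintype.sum_prod_type_right]
    simp [Fin.consEquiv]
  simp only [Finset.sum_add_distrib, h1, two_mul]
  refine add_le_add (Finset.sum_le_sum_of_subset (Finset.range_mono (by omega))) ?_
  rw [wordSum, Finset.sum_range_succ' _ (n + 1)]
  exact le_self_add (a := ∑ m ∈ Finset.range (n + 1), _)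

/-- The embedding `W^{4,1} ⊆ L^∞` in dimension four, with one integration in each direction.
Derivatives are measured by a family indexed by words, where prepending a letter stands for
differentiating once more. The constants `c j` keep the dependence on the sides explicit, for use on
boxes that shrink towards the axis. -/
theorem exists_enorm_le_lintegral_box (ι E : Type*) [Fintype ι] [NormedAddCommGroup E]
    [NormedSpace ℝ E] [CompleteSpace E] : ∃ K : ℝ≥0, ∀ (g : List ι → Spacetime → E)
    (p : Spacetime) (a : Fin 4 → ℝ) (c : Fin 4 → ℝ≥0) (U : Set Spacetime), IsOpen U →
    box p a ⊆ U → (∀ w, ContDiffOn ℝ 1 (g w) U) → (∀ j, a j ≠ 0) → (∀ j, ‖a j‖ₑ⁻¹ ≤ c j) →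
    (∀ w j, ∀ z ∈ box p a,
      ‖fderiv ℝ (g w) z (dir j)‖ₑ ≤ c j * (‖g w z‖ₑ + ∑ i, ‖g (i :: w) z‖ₑ)) →
    ‖g [] p‖ₑ ≤ K * (∏ j, (c j : ℝ≥0∞)) * ∫⁻ z in box p a, wordSum g 4 z := by
  obtain ⟨K, hK⟩ := exists_le_lintegral_box
  -- Each direction costs `4 = 2 * 2`: one factor from the two terms of the one-dimensional bound,
  -- one from `wordSum_succ_ge`.
  refine ⟨K * 4 ^ 4, fun g p a c U hU hpU hg ha hac hstep => ?_⟩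
  have hp : p ∈ U := hpU ⟨0, fun _ => left_mem_uIcc, by simp⟩
  have hmeas : Measurable fun z => U.indicator (wordSum g 4) z := by
    classical
    have : ContinuousOn (wordSum g 4) U :=
      continuousOn_finsetSum _ fun m _ => continuousOn_finsetSum _ fun w _ =>
        (hg _).continuousOn.enorm
    rw [← Set.piecewise_eq_indicator]
    exact ContinuousOn.measurable_piecewise this continuousOn_const hU.measurableSet
  have hline : ∀ w j q, (∀ s ∈ uIcc 0 (a j), q + s • dir j ∈ box p a) →
      ‖g w q‖ₑ ≤ 2 * c j * ∫⁻ s in uIcc 0 (a j),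
        (‖g w (q + s • dir j)‖ₑ + ∑ i, ‖g (i :: w) (q + s • dir j)‖ₑ) := by
    intro w j q hq
    have hd : ∀ s ∈ uIcc 0 (a j), HasDerivAt (fun s : ℝ => g w (q + s • dir j))
        (fderiv ℝ (g w) (q + s • dir j) (dir j)) s := fun s hs => by
      have h1 := (((hg w).differentiableOn one_ne_zero).differentiableAt
        (hU.mem_nhds (hpU (hq s hs)))).hasFDerivAt
      have h2 : HasDerivAt (fun s : ℝ => q + s • dir j) (dir j) s := by
        simpa using ((hasDerivAt_id s).smul_const (dir j)).const_add q
      exact h1.comp_hasDerivAt s h2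
    have hc : ContinuousOn (fun s : ℝ => fderiv ℝ (g w) (q + s • dir j) (dir j))
        (uIcc 0 (a j)) :=
      ContinuousOn.clm_apply (((hg w).continuousOn_fderiv_of_isOpen hU le_rfl).comp (by fun_prop)
        fun s hs => hpU (hq s hs)) continuousOn_const
    have h := enorm_le_lintegral_uIcc (ha j) hd hc
    simp only [zero_smul, add_zero] at h
    refine h.trans ?_
    rw [mul_comm 2, mul_assoc, ← lintegral_const_mul' _ _ (by simp),
      ← lintegral_const_mul' _ _ (by simp)]
    refine setLIntegral_mono' measurableSet_uIcc fun s hs => ?_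
    have h1 := hstep w j _ (hq s hs)
    calc _ ≤ c j * (‖g w (q + s • dir j)‖ₑ + ∑ i, ‖g (i :: w) (q + s • dir j)‖ₑ) +
          c j * (‖g w (q + s • dir j)‖ₑ + ∑ i, ‖g (i :: w) (q + s • dir j)‖ₑ) := by
          refine add_le_add ?_ h1
          gcongr
          · exact hac j
          · exact le_self_add
      _ = _ := by rw [← mul_add, two_mul]
  have hmg : ∀ w j q, (∀ s ∈ uIcc 0 (a j), q + s • dir j ∈ box p a) →
      AEMeasurable (fun s : ℝ => ‖g w (q + s • dir j)‖ₑ) (volume.restrict (uIcc 0 (a j))) :=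
    fun w j q hq => (ContinuousOn.aestronglyMeasurable_of_isCompact
      ((hg w).continuousOn.comp (by fun_prop) fun s hs => hpU (hq s hs))
      isCompact_uIcc measurableSet_uIcc).enorm
  have hmain : ∀ n j q, (∀ s ∈ uIcc 0 (a j), q + s • dir j ∈ box p a) →
      wordSum g n q ≤ (4 * c j : ℝ≥0) *
        ∫⁻ s in uIcc 0 (a j), wordSum g (n + 1) (q + s • dir j) := by
    intro n j q hq
    have hm1 : ∀ w, AEMeasurable (fun s : ℝ => ‖g w (q + s • dir j)‖ₑ +
        ∑ i, ‖g (i :: w) (q + s • dir j)‖ₑ) (volume.restrict (uIcc 0 (a j))) := fun w =>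
      (hmg w j q hq).add (Finset.aemeasurable_fun_sum _ fun i _ => hmg _ j q hq)
    calc wordSum g n q ≤ ∑ m ∈ Finset.range (n + 1), ∑ w : Fin m → ι, 2 * c j *
          ∫⁻ s in uIcc 0 (a j), (‖g (List.ofFn w) (q + s • dir j)‖ₑ +
            ∑ i, ‖g (i :: List.ofFn w) (q + s • dir j)‖ₑ) :=
          Finset.sum_le_sum fun m _ => Finset.sum_le_sum fun w _ => hline _ j q hq
      _ = 2 * c j * ∫⁻ s in uIcc 0 (a j), ∑ m ∈ Finset.range (n + 1), ∑ w : Fin m → ι,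
          (‖g (List.ofFn w) (q + s • dir j)‖ₑ +
            ∑ i, ‖g (i :: List.ofFn w) (q + s • dir j)‖ₑ) := by
          rw [lintegral_finsetSum' _ fun m _ => Finset.aemeasurable_fun_sum _ fun w _ => hm1 _]
          simp only [lintegral_finsetSum' _ fun w _ => hm1 _, Finset.mul_sum]
      _ ≤ 2 * c j * ∫⁻ s in uIcc 0 (a j), 2 * wordSum g (n + 1) (q + s • dir j) := by
          gcongr
          exact wordSum_succ_ge g n _
      _ = _ := by
          rw [lintegral_const_mul' _ _ (by simp)]
          push_cast
          ring
  -- The family is regular only on `U`, so it is extended by zero to be globally measurable.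
  have h := hK p a (fun j => 4 * c j) (fun n => U.indicator (wordSum g n)) hmeas
    fun j q hq => by
      have hqU : q ∈ U := by simpa using hpU (hq 0 left_mem_uIcc)
      rw [indicator_of_mem hqU]
      refine (hmain j j q hq).trans (mul_le_mul_right (le_of_eq ?_) _)
      refine setLIntegral_congr_fun measurableSet_uIcc fun s hs => ?_
      simp only [indicator_of_mem (hpU (hq s hs))]
      rfl
  have h0 : wordSum g 0 p = ‖g [] p‖ₑ := by simp [wordSum]
  have h4 : ∫⁻ z in box p a, U.indicator (wordSum g 4) z = ∫⁻ z in box p a, wordSum g 4 z :=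
    setLIntegral_congr_fun (measurableSet_box p a) fun z hz => indicator_of_mem (hpU hz) _
  rw [← h0]
  refine le_of_eq_of_le (by simp [hp]) (h.trans (le_of_eq ?_))
  rw [← h4]
  simp only [ENNReal.coe_mul, Finset.prod_mul_distrib, Finset.prod_const, Finset.card_univ,
    Fintype.card_fin]
  push_cast
  rw [← mul_assoc (K : ℝ≥0∞)]
  rfl

/-! ### A Sobolev inequality for b-derivatives -/

theorem mem_interiorM {p : Spacetime} : p ∈ interiorM ↔ p.2 ≠ 0 := Iff.rfl

theorem dir_succ (j : Fin 3) : dir j.succ = (0, EuclideanSpace.single j 1) := rfl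

/-- Numerators of the coefficients of the coordinate vector fields in terms of b-vector fields. -/
def dirNum (p : Spacetime) : Fin 3 → Fin 5 → ℝ :=
  ![![0, p.2 0, 0, p.2 2, -p.2 1], ![0, p.2 1, -p.2 2, 0, p.2 0], ![0, p.2 2, p.2 1, -p.2 0, 0]]

/-- Coefficients of the coordinate vector fields in terms of b-vector fields. -/
def dirCoef : Fin 4 → Fin 5 → Spacetime → ℝ :=
  Fin.cons (fun i _ => if i = 0 then 1 else 0) fun j i p => (‖p.2‖ ^ 2)⁻¹ * dirNum p j i

theorem norm_sq_eq (x : EuclideanSpace ℝ (Fin 3)) : ‖x‖ ^ 2 = x 0 ^ 2 + x 1 ^ 2 + x 2 ^ 2 := by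
  simp [EuclideanSpace.norm_sq_eq, Fin.sum_univ_three]

/-- In space this is `|x|² e = (x · e) x + (x × e) × x` with `e` a basis vector: `x` is the field `r
∂_r`, and `e_l × x` are the rotations. -/
theorem dir_eq_sum {p : Spacetime} (hp : p ∈ interiorM) (j : Fin 4) :
    dir j = ∑ i, dirCoef j i p • bField i p := by
  refine Fin.cases ?_ (fun j => ?_) j
  · simp [dirCoef, dir, bField]
  · have h0 : ‖p.2‖ ^ 2 ≠ 0 := pow_ne_zero 2 (norm_ne_zero_iff.2 hp)
    have h : ‖p.2‖ ^ 2 • dir j.succ = ∑ i, dirNum p j i • bField i p := by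
      rw [norm_sq_eq, dir_succ]
      fin_cases j <;>
      · ext l
        · simp [Fin.sum_univ_five, bField, dirNum]
        · fin_cases l <;> simp [Fin.sum_univ_five, bField, dirNum] <;> ring
    simp only [dirCoef, Fin.cons_succ, mul_smul, ← Finset.smul_sum, ← h]
    rw [smul_smul, inv_mul_cancel₀ h0, one_smul]

theorem contDiffOn_dirCoef (j : Fin 4) (i : Fin 5) (n : WithTop ℕ∞) :
    ContDiffOn ℝ n (dirCoef j i) interiorM := by
  refine Fin.cases ?_ (fun j => ?_) j
  · exact contDiffOn_const
  · have h : ∀ l : Fin 3, ContDiff ℝ n fun p : Spacetime => p.2 l := fun l =>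
      ((EuclideanSpace.proj (𝕜 := ℝ) l).contDiff).comp contDiff_snd
    have h1 : ContDiffOn ℝ n (fun p : Spacetime => (‖p.2‖ ^ 2)⁻¹) interiorM :=
      (contDiff_snd.norm_sq ℝ).contDiffOn.inv fun p hp => pow_ne_zero 2 (norm_ne_zero_iff.2 hp)
    have h2 : ContDiff ℝ n fun p : Spacetime => dirNum p j i := by
      fin_cases j <;> fin_cases i
      exacts [contDiff_const, h 0, contDiff_const, h 2, (h 1).neg,
        contDiff_const, h 1, (h 2).neg, contDiff_const, h 0,
        contDiff_const, h 2, h 1, (h 0).neg, contDiff_const]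
    exact h1.mul h2.contDiffOn

theorem abs_dirCoef_zero_le (i : Fin 5) (p : Spacetime) : |dirCoef 0 i p| ≤ 1 := by
  simp only [dirCoef, Fin.cons_zero]
  split_ifs <;> simp

theorem abs_dirCoef_succ_le (j : Fin 3) (i : Fin 5) {p : Spacetime} (hp : p ∈ interiorM) :
    |dirCoef j.succ i p| ≤ ‖p.2‖⁻¹ := by
  have h0 : 0 < ‖p.2‖ := norm_pos_iff.2 hp
  have h : ∀ l, |p.2 l| ≤ ‖p.2‖ := fun l => PiLp.norm_apply_le p.2 l
  have h1 : |dirNum p j i| ≤ ‖p.2‖ := by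
    fin_cases j <;> fin_cases i <;> simp [dirNum] <;> exact h _
  simp only [dirCoef, Fin.cons_succ, abs_mul, abs_inv, abs_pow, abs_norm]
  calc (‖p.2‖ ^ 2)⁻¹ * |dirNum p j i| ≤ (‖p.2‖ ^ 2)⁻¹ * ‖p.2‖ := by gcongr
    _ = ‖p.2‖⁻¹ := by field_simp

/-- The sum of the `L²` norms of `g_w` over the words `w` of length at most `n`. -/
def wordNorm {ι E : Type*} [Fintype ι] [NormedAddCommGroup E] (g : List ι → Spacetime → E) (n : ℕ)
    (μ : Measure Spacetime) : ℝ≥0∞ :=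
  ∑ m ∈ Finset.range (n + 1), ∑ w : Fin m → ι, eLpNorm (g (List.ofFn w)) 2 μ

/-- Cauchy-Schwarz on `B`, term by term. -/
theorem setLIntegral_wordSum_le {ι E : Type*} [Fintype ι] [NormedAddCommGroup E]
    {g : List ι → Spacetime → E} (n : ℕ) {B S : Set Spacetime} (hB : IsCompact B)
    (hg : ∀ w, ContinuousOn (g w) B) (hBS : B ⊆ S) :
    ∫⁻ z in B, wordSum g n z ≤
      wordNorm g n (volume.restrict S) * volume B ^ (1 / 2 : ℝ) := by
  have hm : ∀ w, AEStronglyMeasurable (g w) (volume.restrict B) := fun w =>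
    (hg w).aestronglyMeasurable_of_isCompact hB hB.measurableSet
  simp only [wordSum, wordNorm]
  rw [lintegral_finsetSum' _ fun m _ => Finset.aemeasurable_fun_sum _ fun w _ => (hm _).enorm,
    Finset.sum_mul]
  refine Finset.sum_le_sum fun m _ => ?_
  rw [lintegral_finsetSum' _ fun w _ => (hm _).enorm, Finset.sum_mul]
  refine Finset.sum_le_sum fun w _ => ?_
  rw [← eLpNorm_one_eq_lintegral_enorm]
  refine (eLpNorm_le_eLpNorm_mul_rpow_measure_univ (p := 1) (q := 2) (by norm_num) (hm _)).trans ?_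
  gcongr ?_ * ?_
  · exact eLpNorm_mono_measure _ (Measure.restrict_mono hBS le_rfl)
  · rw [Measure.restrict_apply_univ]
    norm_num

/-- The box at `p` of unit length in time and of side `‖x‖` in space, pointing away from the
axis. -/
def outwardSides (p : Spacetime) : Fin 4 → ℝ :=
  Fin.cons 1 fun j => if 0 ≤ p.2 j then ‖p.2‖ else -‖p.2‖

theorem sum_smul_dir (s : Fin 4 → ℝ) :
    ∑ i, s i • dir i = ((s 0, WithLp.toLp 2 fun j => s j.succ) : Spacetime) := by
  rw [Fin.sum_univ_succ, Fin.sum_univ_three]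
  simp only [dir_succ]
  ext l
  · simp [dir]
  · fin_cases l <;> simp [dir]

/-- Each spatial coordinate moves away from `0`, so `r` never drops below its value at `p`. This
keeps the coefficients `O(1/r)` under control on the whole box. The factor `2` is a bound for `√3`.
-/
theorem norm_le_of_mem_outwardBox {p z : Spacetime} (hz : z ∈ box p (outwardSides p)) :
    ‖p.2‖ ≤ ‖z.2‖ ∧ |z.1 - p.1| ≤ 1 ∧ ‖z.2 - p.2‖ ≤ 2 * ‖p.2‖ := by
  obtain ⟨s, hs, rfl⟩ := hz
  rw [sum_smul_dir]
  have h0 : |s 0| ≤ 1 := by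
    have := hs 0
    rw [outwardSides, Fin.cons_zero, uIcc_of_le zero_le_one] at this
    exact abs_le.2 ⟨by linarith [this.1], this.2⟩
  have h1 : ∀ j : Fin 3, |s j.succ| ≤ ‖p.2‖ ∧ p.2 j ^ 2 ≤ (p.2 j + s j.succ) ^ 2 := fun j => by
    have := hs j.succ
    rw [outwardSides, Fin.cons_succ] at this
    split_ifs at this with h
    · rw [uIcc_of_le (norm_nonneg _)] at this
      exact ⟨abs_le.2 ⟨by linarith [this.1, norm_nonneg p.2], this.2⟩, by nlinarith [this.1]⟩
    · rw [uIcc_of_ge (by linarith [norm_nonneg p.2])] at this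
      exact ⟨abs_le.2 ⟨this.1, by linarith [this.2, norm_nonneg p.2]⟩, by nlinarith [this.2]⟩
  refine ⟨?_, by simpa using h0, ?_⟩
  · refine (sq_le_sq₀ (norm_nonneg _) (norm_nonneg _)).1 ?_
    rw [norm_sq_eq, norm_sq_eq]
    exact add_le_add (add_le_add (h1 0).2 (h1 1).2) (h1 2).2
  · have h2 : ∀ j, (s (Fin.succ j)) ^ 2 ≤ ‖p.2‖ ^ 2 := fun j => by
      rw [← sq_abs]; exact pow_le_pow_left₀ (abs_nonneg _) (h1 j).1 2
    refine (sq_le_sq₀ (norm_nonneg _) (by positivity)).1 ?_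
    rw [Prod.snd_add, add_sub_cancel_left, norm_sq_eq]
    have a0 := h2 0
    have a1 := h2 1
    have a2 := h2 2
    change s (Fin.succ 0) ^ 2 + s (Fin.succ 1) ^ 2 + s (Fin.succ 2) ^ 2 ≤ _
    nlinarith [sq_nonneg ‖p.2‖]

theorem exists_volume_outwardBox_le : ∃ V : ℝ≥0, ∀ p : Spacetime,
    volume (box p (outwardSides p)) ≤ V * ‖p.2‖ₑ ^ (3 : ℝ) := by
  refine ⟨((volume (Metric.closedBall (0 : ℝ) 1)) * (8 *
    (volume (Metric.ball (0 : EuclideanSpace ℝ (Fin 3)) 1)))).toNNReal, fun p => ?_⟩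
  rw [ENNReal.coe_toNNReal (ENNReal.mul_ne_top measure_closedBall_lt_top.ne
    (ENNReal.mul_ne_top (by norm_num) measure_ball_lt_top.ne))]
  calc volume (box p (outwardSides p)) ≤
      volume (Metric.closedBall p.1 1 ×ˢ Metric.closedBall p.2 (2 * ‖p.2‖)) := by
        refine measure_mono fun z hz => ?_
        obtain ⟨-, h1, h2⟩ := norm_le_of_mem_outwardBox hz
        exact ⟨by simpa [Real.dist_eq] using h1, by simpa [dist_eq_norm] using h2⟩
    _ = _ := by
      rw [Measure.volume_eq_prod, Measure.prod_prod, Measure.addHaar_closedBall_center,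
        Measure.addHaar_closedBall volume p.2 (by positivity), mul_assoc]
      congr 1
      rw [finrank_euclideanSpace_fin, mul_pow, ENNReal.ofReal_mul (by norm_num),
        ENNReal.ofReal_pow (norm_nonneg _), ofReal_norm]
      norm_num
      ring

/-- The b-Sobolev inequality. The power is `-3 + 3/2`: the constants of the three spatial directions
give `r^{-3}`, and the square root of the volume of the box gives `r^{3/2}`. The lower-order term
with `A` leaves room for commutators when the family consists of gradients. The radius `3 ‖p‖ + 1`
contains the outward box. -/
theorem exists_enorm_le_wordNorm (E : Type*) [NormedAddCommGroup E] [NormedSpace ℝ E]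
    [CompleteSpace E] (A : ℝ≥0) : ∃ K : ℝ≥0, ∀ g : List (Fin 5) → Spacetime → E,
    (∀ w, ContDiffOn ℝ 1 (g w) interiorM) →
    (∀ w i, ∀ z ∈ interiorM,
      ‖fderiv ℝ (g w) z (bField i z)‖ₑ ≤ ‖g (i :: w) z‖ₑ + A * ‖g w z‖ₑ) →
    ∀ p ∈ interiorM, ∀ S : ℝ, 3 * ‖p‖ + 1 ≤ S →
      ‖g [] p‖ₑ ≤ K * ‖p.2‖ₑ ^ (-(3 / 2) : ℝ) *
        wordNorm g 4 (volume.restrict (Metric.closedBall 0 S)) := by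
  obtain ⟨K, hK⟩ := exists_enorm_le_lintegral_box (Fin 5) E
  obtain ⟨V, hV⟩ := exists_volume_outwardBox_le
  refine ⟨K * (1 + 5 * A) ^ 4 * V ^ (1 / 2 : ℝ), fun g hg hA p hp S hS => ?_⟩
  have hr : 0 < ‖p.2‖ := norm_pos_iff.2 hp
  have hre : ‖p.2‖ₑ ≠ 0 := enorm_ne_zero.2 hp
  have hbox : ∀ z ∈ box p (outwardSides p), z ∈ interiorM := fun z hz =>
    norm_pos_iff.1 (hr.trans_le (norm_le_of_mem_outwardBox hz).1)
  have hinv : ∀ z ∈ box p (outwardSides p), ‖‖z.2‖⁻¹‖ₑ ≤ ‖p.2‖ₑ⁻¹ := fun z hz => by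
    have := (norm_le_of_mem_outwardBox hz).1
    rw [enorm_inv (norm_ne_zero_iff.2 (hbox z hz)), enorm_norm]
    exact ENNReal.inv_le_inv.2 (enorm_le_iff_norm_le.2 this)
  -- Dominates both the inverse side lengths and the coefficients of `dir j` in b-fields; `5 * A`
  -- collects the lower-order terms of the five b-fields.
  set c : Fin 4 → ℝ≥0 := Fin.cons (1 + 5 * A) fun _ => (1 + 5 * A) * ‖p.2‖₊⁻¹ with hc
  have hcp : ∏ j, (c j : ℝ≥0∞) = (1 + 5 * A) ^ 4 * ‖p.2‖ₑ ^ (-3 : ℝ) := by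
    have h3 : ((‖p.2‖₊⁻¹ : ℝ≥0) : ℝ≥0∞) = ‖p.2‖ₑ⁻¹ := ENNReal.coe_inv (nnnorm_ne_zero_iff.2 hp)
    rw [Fin.prod_univ_succ]
    simp only [hc, Fin.cons_zero, Fin.cons_succ, Finset.prod_const, Finset.card_univ,
      Fintype.card_fin, ENNReal.coe_mul, h3]
    rw [ENNReal.rpow_neg, mul_pow, show (3 : ℝ) = (3 : ℕ) by norm_num,
      ENNReal.rpow_natCast, ENNReal.inv_pow]
    push_cast
    ring
  have hone : (1 : ℝ≥0∞) ≤ 1 + 5 * A := le_self_add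
  have h1 := hK g p (outwardSides p) c interiorM interiorM.isOpen hbox hg
    (fun j => Fin.cases (by simp [outwardSides]) (fun j => by
      simp only [outwardSides, Fin.cons_succ]; split_ifs <;> simpa using mem_interiorM.1 hp) j)
    (fun j => Fin.cases (by simp [outwardSides, hc]) (fun j => by
      have : ‖outwardSides p j.succ‖ₑ = ‖p.2‖ₑ := by
        simp only [outwardSides, Fin.cons_succ]; split_ifs <;> simp
      rw [this, hc, Fin.cons_succ, ENNReal.coe_mul, ENNReal.coe_inv (nnnorm_ne_zero_iff.2 hp)]
      exact le_mul_of_one_le_left' (by push_cast; exact hone)) j)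
    fun w j z hz => by
      have hb : ∀ b : ℝ≥0∞, (∀ i, ‖dirCoef j i z‖ₑ ≤ b) →
          ‖fderiv ℝ (g w) z (dir j)‖ₑ ≤
            (1 + 5 * A) * b * (‖g w z‖ₑ + ∑ i, ‖g (i :: w) z‖ₑ) := fun b hb => by
        rw [dir_eq_sum (hbox z hz) j, map_sum]
        calc ‖∑ i, fderiv ℝ (g w) z (dirCoef j i z • bField i z)‖ₑ
            ≤ ∑ i, ‖fderiv ℝ (g w) z (dirCoef j i z • bField i z)‖ₑ := enorm_sum_le _ _
          _ ≤ ∑ i, b * (‖g (i :: w) z‖ₑ + A * ‖g w z‖ₑ) := by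
              refine Finset.sum_le_sum fun i _ => ?_
              rw [map_smul, enorm_smul]
              exact mul_le_mul' (hb i) (hA w i z (hbox z hz))
          _ = b * ((∑ i, ‖g (i :: w) z‖ₑ) + 5 * A * ‖g w z‖ₑ) := by
              rw [← Finset.mul_sum, Finset.sum_add_distrib]
              simp [mul_assoc]
          _ ≤ b * ((1 + 5 * A) * (∑ i, ‖g (i :: w) z‖ₑ) + (1 + 5 * A) * ‖g w z‖ₑ) := by
              gcongr
              · exact le_mul_of_one_le_left' hone
              · exact le_add_self
          _ = _ := by ring
      revert hb
      refine Fin.cases (fun hb => ?_) (fun j hb => ?_) j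
      · refine (hb 1 fun i => ?_).trans (by simp [hc])
        rw [← enorm_one (G := ℝ), enorm_le_iff_norm_le, norm_one]
        exact abs_dirCoef_zero_le i z
      · refine (hb ‖p.2‖ₑ⁻¹ fun i => ?_).trans (le_of_eq ?_)
        · refine le_trans ?_ (hinv z hz)
          rw [enorm_le_iff_norm_le, norm_inv, norm_norm]
          exact abs_dirCoef_succ_le j i (hbox z hz)
        · rw [hc, Fin.cons_succ, ENNReal.coe_mul, ENNReal.coe_inv (nnnorm_ne_zero_iff.2 hp)]
          push_cast
          rfl
  refine h1.trans ?_
  have hBS : box p (outwardSides p) ⊆ Metric.closedBall 0 S := fun z hz => by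
    obtain ⟨-, h1, h2⟩ := norm_le_of_mem_outwardBox hz
    have h3 : |p.1| ≤ ‖p‖ := norm_fst_le p
    have h4 : ‖p.2‖ ≤ ‖p‖ := norm_snd_le p
    rw [mem_closedBall_zero_iff, Prod.norm_def, sup_le_iff]
    constructor
    · have : |z.1| ≤ |z.1 - p.1| + |p.1| := by simpa using abs_add_le (z.1 - p.1) p.1
      exact (this.trans (by linarith [norm_nonneg p]) : |z.1| ≤ S)
    · have := norm_le_norm_sub_add z.2 p.2
      linarith
  have h2 := setLIntegral_wordSum_le (g := g) 4 (isCompact_box p (outwardSides p))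
    (fun w => (hg w).continuousOn.mono hbox) hBS
  calc _ ≤ K * ((1 + 5 * A) ^ 4 * ‖p.2‖ₑ ^ (-3 : ℝ)) *
        (wordNorm g 4 (volume.restrict (Metric.closedBall 0 S)) *
          (V * ‖p.2‖ₑ ^ (3 : ℝ)) ^ (1 / 2 : ℝ)) := by
        rw [hcp]
        gcongr
        exact h2.trans (by gcongr; exact hV p)
    _ = K * (1 + 5 * A) ^ 4 * V ^ (1 / 2 : ℝ) *
        (‖p.2‖ₑ ^ (-3 : ℝ) * ‖p.2‖ₑ ^ (3 / 2 : ℝ)) *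
        wordNorm g 4 (volume.restrict (Metric.closedBall 0 S)) := by
        rw [ENNReal.mul_rpow_of_nonneg _ _ (by norm_num), ← ENNReal.rpow_mul]
        norm_num
        ring
    _ = _ := by
        rw [← ENNReal.rpow_add _ _ hre enorm_ne_top]
        norm_num
        rw [ENNReal.coe_rpow_of_nonneg _ (by norm_num)]

/-! ### Regularity of functions with weak derivatives of all orders -/


/-- `G` is the weak derivative of `F` on `M°` in direction `v`. -/
def WeakDeriv (F G : Spacetime → Spinor) (v : Spacetime) : Prop :=
  ∀ φ : Test, ∫ p, fderiv ℝ φ p v • F p = -∫ p, φ p • G p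

/-- A standard sequence of bump functions with shrinking support. -/
def bump (n : ℕ) : ContDiffBump (0 : Spacetime) where
  rIn := 1 / (n + 1) / 2
  rOut := 1 / (n + 1)
  rIn_pos := by positivity
  rIn_lt_rOut := half_lt_self (by positivity)

theorem tendsto_bump_rOut : Tendsto (fun n => (bump n).rOut) atTop (𝓝 0) :=
  tendsto_one_div_add_atTop_nhds_zero_nat

/-- The mollification of `F` at scale `1 / (n + 1)`. -/
def mollify (n : ℕ) (F : Spacetime → Spinor) : Spacetime → Spinor :=
  (bump n).normed volume ⋆[lsmul ℝ ℝ, volume] F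

theorem mollify_apply (n : ℕ) (F : Spacetime → Spinor) (p : Spacetime) :
    mollify n F p = ∫ q, (bump n).normed volume (p - q) • F q :=
  convolution_lsmul_swap

theorem normed_bump_sub_eq_zero {n : ℕ} {p q : Spacetime} (h : q ∉ ball p (bump n).rOut) :
    (bump n).normed volume (p - q) = 0 := by
  by_contra h'
  have : p - q ∈ Function.support ((bump n).normed volume) := h'
  rw [(bump n).support_normed_eq, mem_ball_zero_iff, ← dist_eq_norm, dist_comm] at this
  exact h this

theorem mollify_congr {n : ℕ} {F G : Spacetime → Spinor} {p : Spacetime}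
    (h : ∀ᵐ q, q ∈ ball p (bump n).rOut → F q = G q) : mollify n F p = mollify n G p := by
  rw [mollify_apply, mollify_apply]
  refine integral_congr_ae (h.mono fun q hq => ?_)
  by_cases hqp : q ∈ ball p (bump n).rOut
  · simp only [hq hqp]
  · simp only [normed_bump_sub_eq_zero hqp, zero_smul]

theorem contDiff_mollify (n : ℕ) {F : Spacetime → Spinor} (hF : LocallyIntegrable F) :
    ContDiff ℝ 1 (mollify n F) :=
  (bump n).hasCompactSupport_normed.contDiff_convolution_left (n := 1) _
    (bump n).contDiff_normed hF

/-- Young's inequality: the bump has integral `1`. -/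
theorem lintegral_mollify_le (n : ℕ) {F : Spacetime → Spinor} (hF : Integrable F) :
    ∫⁻ p, ‖mollify n F p‖ₑ ≤ ∫⁻ p, ‖F p‖ₑ := by
  have hη : Integrable ((bump n).normed volume : Spacetime → ℝ) :=
    (bump n).continuous_normed.integrable_of_hasCompactSupport (bump n).hasCompactSupport_normed
  have h1 : ∫⁻ t, ‖(bump n).normed (volume : Measure Spacetime) t‖ₑ = 1 := by
    rw [← ofReal_integral_norm_eq_lintegral_enorm hη]
    simp only [Real.norm_of_nonneg ((bump n).nonneg_normed _), (bump n).integral_normed,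
      ENNReal.ofReal_one]
  have hm := (hη.convolution_integrand (lsmul ℝ ℝ) hF).aestronglyMeasurable.enorm
  calc ∫⁻ p, ‖mollify n F p‖ₑ
      ≤ ∫⁻ p, ∫⁻ t, ‖lsmul ℝ ℝ ((bump n).normed volume t) (F (p - t))‖ₑ :=
        lintegral_mono fun p => enorm_integral_le_lintegral_enorm _
    _ = ∫⁻ t, ∫⁻ p, ‖lsmul ℝ ℝ ((bump n).normed volume t) (F (p - t))‖ₑ :=
        lintegral_lintegral_swap hm
    _ = ∫⁻ t, ‖(bump n).normed (volume : Measure Spacetime) t‖ₑ * ∫⁻ p, ‖F p‖ₑ := by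
        refine lintegral_congr fun t => ?_
        simp only [lsmul_apply, enorm_smul]
        rw [lintegral_const_mul' _ _ enorm_ne_top,
          lintegral_sub_right_eq_self (fun p => ‖F p‖ₑ) t]
    _ = ∫⁻ p, ‖F p‖ₑ := by
        rw [lintegral_mul_const'' _ hη.aestronglyMeasurable.enorm, h1, one_mul]

/-- Reflected translates of mollifiers as test functions. -/
def bumpTest (n : ℕ) (p : Spacetime) (h : closedBall p (bump n).rOut ⊆ interiorM) : Test where
  toFun q := (bump n).normed volume (p - q)
  contDiff' := (bump n).contDiff_normed.comp (contDiff_const.sub contDiff_id)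
  hasCompactSupport' := by
    refine HasCompactSupport.intro (isCompact_closedBall p (bump n).rOut) fun q hq => ?_
    exact normed_bump_sub_eq_zero fun h => hq (ball_subset_closedBall h)
  tsupport_subset' := by
    refine (closure_minimal (fun q hq => ?_) isClosed_closedBall).trans h
    by_contra hq'
    exact hq (normed_bump_sub_eq_zero fun h => hq' (ball_subset_closedBall h))

/-- The derivative falls on the bump, and `q ↦ η (p - q)` is an admissible test function when its
support stays in `M°`. Cutting off to `B` makes the function integrable and is not seen by the bump.
-/
theorem fderiv_mollify {F G : Spacetime → Spinor} {v : Spacetime} (h : WeakDeriv F G v)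
    {B : Set Spacetime} (hF : LocallyIntegrable (B.indicator F)) {n : ℕ} {p : Spacetime}
    (hB : closedBall p (bump n).rOut ⊆ B) (hM : closedBall p (bump n).rOut ⊆ interiorM) :
    fderiv ℝ (mollify n (B.indicator F)) p v = mollify n (B.indicator G) p := by
  set η := (bump n).normed (volume : Measure Spacetime) with hη
  have hη1 : ContDiff ℝ 1 η := (bump n).contDiff_normed
  have hηs : HasCompactSupport η := (bump n).hasCompactSupport_normed
  have h1 : HasFDerivAt (mollify n (B.indicator F)) _ p :=
    hηs.hasFDerivAt_convolution_left (lsmul ℝ ℝ) hη1 hF p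
  have hd : ∀ q, fderiv ℝ (bumpTest n p hM) q v = -(fderiv ℝ η (p - q) v) := fun q => by
    have e : (bumpTest n p hM : Spacetime → ℝ) = fun q => η (p - q) := rfl
    have h2 := ((hη1.differentiable one_ne_zero (p - q)).hasFDerivAt).comp q
      ((hasFDerivAt_id q).const_sub p)
    have h3 : HasFDerivAt (fun q => η (p - q)) _ q := h2
    rw [e, h3.fderiv]
    simp
  have hz : ∀ q, q ∉ B → bumpTest n p hM q = 0 ∧ fderiv ℝ (bumpTest n p hM) q v = 0 :=
    fun q hq => by
      have hq' : q ∉ closedBall p (bump n).rOut := fun h => hq (hB h)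
      constructor
      · exact normed_bump_sub_eq_zero fun h => hq' (ball_subset_closedBall h)
      · have : q ∉ tsupport (fderiv ℝ (bumpTest n p hM)) := fun h => by
          have h4 := tsupport_fderiv_subset ℝ h
          refine hq' (closure_minimal (fun q hq => ?_) isClosed_closedBall h4)
          by_contra hq'
          exact hq (normed_bump_sub_eq_zero fun h => hq' (ball_subset_closedBall h))
        rw [image_eq_zero_of_notMem_tsupport this]
        rfl
  rw [h1.fderiv, ← convolution_flip]
  have h5 : ((B.indicator F) ⋆[((lsmul ℝ ℝ).precompL Spacetime).flip, volume] fderiv ℝ η) p v =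
      ((B.indicator F) ⋆[(lsmul ℝ ℝ : ℝ →L[ℝ] Spinor →L[ℝ] Spinor).flip, volume]
        fun a => fderiv ℝ η a v) p :=
    convolution_precompR_apply (lsmul ℝ ℝ : ℝ →L[ℝ] Spinor →L[ℝ] Spinor).flip hF
      (hηs.fderiv ℝ) (hη1.continuous_fderiv one_ne_zero) p v
  rw [h5, convolution_def, mollify_apply]
  simp only [flip_apply, lsmul_apply]
  calc ∫ q, fderiv ℝ η (p - q) v • B.indicator F q
      = -∫ q, fderiv ℝ (bumpTest n p hM) q v • F q := by
        rw [← integral_neg]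
        refine integral_congr_ae (.of_forall fun q => ?_)
        by_cases hq : q ∈ B
        · simp [hd, hq]
        · have := (hz q hq).2
          simp only [indicator_of_notMem hq, this, zero_smul, smul_zero, neg_zero]
    _ = ∫ q, bumpTest n p hM q • G q := by rw [h, neg_neg]
    _ = _ := by
        refine integral_congr_ae (.of_forall fun q => ?_)
        by_cases hq : q ∈ B
        · simp only [indicator_of_mem hq]; rfl
        · simp only [indicator_of_notMem hq, (hz q hq).1, zero_smul, smul_zero]

/-- A set of functions, locally integrable on `M°`, which is closed under weak derivatives. -/
structure ClosedUnderWeakDeriv (S : Set (Spacetime → Spinor)) : Prop where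
  locallyIntegrableOn : ∀ F ∈ S, LocallyIntegrableOn F interiorM
  exists_weakDeriv : ∀ F ∈ S, ∀ j, ∃ G ∈ S, WeakDeriv F G (dir j)

theorem norm_dir_le (j : Fin 4) : ‖dir j‖ ≤ 1 := by
  refine Fin.cases ?_ (fun j => ?_) j
  · simp [dir]
  · simp [dir_succ]

/-- The coordinates on `ℝ^{1,3}`. -/
def coord : Fin 4 → Spacetime →L[ℝ] ℝ :=
  Fin.cons (ContinuousLinearMap.fst ℝ ℝ _) fun j =>
    (EuclideanSpace.proj (𝕜 := ℝ) j).comp (ContinuousLinearMap.snd ℝ ℝ _)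

theorem sum_coord_smul_dir (p : Spacetime) : ∑ j, coord j p • dir j = p := by
  rw [sum_smul_dir]
  rfl

theorem norm_coord_le (j : Fin 4) (p : Spacetime) : ‖coord j p‖ ≤ ‖p‖ := by
  refine Fin.cases ?_ (fun j => ?_) j
  · exact norm_fst_le p
  · exact (PiLp.norm_apply_le p.2 j).trans (norm_snd_le p)

theorem clm_eq_sum_coord {E : Type*} [NormedAddCommGroup E] [NormedSpace ℝ E]
    (T : Spacetime →L[ℝ] E) : T = ∑ j, (coord j).smulRight (T (dir j)) := by
  refine ContinuousLinearMap.ext fun p => ?_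
  conv_lhs => rw [← sum_coord_smul_dir p]
  simp

theorem norm_clm_le_sum {E : Type*} [NormedAddCommGroup E] [NormedSpace ℝ E]
    (T : Spacetime →L[ℝ] E) : ‖T‖ ≤ ∑ j, ‖T (dir j)‖ := by
  refine T.opNorm_le_bound (Finset.sum_nonneg fun _ _ => norm_nonneg _) fun p => ?_
  conv_lhs => rw [← sum_coord_smul_dir p, map_sum]
  refine (norm_sum_le _ _).trans ?_
  rw [Finset.sum_mul]
  refine Finset.sum_le_sum fun j _ => ?_
  rw [map_smul, norm_smul, mul_comm]
  gcongr
  exact norm_coord_le j p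

/-- Four sides of length `d / 5` reach at most `4 d / 5`. -/
theorem box_const_subset_ball (p : Spacetime) {d : ℝ} (hd : 0 < d) :
    box p (fun _ => d / 5) ⊆ ball p d := by
  rintro z ⟨s, hs, rfl⟩
  rw [mem_ball_iff_norm, add_sub_cancel_left]
  have h : ∀ i, ‖s i • dir i‖ ≤ d / 5 := fun i => by
    have := hs i
    rw [uIcc_of_le (by positivity)] at this
    rw [norm_smul, Real.norm_of_nonneg this.1]
    exact (mul_le_of_le_one_right this.1 (norm_dir_le i)).trans this.2
  calc ‖∑ i, s i • dir i‖ ≤ ∑ i : Fin 4, d / 5 := (norm_sum_le _ _).trans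
        (Finset.sum_le_sum fun i _ => h i)
    _ < d := by simp; linarith

/-- The Sobolev inequality on small boxes is applied to the mollified iterated weak derivatives.
Their `L¹` norms are bounded by those of the unmollified functions on `B`, independently of `n`. -/
theorem mollify_bounded {S : Set (Spacetime → Spinor)} (hS : ClosedUnderWeakDeriv S)
    {p₀ : Spacetime} {d : ℝ} (hd : 0 < d) (hM : closedBall p₀ (3 * d) ⊆ interiorM)
    {F : Spacetime → Spinor} (hF : F ∈ S) : ∃ C : ℝ, ∀ n, (bump n).rOut ≤ d →
      ∀ p ∈ ball p₀ d, ‖mollify n ((closedBall p₀ (3 * d)).indicator F) p‖ ≤ C := by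
  set B := closedBall p₀ (3 * d) with hB
  obtain ⟨K, hK⟩ := exists_enorm_le_lintegral_box (Fin 4) Spinor
  choose D hDS hD using hS.exists_weakDeriv
  -- Iterated weak derivatives, chosen once and for all, so that prepending a letter is one more
  -- derivative.
  let fam : List (Fin 4) → S := fun w => w.foldr (fun j f => ⟨D f f.2 j, hDS f f.2 j⟩) ⟨F, hF⟩
  have hint : ∀ w, Integrable (B.indicator (fam w).1) := fun w => by
    rw [integrable_indicator_iff measurableSet_closedBall]
    exact (hS.locallyIntegrableOn _ (fam w).2).integrableOn_compact_subset hM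
      (isCompact_closedBall _ _)
  -- At least the inverse side length, and at least `1` for the derivative bound.
  set c : ℝ≥0 := ‖d / 5‖₊⁻¹ + 1 with hc
  set X : ℝ≥0∞ := ∑ m ∈ Finset.range 5, ∑ w : Fin m → Fin 4,
    ∫⁻ p, ‖B.indicator (fam (List.ofFn w)).1 p‖ₑ with hX
  have hXtop : X ≠ ∞ := ENNReal.sum_ne_top.2 fun m _ => ENNReal.sum_ne_top.2 fun w _ =>
    (hint _).2.ne
  refine ⟨(K * (∏ _j : Fin 4, (c : ℝ≥0∞)) * X).toReal, fun n hn p hp => ?_⟩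
  have h5 : d / 5 ≠ 0 := by positivity
  have h5' : (‖d / 5‖₊⁻¹ : ℝ≥0) = ‖d / 5‖ₑ⁻¹ := ENNReal.coe_inv (nnnorm_ne_zero_iff.2 h5)
  have hKp := hK (fun w => mollify n (B.indicator (fam w).1)) p (fun _ => d / 5) (fun _ => c) univ
    isOpen_univ (subset_univ _) (fun w => (contDiff_mollify n (hint
        w).locallyIntegrable).contDiffOn)
    (fun _ => h5) (fun _ => by
      rw [← h5']; exact ENNReal.coe_le_coe.2 (le_add_of_nonneg_right zero_le_one))
    fun w j z hz => by
      have hz' : z ∈ ball p d := box_const_subset_ball p hd hz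
      -- The radius `3 d` is spent in thirds: from `p₀` to `p`, along the box, and on the support of
      -- the bump.
      have hzB : closedBall z (bump n).rOut ⊆ B := closedBall_subset_closedBall' (by
        rw [mem_ball] at hz' hp
        linarith [dist_triangle z p p₀])
      have : fderiv ℝ (mollify n (B.indicator (fam w).1)) z (dir j) =
          mollify n (B.indicator (fam (j :: w)).1) z :=
        fderiv_mollify (hD _ (fam w).2 j) (hint w).locallyIntegrable hzB (hzB.trans hM)
      rw [this]
      calc ‖mollify n (B.indicator (fam (j :: w)).1) z‖ₑ
          ≤ ∑ i, ‖mollify n (B.indicator (fam (i :: w)).1) z‖ₑ :=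
            Finset.single_le_sum (f := fun i => ‖mollify n (B.indicator (fam (i :: w)).1) z‖ₑ)
              (fun _ _ => zero_le) (Finset.mem_univ j)
        _ ≤ _ := le_add_self
        _ ≤ _ := le_mul_of_one_le_left' (by rw [hc]; push_cast; exact le_add_self)
  have hle : ∫⁻ z in box p fun _ => d / 5,
      wordSum (fun w => mollify n (B.indicator (fam w).1)) 4 z ≤ X := by
    have hm : ∀ w, AEMeasurable (fun z => ‖mollify n (B.indicator (fam w).1) z‖ₑ) volume :=
      fun w => (contDiff_mollify n (hint w).locallyIntegrable).continuous.enorm.aemeasurable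
    refine (setLIntegral_le_lintegral _ _).trans ?_
    simp only [wordSum]
    rw [lintegral_finsetSum' _ fun m _ => Finset.aemeasurable_fun_sum _ fun w _ => hm _]
    refine Finset.sum_le_sum fun m _ => ?_
    rw [lintegral_finsetSum' _ fun w _ => hm _]
    exact Finset.sum_le_sum fun w _ => lintegral_mollify_le n (hint _)
  rw [← toReal_enorm]
  refine ENNReal.toReal_mono (ENNReal.mul_ne_top (ENNReal.mul_ne_top (by simp) (by simp)) hXtop)
    (hKp.trans (by gcongr))

/-- Bounds on the mollified first derivatives make the mollifications Lipschitz uniformly in `n`. By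
Lebesgue differentiation they converge a.e., so `F` is Lipschitz on a set of full measure in the
ball and extends from there. -/
theorem exists_continuous_ae_eq {S : Set (Spacetime → Spinor)} (hS : ClosedUnderWeakDeriv S)
    {p₀ : Spacetime} {d : ℝ} (hd : 0 < d) (hM : closedBall p₀ (3 * d) ⊆ interiorM)
    {F : Spacetime → Spinor} (hF : F ∈ S) : ∃ f : Spacetime → Spinor, Continuous f ∧
      ∀ᵐ p, p ∈ ball p₀ d → F p = f p := by
  set B := closedBall p₀ (3 * d) with hB
  choose G hGS hG using hS.exists_weakDeriv F hF
  choose C hC using fun j => mollify_bounded hS hd hM (hGS j)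
  have hint : Integrable (B.indicator F) := by
    rw [integrable_indicator_iff measurableSet_closedBall]
    exact (hS.locallyIntegrableOn _ hF).integrableOn_compact_subset hM (isCompact_closedBall _ _)
  have hlim := ContDiffBump.ae_convolution_tendsto_right_of_locallyIntegrable (K := 2)
    tendsto_bump_rOut (.of_forall fun n => by simp only [bump]; linarith) hint.locallyIntegrable
  set E := {p | Tendsto (fun n => mollify n (B.indicator F) p) atTop (𝓝 (B.indicator F p))}
    with hE
  have hev : ∀ᶠ n in atTop, (bump n).rOut ≤ d :=
    (tendsto_bump_rOut.eventually (gt_mem_nhds hd)).mono fun n hn => hn.le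
  have hlip : ∀ n, (bump n).rOut ≤ d → ∀ p ∈ ball p₀ d, ∀ q ∈ ball p₀ d,
      ‖mollify n (B.indicator F) p - mollify n (B.indicator F) q‖ ≤ (∑ j, C j) * ‖p - q‖ := by
    intro n hn p hp q hq
    refine (convex_ball p₀ d).norm_image_sub_le_of_norm_fderiv_le (𝕜 := ℝ)
      (fun z _ => (contDiff_mollify n hint.locallyIntegrable).differentiable one_ne_zero z)
      (fun z hz => ?_) hq hp
    refine (norm_clm_le_sum _).trans (Finset.sum_le_sum fun j _ => ?_)
    have hzB : closedBall z (bump n).rOut ⊆ B := closedBall_subset_closedBall' (by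
        rw [mem_ball] at hz
        linarith)
    rw [fderiv_mollify (hG j) hint.locallyIntegrable hzB (hzB.trans hM)]
    exact hC j n hn z hz
  have hFlip : LipschitzOnWith (∑ j, C j).toNNReal (B.indicator F) (E ∩ ball p₀ d) := by
    refine LipschitzOnWith.of_dist_le_mul fun p hp q hq => ?_
    rw [dist_eq_norm, dist_eq_norm]
    refine le_trans (le_of_tendsto (hp.1.sub hq.1).norm
      (hev.mono fun n hn => hlip n hn p hp.2 q hq.2)) ?_
    gcongr
    exact Real.le_coe_toNNReal _
  obtain ⟨f, hf, hfE⟩ := hFlip.extend_finite_dimension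
  refine ⟨f, hf.continuous, hlim.mono fun p hp hpb => ?_⟩
  rw [← hfE ⟨hp, hpb⟩, indicator_of_mem]
  exact closedBall_subset_closedBall (by linarith) (ball_subset_closedBall hpb)

/-- The precise representative of a function, as a limit of mollifications. -/
def rep (F : Spacetime → Spinor) (p : Spacetime) : Spinor :=
  limUnder atTop fun n => mollify n F p

/-- The limit is taken jointly in the scale and the point, which encodes locally uniform
convergence. Only the values of `F` near `p` matter, so `rep` is local and needs no gluing. -/
theorem tendsto_mollify_of_ae_eq {F f : Spacetime → Spinor} (hf : Continuous f) {p : Spacetime}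
    {U : Set Spacetime} (hU : IsOpen U) (hp : p ∈ U) (h : ∀ᵐ q, q ∈ U → F q = f q) :
    Tendsto (fun i : ℕ × Spacetime => mollify i.1 F i.2) (atTop ×ˢ 𝓝 p) (𝓝 (f p)) := by
  have h1 : Tendsto (fun i : ℕ × Spacetime => mollify i.1 f i.2) (atTop ×ˢ 𝓝 p) (𝓝 (f p)) :=
    ContDiffBump.convolution_tendsto_right (φ := fun i : ℕ × Spacetime => bump i.1)
      (g := fun _ => f) (tendsto_bump_rOut.comp tendsto_fst)
      (.of_forall fun _ => hf.aestronglyMeasurable)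
      ((hf.tendsto p).comp tendsto_snd) tendsto_snd
  obtain ⟨ε, hε, hεU⟩ := Metric.isOpen_iff.1 hU p hp
  refine h1.congr' ?_
  have e1 : ∀ᶠ i : ℕ × Spacetime in atTop ×ˢ 𝓝 p, (bump i.1).rOut < ε / 2 :=
    (tendsto_bump_rOut.comp tendsto_fst).eventually (gt_mem_nhds (half_pos hε))
  have e2 : ∀ᶠ i : ℕ × Spacetime in atTop ×ˢ 𝓝 p, i.2 ∈ ball p (ε / 2) :=
    tendsto_snd.eventually (ball_mem_nhds p (half_pos hε))
  filter_upwards [e1, e2] with i h1 h2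
  refine mollify_congr (h.mono fun q hq hqi => (hq (hεU ?_)).symm)
  rw [mem_ball] at *
  linarith [dist_triangle q i.2 p]

theorem rep_eq_of_ae_eq {F f : Spacetime → Spinor} (hf : Continuous f) {p : Spacetime}
    {U : Set Spacetime} (hU : IsOpen U) (hp : p ∈ U) (h : ∀ᵐ q, q ∈ U → F q = f q) :
    rep F p = f p :=
  ((tendsto_mollify_of_ae_eq hf hU hp h).comp
    (tendsto_id.prodMk (tendsto_const_nhds (x := p)))).limUnder_eq

theorem exists_closedBall_subset {p : Spacetime} (hp : p ∈ interiorM) :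
    ∃ d > 0, closedBall p (3 * d) ⊆ interiorM := by
  obtain ⟨ε, hε, h⟩ := Metric.nhds_basis_closedBall.mem_iff.1 (interiorM.isOpen.mem_nhds hp)
  exact ⟨ε / 3, by positivity, by rwa [mul_div_cancel₀ _ (by norm_num)]⟩

theorem continuousOn_rep {S : Set (Spacetime → Spinor)} (hS : ClosedUnderWeakDeriv S)
    {F : Spacetime → Spinor} (hF : F ∈ S) : ContinuousOn (rep F) interiorM := fun p hp => by
  obtain ⟨d, hd, hM⟩ := exists_closedBall_subset hp
  obtain ⟨f, hf, hFf⟩ := exists_continuous_ae_eq hS hd hM hF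
  refine (hf.continuousAt.congr ?_).continuousWithinAt
  filter_upwards [ball_mem_nhds p hd] with q hq
  exact (rep_eq_of_ae_eq hf isOpen_ball hq hFf).symm

theorem ae_eq_rep {S : Set (Spacetime → Spinor)} (hS : ClosedUnderWeakDeriv S)
    {F : Spacetime → Spinor} (hF : F ∈ S) : ∀ᵐ p, p ∈ interiorM → F p = rep F p := by
  rw [ae_iff]
  refine measure_null_of_locally_null _ fun p hp => ?_
  simp only [Classical.not_imp, mem_ofPred_eq] at hp
  obtain ⟨d, hd, hM⟩ := exists_closedBall_subset hp.1
  obtain ⟨f, hf, hFf⟩ := exists_continuous_ae_eq hS hd hM hF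
  refine ⟨_ ∩ ball p d, inter_mem_nhdsWithin _ (ball_mem_nhds p hd), measure_mono_null ?_ hFf⟩
  rintro q ⟨hq, hqp⟩ h
  simp only [Classical.not_imp, mem_ofPred_eq] at hq
  exact hq.2 ((h hqp).trans (rep_eq_of_ae_eq hf isOpen_ball hqp hFf).symm)

/-- Near `p` the mollifications converge and their derivatives converge uniformly, to the precise
representatives of the weak derivatives. -/
theorem hasFDerivAt_rep {S : Set (Spacetime → Spinor)} (hS : ClosedUnderWeakDeriv S)
    {F : Spacetime → Spinor} (hF : F ∈ S) {G : Fin 4 → Spacetime → Spinor} (hGS : ∀ j, G j ∈ S)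
    (hG : ∀ j, WeakDeriv F (G j) (dir j)) {p : Spacetime} (hp : p ∈ interiorM) :
    HasFDerivAt (rep F) (∑ j, (coord j).smulRight (rep (G j) p)) p := by
  obtain ⟨d, hd, hM⟩ := exists_closedBall_subset hp
  set B := closedBall p (3 * d) with hB
  have hint : ∀ H ∈ S, Integrable (B.indicator H) := fun H hH => by
    rw [integrable_indicator_iff measurableSet_closedBall]
    exact (hS.locallyIntegrableOn _ hH).integrableOn_compact_subset hM (isCompact_closedBall _ _)
  have hloc : ∀ H ∈ S, ∃ h : Spacetime → Spinor, Continuous h ∧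
      (∀ q ∈ ball p d, rep H q = h q) ∧ ∀ᵐ q, q ∈ ball p d → B.indicator H q = h q := by
    intro H hH
    obtain ⟨h, hh, hHh⟩ := exists_continuous_ae_eq hS hd hM hH
    refine ⟨h, hh, fun q hq => rep_eq_of_ae_eq hh isOpen_ball hq hHh,
      hHh.mono fun q hq hqp => ?_⟩
    rw [indicator_of_mem (closedBall_subset_closedBall (by linarith) (ball_subset_closedBall hqp)),
      hq hqp]
  have hlim : ∀ H ∈ S, ∀ q ∈ ball p d, Tendsto
      (fun i : ℕ × Spacetime => mollify i.1 (B.indicator H) i.2) (atTop ×ˢ 𝓝 q)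
      (𝓝 (rep H q)) := fun H hH q hq => by
    obtain ⟨h, hh, h1, h2⟩ := hloc H hH
    rw [h1 q hq]
    exact tendsto_mollify_of_ae_eq hh isOpen_ball hq h2
  have hlimD : Tendsto (fun i : ℕ × Spacetime => ∑ j, (coord j).smulRight
      (mollify i.1 (B.indicator (G j)) i.2)) (atTop ×ˢ 𝓝 p)
      (𝓝 (∑ j, (coord j).smulRight (rep (G j) p))) :=
    tendsto_finsetSum _ fun j _ =>
      ((ContinuousLinearMap.smulRightL ℝ Spacetime Spinor (coord j)).continuous.tendsto _).comp
        (hlim (G j) (hGS j) p (mem_ball_self hd))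
  have hcont : Tendsto (fun q => ∑ j, (coord j).smulRight (rep (G j) q)) (𝓝 p)
      (𝓝 (∑ j, (coord j).smulRight (rep (G j) p))) :=
    tendsto_finsetSum _ fun j _ =>
      ((ContinuousLinearMap.smulRightL ℝ Spacetime Spinor (coord j)).continuous.tendsto _).comp
        ((continuousOn_rep hS (hGS j)).continuousAt (interiorM.isOpen.mem_nhds hp))
  refine hasFDerivAt_of_tendstoUniformlyOnFilter (𝕜 := ℝ) (l := atTop)
    (f := fun n => mollify n (B.indicator F))
    (f' := fun n q => ∑ j, (coord j).smulRight (mollify n (B.indicator (G j)) q))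
    (g' := fun q => ∑ j, (coord j).smulRight (rep (G j) q)) ?_ ?_ ?_
  -- Both the derivatives and their limit tend to the same value at `p`, jointly in `(n, q)`; hence
  -- they are uniformly close.
  · rw [tendstoUniformlyOnFilter_iff_tendsto]
    exact (((hcont.comp tendsto_snd).prodMk_nhds hlimD)).mono_right (nhds_le_uniformity _)
  · have e1 : ∀ᶠ i : ℕ × Spacetime in atTop ×ˢ 𝓝 p, (bump i.1).rOut < d :=
      (tendsto_bump_rOut.comp tendsto_fst).eventually (gt_mem_nhds hd)
    have e2 : ∀ᶠ i : ℕ × Spacetime in atTop ×ˢ 𝓝 p, i.2 ∈ ball p d :=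
      tendsto_snd.eventually (ball_mem_nhds p hd)
    filter_upwards [e1, e2] with i h1 h2
    have hzB : closedBall i.2 (bump i.1).rOut ⊆ B := closedBall_subset_closedBall' (by
        rw [mem_ball] at h2
        linarith)
    have := ((contDiff_mollify i.1 (hint F hF).locallyIntegrable).differentiable one_ne_zero
      i.2).hasFDerivAt
    rw [clm_eq_sum_coord (fderiv ℝ (mollify i.1 (B.indicator F)) i.2)] at this
    have h3 : ∀ j, fderiv ℝ (mollify i.1 (B.indicator F)) i.2 (dir j) =
        mollify i.1 (B.indicator (G j)) i.2 := fun j =>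
      fderiv_mollify (hG j) (hint F hF).locallyIntegrable hzB (hzB.trans hM)
    simp only [h3] at this
    exact this
  · filter_upwards [ball_mem_nhds p hd] with q hq
    have h1 : Tendsto (fun n : ℕ => (n, q)) atTop (atTop ×ˢ 𝓝 q) :=
      tendsto_id.prodMk tendsto_const_nhds
    have h2 := (hlim F hF q hq).comp h1
    exact h2

/-- Induction on `n` over the whole class at once: the derivative of `rep F` is built from `rep (G
j)` with `G j` again in the class. -/
theorem contDiffOn_rep {S : Set (Spacetime → Spinor)} (hS : ClosedUnderWeakDeriv S) (n : ℕ) :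
    ∀ F ∈ S, ContDiffOn ℝ n (rep F) interiorM := by
  induction n with
  | zero =>
    exact fun F hF => by
      rw [Nat.cast_zero, contDiffOn_zero]
      exact continuousOn_rep hS hF
  | succ n ih =>
    intro F hF
    choose G hGS hG using hS.exists_weakDeriv F hF
    have hd := fun p hp => hasFDerivAt_rep hS hF hGS hG (p := p) hp
    rw [Nat.cast_succ, contDiffOn_succ_iff_fderiv_of_isOpen interiorM.isOpen]
    refine ⟨fun p hp => (hd p hp).differentiableAt.differentiableWithinAt,
      fun h => absurd h (by simp), ?_⟩
    refine ContDiffOn.congr ?_ fun p hp => (hd p hp).fderiv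
    exact ContDiffOn.sum fun j _ => contDiffOn_const.smulRight (ih _ (hGS j))

/-! ### Smooth representatives of elements of `H_{b,loc}^{1,∞}` -/

theorem ae_mem_interiorM : ∀ᵐ p : Spacetime, p ∈ interiorM := by
  have h : {p : Spacetime | ¬ p ∈ interiorM} = univ ×ˢ {0} := by
    ext p
    simp [mem_interiorM]
  rw [ae_iff, h, Measure.volume_eq_prod, Measure.prod_prod, measure_singleton, mul_zero]

/-! ### Identification of densities by test functions on `M°`. -/

theorem ae_eq_zero_of_integral_test {F : Spacetime → Spinor}
    (hF : LocallyIntegrableOn F interiorM) (h : ∀ φ : Test, ∫ p, φ p • F p = 0) :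
    ∀ᵐ p, p ∈ interiorM → F p = 0 :=
  interiorM.isOpen.ae_eq_zero_of_integral_contDiff_smul_eq_zero hF
    fun g h1 h2 h3 => h ⟨g, h1, h2, h3⟩

theorem integrable_test_smul {F : Spacetime → Spinor} (hF : LocallyIntegrableOn F interiorM)
    {φ : Spacetime → ℝ} (hφ : Continuous φ) (hc : HasCompactSupport φ)
    (hs : tsupport φ ⊆ interiorM) : Integrable fun p => φ p • F p := by
  have h1 := hF.integrableOn_compact_subset hs hc
  have h2 : IntegrableOn (fun p => φ p • F p) (tsupport φ) :=
    h1.continuousOn_smul hφ.continuousOn hc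
  rwa [integrableOn_iff_integrable_of_support_subset] at h2
  intro p hp
  refine subset_tsupport _ fun h => hp ?_
  simp [h]

theorem Test.integrable_smul {F : Spacetime → Spinor} (hF : LocallyIntegrableOn F interiorM)
    (φ : Test) : Integrable fun p => φ p • F p :=
  integrable_test_smul hF φ.continuous φ.hasCompactSupport φ.tsupport_subset

theorem Test.integrable_fderiv_smul {F : Spacetime → Spinor}
    (hF : LocallyIntegrableOn F interiorM) (φ : Test) (v : Spacetime) :
    Integrable fun p => fderiv ℝ φ p v • F p := by
  refine integrable_test_smul hF (φ := fun p => fderiv ℝ φ p v)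
    ((φ.contDiff.continuous_fderiv (by simp)).clm_apply continuous_const)
    ((φ.hasCompactSupport.fderiv ℝ).mono fun p hp h => hp (by simp [h])) ?_
  have h : Function.support (fun p => fderiv ℝ φ p v) ⊆ Function.support (fderiv ℝ φ) :=
    fun p hp h => hp (by simp [h])
  exact (closure_mono h).trans ((tsupport_fderiv_subset ℝ).trans φ.tsupport_subset)

theorem ae_eq_of_integral_test {F G : Spacetime → Spinor}
    (hF : LocallyIntegrableOn F interiorM) (hG : LocallyIntegrableOn G interiorM)
    (h : ∀ φ : Test, ∫ p, φ p • F p = ∫ p, φ p • G p) : F =ᵐ[volume] G := by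
  have h1 := ae_eq_zero_of_integral_test (hF.sub hG) fun φ => by
    simp only [Pi.sub_apply, smul_sub]
    rw [integral_sub (φ.integrable_smul hF) (φ.integrable_smul hG), h, sub_self]
  filter_upwards [h1, ae_mem_interiorM] with p hp hpM
  exact sub_eq_zero.1 (hp hpM)

theorem IsL2LocDensity.locallyIntegrable {T : Test → Spinor} {f : Spacetime → Spinor}
    (h : IsL2LocDensity T f) : LocallyIntegrable f := fun p => by
  have : IsFiniteMeasure (volume.restrict (closedBall (0 : Spacetime) (‖p‖ + 1))) :=
    ⟨by simpa using measure_closedBall_lt_top⟩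
  exact ⟨closedBall 0 (‖p‖ + 1), closedBall_mem_nhds_of_mem (by simp),
    (h.memLp _).integrable (by norm_num)⟩

theorem IsL2LocDensity.locallyIntegrableOn {T : Test → Spinor} {f : Spacetime → Spinor}
    (h : IsL2LocDensity T f) : LocallyIntegrableOn f interiorM :=
  h.locallyIntegrable.locallyIntegrableOn _

theorem IsL2LocDensity.ae_eq {T : Test → Spinor} {f g : Spacetime → Spinor}
    (hf : IsL2LocDensity T f) (hg : IsL2LocDensity T g) : f =ᵐ[volume] g :=
  ae_eq_of_integral_test hf.locallyIntegrableOn hg.locallyIntegrableOn fun φ => by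
    rw [← hf.eq_integral, ← hg.eq_integral]

/-- All densities agree almost everywhere, so the infimum is over a single value. -/
theorem localL2Norm_eq {T : Test → Spinor} {f g : Spacetime → Spinor}
    (hf : IsL2LocDensity T f) (hfg : f =ᵐ[volume] g) (S : ℝ) :
    localL2Norm S T = eLpNorm g 2 (volume.restrict (closedBall 0 S)) := by
  refine le_antisymm ((iInf₂_le f hf).trans_eq (eLpNorm_congr_ae (ae_restrict_of_ae hfg))) ?_
  exact le_iInf₂ fun h hh => le_of_eq
    (eLpNorm_congr_ae (ae_restrict_of_ae (hfg.symm.trans (hf.ae_eq hh))))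

/-- The product of a test function with a function which is smooth on `M°`. -/
def mulTest (b : Spacetime → ℝ) (hb : ContDiffOn ℝ (⊤ : ℕ∞) b interiorM) (φ : Test) : Test where
  toFun p := b p * φ p
  contDiff' := by
    refine contDiff_iff_contDiffAt.2 fun p => ?_
    by_cases hp : p ∈ tsupport φ
    · exact (hb.contDiffAt (interiorM.isOpen.mem_nhds (φ.tsupport_subset hp))).mul
        φ.contDiff.contDiffAt
    · refine contDiffAt_const (c := (0 : ℝ)) |>.congr_of_eventuallyEq ?_
      filter_upwards [(isClosed_tsupport φ).isOpen_compl.mem_nhds hp] with q hq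
      rw [image_eq_zero_of_notMem_tsupport hq, mul_zero]
  hasCompactSupport' := φ.hasCompactSupport.mul_left
  tsupport_subset' := (tsupport_mul_subset_right).trans φ.tsupport_subset

theorem fderiv_mulTest {b : Spacetime → ℝ} (hb : ContDiffOn ℝ (⊤ : ℕ∞) b interiorM) (φ : Test)
    {p : Spacetime} (hp : p ∈ interiorM) (v : Spacetime) :
    fderiv ℝ (mulTest b hb φ) p v = b p * fderiv ℝ φ p v + φ p * fderiv ℝ b p v := by
  have h1 := ((hb.contDiffAt (interiorM.isOpen.mem_nhds hp)).differentiableAt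
    (by simp)).hasFDerivAt
  have h2 := ((φ.contDiff.differentiable (by simp)) p).hasFDerivAt
  have e : (mulTest b hb φ : Spacetime → ℝ) = fun q => b q * φ q := rfl
  have h3 : HasFDerivAt (fun q => b q * φ q) _ p := h1.mul h2
  rw [e, h3.fderiv]
  simp

/-! ### Calculus of weak derivatives with coefficients smooth on `M°`. -/

theorem WeakDeriv.congr {F F' G G' : Spacetime → Spinor} {v : Spacetime} (h : WeakDeriv F G v)
    (hF : F =ᵐ[volume] F') (hG : G =ᵐ[volume] G') : WeakDeriv F' G' v := fun φ => by
  have h1 : ∫ p, fderiv ℝ φ p v • F' p = ∫ p, fderiv ℝ φ p v • F p :=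
    integral_congr_ae (hF.mono fun p hp => by simp only [hp])
  have h2 : ∫ p, φ p • G' p = ∫ p, φ p • G p :=
    integral_congr_ae (hG.mono fun p hp => by simp only [hp])
  rw [h1, h2, h φ]

theorem WeakDeriv.add {F F' G G' : Spacetime → Spinor} {v : Spacetime}
    (hF : LocallyIntegrableOn F interiorM) (hF' : LocallyIntegrableOn F' interiorM)
    (hG : LocallyIntegrableOn G interiorM) (hG' : LocallyIntegrableOn G' interiorM)
    (h : WeakDeriv F G v) (h' : WeakDeriv F' G' v) : WeakDeriv (F + F') (G + G') v := fun φ => by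
  simp only [Pi.add_apply, smul_add]
  rw [integral_add (φ.integrable_fderiv_smul hF v) (φ.integrable_fderiv_smul hF' v),
    integral_add (φ.integrable_smul hG) (φ.integrable_smul hG'), h φ, h' φ, neg_add]

theorem LocallyIntegrableOn.smooth_smul {b : Spacetime → ℝ}
    (hb : ContDiffOn ℝ (⊤ : ℕ∞) b interiorM) {F : Spacetime → Spinor}
    (hF : LocallyIntegrableOn F interiorM) : LocallyIntegrableOn (fun p => b p • F p) interiorM :=
  hF.continuousOn_smul interiorM.isOpen.isLocallyClosed hb.continuousOn

theorem contDiffOn_fderiv_apply {b : Spacetime → ℝ} (hb : ContDiffOn ℝ (⊤ : ℕ∞) b interiorM)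
    (v : Spacetime) : ContDiffOn ℝ (⊤ : ℕ∞) (fun p => fderiv ℝ b p v) interiorM :=
  (hb.fderiv_of_isOpen interiorM.isOpen (by simp)).clm_apply contDiffOn_const

/-- The Leibniz rule, from testing with `b φ`; `b` may blow up at the axis because `φ` vanishes near
it. -/
theorem WeakDeriv.smooth_smul {F G : Spacetime → Spinor} {v : Spacetime}
    (hF : LocallyIntegrableOn F interiorM) (hG : LocallyIntegrableOn G interiorM)
    (h : WeakDeriv F G v) {b : Spacetime → ℝ} (hb : ContDiffOn ℝ (⊤ : ℕ∞) b interiorM) :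
    WeakDeriv (fun p => b p • F p) (fun p => fderiv ℝ b p v • F p + b p • G p) v := fun φ => by
  have i1 := (mulTest b hb φ).integrable_fderiv_smul hF v
  have i2 := (mulTest b hb φ).integrable_smul hG
  have i3 := (mulTest _ (contDiffOn_fderiv_apply hb v) φ).integrable_smul hF
  have h1 : ∫ p, fderiv ℝ φ p v • b p • F p = ∫ p, (fderiv ℝ (mulTest b hb φ) p v • F p -
      mulTest _ (contDiffOn_fderiv_apply hb v) φ p • F p) := by
    refine integral_congr_ae (ae_mem_interiorM.mono fun p hp => ?_)
    simp only [fderiv_mulTest hb φ hp]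
    change _ = _ - (fderiv ℝ b p v * φ p) • F p
    rw [smul_smul, ← sub_smul]
    ring_nf
  have h2 : ∫ p, φ p • (fderiv ℝ b p v • F p + b p • G p) =
      ∫ p, (mulTest _ (contDiffOn_fderiv_apply hb v) φ p • F p + mulTest b hb φ p • G p) := by
    refine integral_congr_ae (.of_forall fun p => ?_)
    change φ p • (fderiv ℝ b p v • F p + b p • G p) =
      (fderiv ℝ b p v * φ p) • F p + (b p * φ p) • G p
    rw [smul_add, smul_smul, smul_smul, mul_comm (φ p), mul_comm (φ p)]
  rw [h1, h2, integral_sub i1 i3, integral_add i3 i2, h]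
  abel

/-- The linear part of the (affine) vector field `bField i`. -/
def bLin (i : Fin 5) : Spacetime →L[ℝ] Spacetime :=
  LinearMap.toContinuousLinearMap
  { toFun := fun p => bField i p - bField i 0
    map_add' := fun p q => by
      ext l
      · fin_cases i <;> simp [bField]
      · fin_cases i <;> fin_cases l <;> simp [bField] <;> ring
    map_smul' := fun c p => by
      ext l
      · fin_cases i <;> simp [bField]
      · fin_cases i <;> fin_cases l <;> simp [bField] }

theorem hasFDerivAt_bField (i : Fin 5) (p : Spacetime) :
    HasFDerivAt (bField i) (bLin i) p := by
  have h : bField i = fun q => bLin i q + bField i 0 := by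
    funext q
    simp [bLin]
  rw [h]
  exact (bLin i).hasFDerivAt.add_const _

theorem coord_succ (j : Fin 3) (p : Spacetime) : coord j.succ p = p.2 j := rfl

/-- The divergence of an affine field is the trace of its linear part. -/
theorem sum_coord_bLin (i : Fin 5) : ∑ j, coord j (bLin i (dir j)) = bDiv i := by
  rw [Fin.sum_univ_succ, Fin.sum_univ_three]
  simp only [dir_succ, coord_succ]
  fin_cases i <;> simp [bLin, bField, coord, dir, bDiv]
  norm_num

theorem contDiff_coord_bField (i : Fin 5) (j : Fin 4) :
    ContDiff ℝ (⊤ : ℕ∞) fun p => coord j (bField i p) :=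
  (coord j).contDiff.comp (contDiff_bField i)

theorem coord_dir (i j : Fin 4) : coord i (dir j) = if i = j then 1 else 0 := by
  refine Fin.cases ?_ (fun j => ?_) j <;> refine Fin.cases ?_ (fun i => ?_) i
  · simp [coord, dir]
  · simp [coord, dir]
  · simp [coord, dir, Fin.succ_ne_zero, eq_comm]
  · simp [coord, dir, eq_comm]

/-- The b-derivatives `f_w` of an element of `H_{b,loc}^{1,∞}` and their first derivatives. -/
structure IsBFamily (f : List (Fin 5) → Spacetime → Spinor)
    (g : List (Fin 5) → Fin 4 → Spacetime → Spinor) : Prop where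
  int : ∀ w, LocallyIntegrableOn (f w) interiorM
  int' : ∀ w j, LocallyIntegrableOn (g w j) interiorM
  weakDeriv : ∀ w j, WeakDeriv (f w) (g w j) (dir j)
  cons_eq : ∀ i w, f (i :: w) =ᵐ[volume] fun p => ∑ j, coord j (bField i p) • g w j p

theorem lineDeriv_test_apply (φ : Test) (v p : Spacetime) : (∂_{v} φ : Test) p =
    fderiv ℝ φ p v := by
  rw [TestFunction.lineDerivOp_eq_lineDerivCLM ℝ, TestFunction.lineDerivCLM_apply]
  exact ((φ.contDiff.differentiable (by simp)) p).lineDeriv_eq_fderiv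

theorem weakDeriv_of_isL2LocDensity {u : Distr} {w : List (Fin 5)} {f g : Spacetime → Spinor}
    {v : Spacetime} (hf : IsL2LocDensity (bWeak w u) f) (hg : IsL2LocDensity (dbWeak v w u) g) :
    WeakDeriv f g v := fun φ => by
  rw [← hg.eq_integral, show dbWeak v w u φ = bWeak w u (-∂_{v} φ) from rfl, hf.eq_integral,
    ← integral_neg]
  refine integral_congr_ae (.of_forall fun p => ?_)
  change _ = -((-(∂_{v} φ : Test) p) • f p)
  rw [lineDeriv_test_apply, neg_smul, neg_neg]

/-- The transpose in divergence form, `Vᵗ φ = -∑ ∂_j (V^j φ)`, to which weak coordinate derivatives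
apply directly. -/
theorem bTranspose_apply (i : Fin 5) (φ : Test) {p : Spacetime} (hp : p ∈ interiorM) :
    bTranspose i φ p =
      -∑ j, fderiv ℝ (mulTest _ (contDiff_coord_bField i j).contDiffOn φ) p (dir j) := by
  change -fderiv ℝ φ p (bField i p) - bDiv i * φ p = _
  simp only [fderiv_mulTest _ φ hp, Finset.sum_add_distrib]
  have h1 : ∑ j, coord j (bField i p) * fderiv ℝ φ p (dir j) = fderiv ℝ φ p (bField i p) := by
    conv_rhs => rw [← sum_coord_smul_dir (bField i p), map_sum]
    simp
  have h2 : ∀ j, fderiv ℝ (fun p => coord j (bField i p)) p (dir j) = coord j (bLin i (dir j)) :=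
    fun j => by
      have h3 : HasFDerivAt (fun p => coord j (bField i p)) _ p :=
        (coord j).hasFDerivAt.comp p (hasFDerivAt_bField i p)
      rw [h3.fderiv]
      rfl
  simp only [h1, h2, ← Finset.mul_sum, sum_coord_bLin]
  ring

theorem isBFamily_of_isL2LocDensity {u : Distr} {f : List (Fin 5) → Spacetime → Spinor}
    {g : List (Fin 5) → Fin 4 → Spacetime → Spinor}
    (hf : ∀ w, IsL2LocDensity (bWeak w u) (f w))
    (hg : ∀ w j, IsL2LocDensity (dbWeak (dir j) w u) (g w j)) : IsBFamily f g where
  int w := (hf w).locallyIntegrableOn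
  int' w j := (hg w j).locallyIntegrableOn
  weakDeriv w j := weakDeriv_of_isL2LocDensity (hf w) (hg w j)
  cons_eq i w := by
    have hint : ∀ j, LocallyIntegrableOn (fun p => coord j (bField i p) • g w j p) interiorM :=
      fun j => LocallyIntegrableOn.smooth_smul (contDiff_coord_bField i j).contDiffOn
        (hg w j).locallyIntegrableOn
    refine ae_eq_of_integral_test (hf _).locallyIntegrableOn ?_ fun φ => ?_
    · simp only [Fin.sum_univ_four]
      exact (((hint 0).add (hint 1)).add (hint 2)).add (hint 3)
    · rw [← (hf _).eq_integral, show bWeak (i :: w) u φ = bWeak w u (bTranspose i φ) from rfl,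
        (hf w).eq_integral]
      set ψ : Fin 4 → Test := fun j => mulTest _ (contDiff_coord_bField i j).contDiffOn φ with hψ
      calc ∫ p, bTranspose i φ p • f w p = ∫ p, -∑ j, fderiv ℝ (ψ j) p (dir j) • f w p := by
            refine integral_congr_ae (ae_mem_interiorM.mono fun p hp => ?_)
            simp only [bTranspose_apply i φ hp, neg_smul, Finset.sum_smul, hψ]
        _ = ∑ j, ∫ p, ψ j p • g w j p := by
            rw [integral_neg, integral_finsetSum _ fun j _ =>
              (ψ j).integrable_fderiv_smul (hf w).locallyIntegrableOn _, ← Finset.sum_neg_distrib]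
            refine Finset.sum_congr rfl fun j _ => ?_
            rw [weakDeriv_of_isL2LocDensity (hf w) (hg w j), neg_neg]
        _ = _ := by
            rw [← integral_finsetSum _ fun j _ =>
              (ψ j).integrable_smul (hg w j).locallyIntegrableOn]
            refine integral_congr_ae (.of_forall fun p => ?_)
            change ∑ j, (coord j (bField i p) * φ p) • g w j p = _
            simp only [Finset.smul_sum, smul_smul, mul_comm]

namespace IsBFamily

variable {f : List (Fin 5) → Spacetime → Spinor} {g : List (Fin 5) → Fin 4 → Spacetime → Spinor}

/-- Inverts `cons_eq` off the axis, by expanding `dir j` in b-fields. -/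
theorem eq_sum (h : IsBFamily f g) (w : List (Fin 5)) (j : Fin 4) :
    g w j =ᵐ[volume] fun p => ∑ i, dirCoef j i p • f (i :: w) p := by
  filter_upwards [ae_all_iff.2 fun i => h.cons_eq i w, ae_mem_interiorM] with p hp hpM
  simp only [hp, Finset.smul_sum, smul_smul]
  rw [Finset.sum_comm]
  simp only [← Finset.sum_smul]
  have h1 : ∀ l, ∑ i, dirCoef j i p * coord l (bField i p) = coord l (dir j) := fun l => by
    rw [dir_eq_sum hpM j, map_sum]
    simp
  simp [h1, coord_dir]

/-- The module over smooth functions on `M°` generated by a family of b-derivatives. -/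
def module (f : List (Fin 5) → Spacetime → Spinor) : AddSubmonoid (Spacetime → Spinor) :=
  AddSubmonoid.closure {H | ∃ (w : List (Fin 5)) (b : Spacetime → ℝ),
      ContDiffOn ℝ (⊤ : ℕ∞) b interiorM ∧ H = fun p => b p • f w p}

theorem smul_mem_module (f : List (Fin 5) → Spacetime → Spinor) (w : List (Fin 5))
    {b : Spacetime → ℝ} (hb : ContDiffOn ℝ (⊤ : ℕ∞) b interiorM) :
    (fun p => b p • f w p) ∈ module f :=
  AddSubmonoid.subset_closure ⟨w, b, hb, rfl⟩

theorem mem_module (f : List (Fin 5) → Spacetime → Spinor) (w : List (Fin 5)) : f w ∈ module f := by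
  simpa using smul_mem_module f w (b := fun _ => 1) contDiffOn_const

theorem sum_mem_module (f : List (Fin 5) → Spacetime → Spinor) (w : List (Fin 5))
    {b : Fin 5 → Spacetime → ℝ} (hb : ∀ i, ContDiffOn ℝ (⊤ : ℕ∞) (b i) interiorM) :
    (fun p => ∑ i, b i p • f (i :: w) p) ∈ module f := by
  have : (fun p => ∑ i, b i p • f (i :: w) p) = ∑ i, fun p => b i p • f (i :: w) p := by
    ext1 p
    simp
  rw [this]
  exact sum_mem fun i _ => smul_mem_module f _ (hb i)

theorem locallyIntegrableOn_module (h : IsBFamily f g) {F : Spacetime → Spinor}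
    (hF : F ∈ module f) : LocallyIntegrableOn F interiorM := by
  unfold module at hF
  induction hF using AddSubmonoid.closure_induction with
  | mem x hx =>
    obtain ⟨w, b, hb, rfl⟩ := hx
    exact LocallyIntegrableOn.smooth_smul hb (h.int w)
  | zero => exact (locallyIntegrable_zero).locallyIntegrableOn _
  | add x y _ _ hx hy => exact hx.add hy

/-- Leibniz, together with `∂_j f_w = ∑ dirCoef j i • f_{i :: w}`: only b-derivatives and
coefficients smooth on `M°` appear. The first derivatives `g` are thus already in the module. -/
theorem closedUnderWeakDeriv (h : IsBFamily f g) :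
    ClosedUnderWeakDeriv (module f : Set (Spacetime → Spinor)) where
  locallyIntegrableOn F hF := h.locallyIntegrableOn_module hF
  exists_weakDeriv F hF j := by
    replace hF : F ∈ AddSubmonoid.closure _ := hF
    induction hF using AddSubmonoid.closure_induction with
    | mem x hx =>
      obtain ⟨w, b, hb, rfl⟩ := hx
      refine ⟨_, add_mem (smul_mem_module f w (contDiffOn_fderiv_apply hb (dir j)))
        (sum_mem_module f w (b := fun i p => b p * dirCoef j i p)
          fun i => hb.mul (contDiffOn_dirCoef j i _)),
        (WeakDeriv.smooth_smul (h.int w) (h.int' w j) (h.weakDeriv w j) hb).congr (ae_eq_refl _)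
          ((h.eq_sum w j).mono fun p hp => ?_)⟩
      simp only [hp, Pi.add_apply, Finset.smul_sum, smul_smul]
    | zero => exact ⟨0, zero_mem _, fun φ => by simp⟩
    | add x y hx hy hx' hy' =>
      obtain ⟨G, hG, hG'⟩ := hx'
      obtain ⟨H, hH, hH'⟩ := hy'
      exact ⟨G + H, add_mem hG hH, WeakDeriv.add (h.locallyIntegrableOn_module hx)
        (h.locallyIntegrableOn_module hy) (h.locallyIntegrableOn_module hG)
        (h.locallyIntegrableOn_module hH) hG' hH'⟩

theorem ae_eq_rep (h : IsBFamily f g) {F : Spacetime → Spinor} (hF : F ∈ module f) :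
    F =ᵐ[volume] rep F := by
  filter_upwards [DiracCoulomb.ae_eq_rep h.closedUnderWeakDeriv hF, ae_mem_interiorM] with p hp hM
  exact hp hM

theorem fderiv_rep_ae (h : IsBFamily f g) (w : List (Fin 5)) :
    ∀ᵐ p, ∀ v, fderiv ℝ (rep (f w)) p v = ∑ j, coord j v • g w j p := by
  have hm : ∀ j, (fun p => ∑ i, dirCoef j i p • f (i :: w) p) ∈ module f := fun j =>
    sum_mem_module f w fun i => contDiffOn_dirCoef j i _
  filter_upwards [ae_all_iff.2 fun j => h.eq_sum w j, ae_all_iff.2 fun j => h.ae_eq_rep (hm j),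
    ae_mem_interiorM] with p h1 h2 hM v
  rw [(hasFDerivAt_rep h.closedUnderWeakDeriv (mem_module f w) hm
    (fun j => (h.weakDeriv w j).congr (ae_eq_refl _) (h.eq_sum w j)) hM).fderiv]
  simp [h1, ← h2]

theorem fderiv_rep_bField (h : IsBFamily f g) (w : List (Fin 5)) (i : Fin 5) {p : Spacetime}
    (hp : p ∈ interiorM) : fderiv ℝ (rep (f w)) p (bField i p) = rep (f (i :: w)) p := by
  have h1 : (fun p => fderiv ℝ (rep (f w)) p (bField i p)) =ᵐ[volume] rep (f (i :: w)) := by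
    filter_upwards [h.fderiv_rep_ae w, h.cons_eq i w, h.ae_eq_rep (mem_module f (i :: w))]
      with p h1 h2 h3
    rw [h1, ← h3, h2]
  have hc := contDiffOn_rep h.closedUnderWeakDeriv 1 _ (mem_module f w)
  -- An a.e. identity between continuous functions holds everywhere on the open set `M°`.
  refine Measure.eqOn_open_of_ae_eq (ae_restrict_of_ae h1) interiorM.isOpen ?_
    (continuousOn_rep h.closedUnderWeakDeriv (mem_module f _)) hp
  exact (hc.continuousOn_fderiv_of_isOpen interiorM.isOpen (by simp)).clm_apply
    (contDiff_bField i).continuous.continuousOn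

end IsBFamily

/-- Replaces the weak b-derivatives by classical ones without changing any seminorm. Order `2` is
what the commutator of a b-field with the gradient requires. -/
theorem exists_smooth_family (u : HbLocInf) : ∃ F : List (Fin 5) → Spacetime → Spinor,
    (∀ w, ContDiffOn ℝ 2 (F w) interiorM) ∧
    (∀ w i, ∀ p ∈ interiorM, fderiv ℝ (F w) p (bField i p) = F (i :: w) p) ∧
    (∀ w S, localL2Norm S (bWeak w (u : Distr)) =
      eLpNorm (F w) 2 (volume.restrict (closedBall 0 S))) ∧
    (∀ w j S, localL2Norm S (dbWeak (dir j) w (u : Distr)) =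
      eLpNorm (fun p => fderiv ℝ (F w) p (dir j)) 2 (volume.restrict (closedBall 0 S))) ∧
    ∀ φ : Test, (u : Distr) φ = ∫ p, φ p • F [] p := by
  choose f hf using fun w => (u.2 w).1
  choose g hg using fun w (j : Fin 4) => (u.2 w).2 (dir j)
  have h := isBFamily_of_isL2LocDensity hf hg
  refine ⟨fun w => rep (f w), fun w => contDiffOn_rep h.closedUnderWeakDeriv 2 _
      (IsBFamily.mem_module f w), fun w i p hp => h.fderiv_rep_bField w i hp,
    fun w S => localL2Norm_eq (hf w) (h.ae_eq_rep (IsBFamily.mem_module f w)) S,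
    fun w j S => localL2Norm_eq (hg w j) ((h.fderiv_rep_ae w).mono fun p hp => ?_) S, fun φ => ?_⟩
  · simp [hp, coord_dir]
  · rw [show (u : Distr) φ = bWeak [] (u : Distr) φ from rfl, (hf []).eq_integral]
    exact integral_congr_ae ((h.ae_eq_rep (IsBFamily.mem_module f [])).mono fun p hp => by
      simp only [hp])

/-! ### Pointwise bounds for elements of `H_{b,loc}^{1,∞}` -/

/-- The smooth representative of an element of `H_{b,loc}^{1,∞}`. -/
def val (u : HbLocInf) : Spacetime → Spinor :=
  (interiorM : Set Spacetime).indicator (Classical.choose (exists_smooth_family u) [])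

/-- A seminorm of `H_{b,loc}^{1,∞}`, controlling four b-derivatives. -/
def locNorm (S : ℝ) (u : Distr) : ℝ≥0∞ :=
  ∑ m ∈ Finset.range 5, ∑ w : Fin m → Fin 5, (localL2Norm S (bWeak (List.ofFn w) u) +
    ∑ j, localL2Norm S (dbWeak (dir j) (List.ofFn w) u))

theorem val_integral (u : HbLocInf) (φ : Test) : (u : Distr) φ = ∫ p, φ p • val u p := by
  rw [(Classical.choose_spec (exists_smooth_family u)).2.2.2.2 φ]
  refine integral_congr_ae (ae_mem_interiorM.mono fun p hp => ?_)
  simp only [val, indicator_of_mem (show p ∈ (interiorM : Set Spacetime) from hp)]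

theorem contDiffOn_val (u : HbLocInf) : ContDiffOn ℝ 2 (val u) interiorM :=
  ((Classical.choose_spec (exists_smooth_family u)).1 []).congr fun p hp => by
    rw [val, indicator_of_mem hp]

theorem eqOn_of_integral_test {F G : Spacetime → Spinor} (hF : ContinuousOn F interiorM)
    (hG : ContinuousOn G interiorM) (h : ∀ φ : Test, ∫ p, φ p • F p = ∫ p, φ p • G p) :
    EqOn F G interiorM :=
  Measure.eqOn_open_of_ae_eq (ae_restrict_of_ae (ae_eq_of_integral_test
    (hF.locallyIntegrableOn interiorM.isOpen.measurableSet)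
    (hG.locallyIntegrableOn interiorM.isOpen.measurableSet) h)) interiorM.isOpen hF hG

/-- Makes `val` independent of the choices in its definition: a continuous density is unique on
`M°`. -/
theorem val_eq {u : HbLocInf} {F : Spacetime → Spinor} (hF : ContinuousOn F interiorM)
    (h : ∀ φ : Test, (u : Distr) φ = ∫ p, φ p • F p) {p : Spacetime} (hp : p ∈ interiorM) :
    val u p = F p :=
  eqOn_of_integral_test (contDiffOn_val u).continuousOn hF
    (fun φ => by rw [← h, val_integral]) hp

/-- The normalisation on the axis makes `val` linear at every point, so that `kernel` is defined for
all `p` and `q`. -/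
theorem val_of_notMem (u : HbLocInf) {p : Spacetime} (hp : p ∉ interiorM) : val u p = 0 :=
  indicator_of_notMem hp _

theorem val_add (u v : HbLocInf) (p : Spacetime) : val (u + v) p = val u p + val v p := by
  by_cases hp : p ∈ interiorM
  · refine val_eq (F := fun p => val u p + val v p)
      ((contDiffOn_val u).continuousOn.add (contDiffOn_val v).continuousOn) (fun φ => ?_) hp
    have h := fun u : HbLocInf => φ.integrable_smul
      ((contDiffOn_val u).continuousOn.locallyIntegrableOn interiorM.isOpen.measurableSet)
    simp only [smul_add]
    rw [integral_add (h u) (h v), ← val_integral, ← val_integral]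
    rfl
  · simp [val_of_notMem _ hp]

theorem val_smul (c : ℂ) (u : HbLocInf) (p : Spacetime) : val (c • u) p = c • val u p := by
  by_cases hp : p ∈ interiorM
  · refine val_eq (F := fun p => c • val u p)
      ((contDiffOn_val u).continuousOn.const_smul c) (fun φ => ?_) hp
    simp only [smul_comm _ c]
    rw [integral_smul, ← val_integral]
    rfl
  · simp [val_of_notMem _ hp]

/-- Differentiating `V F_w = F_{i :: w}` and using the symmetry of second derivatives gives `V
(∇F_w) = ∇F_{i :: w} - ∇F_w ∘ DV`, where `DV` is the constant map `bLin i`. -/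
theorem fderiv_fderiv_bField_le {F : List (Fin 5) → Spacetime → Spinor}
    (hF : ∀ w, ContDiffOn ℝ 2 (F w) interiorM)
    (hb : ∀ w i, ∀ p ∈ interiorM, fderiv ℝ (F w) p (bField i p) = F (i :: w) p)
    (w : List (Fin 5)) (i : Fin 5) {z : Spacetime} (hz : z ∈ interiorM) :
    ‖fderiv ℝ (fderiv ℝ (F w)) z (bField i z)‖ₑ ≤
      ‖fderiv ℝ (F (i :: w)) z‖ₑ + (∑ i, ‖bLin i‖₊ : ℝ≥0) * ‖fderiv ℝ (F w) z‖ₑ := by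
  have hU := interiorM.isOpen.mem_nhds hz
  have hc := (hF w).contDiffAt hU
  have h1 : HasFDerivAt (fderiv ℝ (F w)) (fderiv ℝ (fderiv ℝ (F w)) z) z :=
    ((hc.fderiv_right (m := 1) (by norm_num)).differentiableAt (by simp)).hasFDerivAt
  have h2 := h1.clm_apply (hasFDerivAt_bField i z)
  have h3 : fderiv ℝ (F (i :: w)) z = _ := (h2.congr_of_eventuallyEq
    (f₁ := F (i :: w)) (by filter_upwards [hU] with q hq using (hb w i q hq).symm)).fderiv
  have hsymm := (hc.isSymmSndFDerivAt (by simp)).eq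
  have h4 : fderiv ℝ (fderiv ℝ (F w)) z (bField i z) =
      fderiv ℝ (F (i :: w)) z - (fderiv ℝ (F w) z).comp (bLin i) := by
    refine ContinuousLinearMap.ext fun v => ?_
    rw [h3, hsymm]
    simp
  rw [h4]
  refine enorm_sub_le.trans (add_le_add le_rfl ?_)
  rw [mul_comm]
  refine (ContinuousLinearMap.opENorm_comp_le _ _).trans (mul_le_mul_right ?_ _)
  rw [enorm_eq_nnnorm, ENNReal.coe_le_coe]
  exact Finset.single_le_sum (f := fun i => ‖bLin i‖₊) (fun _ _ => zero_le) (Finset.mem_univ i)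

/-- The b-Sobolev inequality, once for the b-derivatives (no lower-order term) and once for their
gradients (with the commutator term). -/
theorem exists_val_le : ∃ K : ℝ≥0, ∀ (u : HbLocInf) (S : ℝ), ∀ p ∈ interiorM, 3 * ‖p‖ + 1 ≤ S →
    ‖val u p‖ₑ ≤ K * ‖p.2‖ₑ ^ (-(3 / 2) : ℝ) * locNorm S u ∧
    ‖fderiv ℝ (val u) p‖ₑ ≤ K * ‖p.2‖ₑ ^ (-(3 / 2) : ℝ) * locNorm S u := by
  obtain ⟨K₁, hK₁⟩ := exists_enorm_le_wordNorm Spinor 0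
  obtain ⟨K₂, hK₂⟩ := exists_enorm_le_wordNorm (Spacetime →L[ℝ] Spinor) (∑ i, ‖bLin i‖₊)
  refine ⟨K₁ + K₂, fun u S p hp hS => ?_⟩
  have hsp := Classical.choose_spec (exists_smooth_family u)
  set F := Classical.choose (exists_smooth_family u) with hFdef
  obtain ⟨hF, hb, hn, hn', -⟩ := hsp
  have hval : ∀ q ∈ interiorM, val u q = F [] q := fun q hq => by
    rw [val, indicator_of_mem (show q ∈ (interiorM : Set Spacetime) from hq)]
  constructor
  · rw [hval p hp]
    refine (hK₁ F (fun w => (hF w).of_le (by norm_num))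
      (fun w i z hz => by rw [hb w i z hz]; simp) p hp S hS).trans ?_
    gcongr
    · exact le_self_add
    · refine Finset.sum_le_sum fun m _ => Finset.sum_le_sum fun w _ => ?_
      rw [← hn]
      exact le_self_add
  · have hv : fderiv ℝ (val u) p = fderiv ℝ (F []) p := Filter.EventuallyEq.fderiv_eq (by
      filter_upwards [interiorM.isOpen.mem_nhds hp] with q hq using hval q hq)
    rw [hv]
    refine (hK₂ (fun w => fderiv ℝ (F w)) (fun w => (hF w).fderiv_of_isOpen interiorM.isOpen
      (by norm_num)) (fun w i z hz => fderiv_fderiv_bField_le hF hb w i hz) p hp S hS).trans ?_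
    gcongr
    · exact le_add_self
    · refine Finset.sum_le_sum fun m _ => Finset.sum_le_sum fun w _ => ?_
      refine le_trans ?_ (le_add_self)
      have hmeas : ∀ j, AEStronglyMeasurable (fun q => fderiv ℝ (F (List.ofFn w)) q (dir j))
          (volume.restrict (closedBall 0 S)) := fun j => by
        have h1 : ContinuousOn (fun q => fderiv ℝ (F (List.ofFn w)) q (dir j)) interiorM :=
          ((hF _).continuousOn_fderiv_of_isOpen interiorM.isOpen (by norm_num)).clm_apply
            continuousOn_const
        have h2 : volume.restrict (interiorM : Set Spacetime) = volume :=
          Measure.restrict_eq_self_of_ae_mem ae_mem_interiorM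
        have h3 := h1.aestronglyMeasurable (μ := volume) interiorM.isOpen.measurableSet
        rw [h2] at h3
        exact h3.restrict
      calc eLpNorm (fderiv ℝ (F (List.ofFn w))) 2 (volume.restrict (closedBall 0 S))
          ≤ eLpNorm (∑ j, fun q => ‖fderiv ℝ (F (List.ofFn w)) q (dir j)‖) 2
            (volume.restrict (closedBall 0 S)) := by
            refine eLpNorm_mono_real fun q => ?_
            rw [Finset.sum_apply]
            exact norm_clm_le_sum _
        _ ≤ ∑ j, eLpNorm (fun q => ‖fderiv ℝ (F (List.ofFn w)) q (dir j)‖) 2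
            (volume.restrict (closedBall 0 S)) :=
            eLpNorm_sum_le (fun j _ => (hmeas j).norm) (by norm_num)
        _ = _ := by
            refine Finset.sum_congr rfl fun j _ => ?_
            rw [eLpNorm_norm, hn']

/-- Integration of the gradient bound along a ray improves the bound by one power of `r`. -/
theorem exists_val_le_rpow (R : ℝ) : ∃ K : ℝ, 0 ≤ K ∧ ∀ (u : HbLocInf) (b : ℝ), 0 ≤ b →
    locNorm (3 * R + 1) u ≤ ENNReal.ofReal b → ∀ p : Spacetime, |p.1| ≤ R → 0 < ‖p.2‖ →
      ‖p.2‖ ≤ R → ‖val u p‖ ≤ K * ‖p.2‖ ^ (-(1 / 2) : ℝ) * b := by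
  obtain ⟨K, hK⟩ := exists_val_le
  by_cases hR : 0 < R
  swap
  · exact ⟨0, le_rfl, fun u b _ _ p _ h1 h2 => absurd (h1.trans_le h2) hR⟩
  -- `R⁻¹` comes from the value at radius `R`, and `2` from the growth along the ray.
  refine ⟨K * (R⁻¹ + 2), by positivity, fun u b hb0 hb p hp1 hp2 hp3 => ?_⟩
  have hreal : ∀ q : Spacetime, |q.1| ≤ R → 0 < ‖q.2‖ → ‖q.2‖ ≤ R →
      ‖val u q‖ ≤ K * ‖q.2‖ ^ (-(3 / 2) : ℝ) * b ∧
      ‖fderiv ℝ (val u) q‖ ≤ K * ‖q.2‖ ^ (-(3 / 2) : ℝ) * b := by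
    intro q h1 h2 h3
    have hq : ‖q‖ ≤ R := by
      rw [Prod.norm_def]
      exact sup_le h1 h3
    have e : (K : ℝ≥0∞) * ‖q.2‖ₑ ^ (-(3 / 2) : ℝ) * locNorm (3 * R + 1) u ≤
        ENNReal.ofReal (K * ‖q.2‖ ^ (-(3 / 2) : ℝ) * b) := by
      rw [ENNReal.ofReal_mul (by positivity), ENNReal.ofReal_mul (by positivity),
        ENNReal.ofReal_coe_nnreal, ← ENNReal.ofReal_rpow_of_pos h2, ofReal_norm]
      gcongr
    obtain ⟨b1, b2⟩ := hK u (3 * R + 1) q (norm_pos_iff.1 h2) (by linarith)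
    have hnn : 0 ≤ K * ‖q.2‖ ^ (-(3 / 2) : ℝ) * b := by positivity
    constructor
    · rw [← ENNReal.ofReal_le_ofReal_iff hnn, ofReal_norm]
      exact b1.trans e
    · rw [← ENNReal.ofReal_le_ofReal_iff hnn, ofReal_norm]
      exact b2.trans e
  set r := ‖p.2‖ with hr
  set ω : EuclideanSpace ℝ (Fin 3) := r⁻¹ • p.2 with hω
  have hωn : ‖ω‖ = 1 := by
    rw [hω, norm_smul, norm_inv, norm_norm, inv_mul_cancel₀ hp2.ne']
  -- The ray is parametrised by `ρ = σ^{-2}`. Then `|dρ/dσ| = 2 σ^{-3}` cancels `ρ^{-3/2} = σ³`, so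
  -- the derivative of `h` is bounded by a constant and the mean value inequality yields growth
  -- linear in `σ = ρ^{-1/2}`.
  set h : ℝ → Spinor := fun σ => val u (p.1, σ ^ (-2 : ℝ) • ω) with hh
  have hpow : ∀ ρ : ℝ, 0 < ρ → (ρ ^ (-(1 / 2) : ℝ)) ^ (-2 : ℝ) = ρ := fun ρ hρ => by
    rw [← Real.rpow_mul hρ.le]
    norm_num
  set α := R ^ (-(1 / 2) : ℝ) with hα
  set β := r ^ (-(1 / 2) : ℝ) with hβ
  have hα0 : 0 < α := Real.rpow_pos_of_pos hR _
  have hβ0 : 0 < β := Real.rpow_pos_of_pos hp2 _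
  have hαβ : α ≤ β := Real.rpow_le_rpow_of_nonpos hp2 hp3 (by norm_num)
  have hhβ : h β = val u p := by
    simp only [hh, hβ, hpow r hp2, hω, smul_smul, mul_inv_cancel₀ hp2.ne', one_smul]
  have hρ : ∀ σ ∈ Icc α β, 0 < σ ∧ 0 < ‖σ ^ (-2 : ℝ) • ω‖ ∧
      ‖σ ^ (-2 : ℝ) • ω‖ = σ ^ (-2 : ℝ) ∧ ‖σ ^ (-2 : ℝ) • ω‖ ≤ R := by
    intro σ hσ
    have hσ0 : 0 < σ := hα0.trans_le hσ.1
    have h1 : ‖σ ^ (-2 : ℝ) • ω‖ = σ ^ (-2 : ℝ) := by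
      rw [norm_smul, hωn, mul_one, Real.norm_of_nonneg (Real.rpow_pos_of_pos hσ0 _).le]
    refine ⟨hσ0, ?_, h1, ?_⟩
    · rw [h1]; exact Real.rpow_pos_of_pos hσ0 _
    · rw [h1, ← hpow R hR]
      exact Real.rpow_le_rpow_of_nonpos hα0 hσ.1 (by norm_num)
  have hderiv : ∀ σ ∈ Icc α β, HasDerivWithinAt h (fderiv ℝ (val u) (p.1, σ ^ (-2 : ℝ) • ω)
      (0, (-2 * σ ^ (-3 : ℝ)) • ω)) (Icc α β) σ := by
    intro σ hσ
    obtain ⟨hσ0, h1, -, -⟩ := hρ σ hσ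
    have h2 : HasFDerivAt (val u) (fderiv ℝ (val u) (p.1, σ ^ (-2 : ℝ) • ω))
        (p.1, σ ^ (-2 : ℝ) • ω) :=
      (((contDiffOn_val u).contDiffAt (interiorM.isOpen.mem_nhds
        (norm_pos_iff.1 h1 : (p.1, σ ^ (-2 : ℝ) • ω) ∈ interiorM))).differentiableAt
          (by norm_num)).hasFDerivAt
    have h3 : HasDerivAt (fun σ : ℝ => (p.1, σ ^ (-2 : ℝ) • ω))
        ((0, (-2 * σ ^ (-3 : ℝ)) • ω) : Spacetime) σ := by
      have h4 := (Real.hasDerivAt_rpow_const (x := σ) (p := -2) (Or.inl hσ0.ne')).smul_const ω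
      have h5 : ((-2 : ℝ) - 1) = -3 := by norm_num
      rw [h5] at h4
      exact (hasDerivAt_const σ p.1).prodMk h4
    exact (h2.comp_hasDerivAt σ h3).hasDerivWithinAt
  have hbound : ∀ σ ∈ Ico α β, ‖fderiv ℝ (val u) (p.1, σ ^ (-2 : ℝ) • ω)
      (0, (-2 * σ ^ (-3 : ℝ)) • ω)‖ ≤ 2 * K * b := by
    intro σ hσ
    obtain ⟨hσ0, h1, h2, h3⟩ := hρ σ ⟨hσ.1, hσ.2.le⟩
    have h4 := (hreal (p.1, σ ^ (-2 : ℝ) • ω) hp1 h1 h3).2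
    have h5 : ‖((0, (-2 * σ ^ (-3 : ℝ)) • ω) : Spacetime)‖ = 2 * σ ^ (-3 : ℝ) := by
      rw [Prod.norm_def]
      simp only [norm_zero, norm_smul, hωn, mul_one, norm_mul, norm_neg]
      rw [Real.norm_of_nonneg (Real.rpow_pos_of_pos hσ0 _).le]
      have h7 : (0 : ℝ) ≤ σ ^ (-3 : ℝ) := (Real.rpow_pos_of_pos hσ0 _).le
      rw [Real.norm_ofNat, max_eq_right (by positivity)]
    have h6 : (σ ^ (-2 : ℝ)) ^ (-(3 / 2) : ℝ) * σ ^ (-3 : ℝ) = 1 := by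
      rw [← Real.rpow_mul hσ0.le, ← Real.rpow_add hσ0]
      norm_num
    calc _ ≤ (K * ‖σ ^ (-2 : ℝ) • ω‖ ^ (-(3 / 2) : ℝ) * b) * (2 * σ ^ (-3 : ℝ)) := by
          rw [← h5]
          exact (ContinuousLinearMap.le_opNorm _ _).trans
            (mul_le_mul_of_nonneg_right h4 (norm_nonneg _))
      _ = 2 * K * b * ((σ ^ (-2 : ℝ)) ^ (-(3 / 2) : ℝ) * σ ^ (-3 : ℝ)) := by
          rw [h2]; ring
      _ = 2 * K * b := by rw [h6, mul_one]
  have hmv := norm_image_sub_le_of_norm_deriv_le_segment' hderiv hbound β ⟨hαβ, le_rfl⟩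
  -- At the outer end of the ray `|x| = R`, and `R^{-3/2} = R⁻¹ α ≤ R⁻¹ β`.
  have hαv : ‖h α‖ ≤ K * (R⁻¹ * β) * b := by
    obtain ⟨-, h1, h2, h3⟩ := hρ α ⟨le_rfl, hαβ⟩
    refine (hreal (p.1, α ^ (-2 : ℝ) • ω) hp1 h1 h3).1.trans ?_
    rw [h2, hα, hpow R hR]
    gcongr
    have : R ^ (-(3 / 2) : ℝ) = R⁻¹ * α := by
      rw [← Real.rpow_neg_one, hα, ← Real.rpow_add hR]
      norm_num
    rw [this]
    gcongr
  calc ‖val u p‖ = ‖h β‖ := by rw [hhβ]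
    _ ≤ ‖h α‖ + ‖h β - h α‖ := by
        simpa using norm_add_le (h α) (h β - h α)
    _ ≤ K * (R⁻¹ * β) * b + 2 * K * b * (β - α) := add_le_add hαv hmv
    _ ≤ K * (R⁻¹ * β) * b + 2 * K * b * β := by
        have : 0 ≤ 2 * K * b := by positivity
        gcongr
        linarith
    _ = _ := by ring

theorem IsContinuousOperator.exists_locNorm_le {Λ : HbcNegInf →ₗ[ℂ] HbLocInf}
    (hΛ : IsContinuousOperator Λ) (k : ℕ) (R S : ℝ) : ∃ C : ℝ≥0, ∀ u : HbcNegInf,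
      SupportedInBall R u → locNorm S (Λ u : Distr) ≤ C * bDualNorm k u := by
  choose C hC using fun w : List (Fin 5) => (hΛ k R w S).1
  choose D hD using fun (w : List (Fin 5)) (j : Fin 4) => (hΛ k R w S).2 (dir j)
  refine ⟨∑ m ∈ Finset.range 5, ∑ w : Fin m → Fin 5, (C (List.ofFn w) + ∑ j, D (List.ofFn w) j),
    fun u hu => ?_⟩
  rw [locNorm]
  push_cast
  rw [Finset.sum_mul]
  refine Finset.sum_le_sum fun m _ => ?_
  rw [Finset.sum_mul]
  refine Finset.sum_le_sum fun w _ => ?_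
  rw [add_mul, Finset.sum_mul]
  exact add_le_add (hC _ u hu) (Finset.sum_le_sum fun j _ => hD _ j u hu)

/-! ### Dirac distributions -/

/-- The distribution `φ ↦ φ(q) z`. -/
def dirac (q : Spacetime) (z : Spinor) : Distr :=
  ((BoundedContinuousFunction.evalCLM ℝ q).comp
    (TestFunction.toBoundedContinuousFunctionCLM ℝ)).smulRight z

theorem dirac_apply (q : Spacetime) (z : Spinor) (φ : Test) : dirac q z φ = φ q • z := rfl

/-- The b-derivatives of a test function form a family as in the b-Sobolev inequality with `A = 0`.
Dualised, this is the bound on Dirac distributions. -/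
theorem exists_enorm_test_le : ∃ K : ℝ≥0, ∀ (φ : Test), ∀ q ∈ interiorM,
    ‖φ q‖ₑ ≤ K * ‖q.2‖ₑ ^ (-(3 / 2) : ℝ) * bNorm 4 φ := by
  obtain ⟨K, hK⟩ := exists_enorm_le_wordNorm ℝ 0
  refine ⟨K, fun φ q hq => (hK (fun w => bDerivWord w φ)
    (fun w => ((bDerivWord w φ).contDiff.of_le (by simp)).contDiffOn)
    (fun w i z _ => ?_) q hq _ le_rfl).trans ?_⟩
  · change ‖(bDerivWord (i :: w) φ) z‖ₑ ≤ _
    exact le_self_add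
  · gcongr
    exact Finset.sum_le_sum fun m _ => Finset.sum_le_sum fun w _ =>
      eLpNorm_mono_measure _ Measure.restrict_le_self

/-- In `bDerivWord` the last letter acts first, so the extra derivative is appended at the end of
the word. -/
theorem bNorm_bDeriv_le (k : ℕ) (i : Fin 5) (φ : Test) :
    bNorm k (bDeriv i φ) ≤ bNorm (k + 1) φ := by
  rw [bNorm, bNorm, Finset.sum_range_succ' _ (k + 1)]
  refine le_add_right (Finset.sum_le_sum fun m _ => ?_)
  rw [← (Fin.snocEquiv fun _ => Fin 5).sum_comp, Fintype.sum_prod_type]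
  have h : ∀ w : Fin m → Fin 5, bDerivWord (List.ofFn w) (bDeriv i φ) =
      bDerivWord (List.ofFn (Fin.snocEquiv (fun _ => Fin 5) (i, w))) φ := fun w => by
    rw [List.ofFn_succ_last]
    simp [Fin.snocEquiv, bDerivWord]
  simp only [h]
  exact Finset.single_le_sum (f := fun i => ∑ w : Fin m → Fin 5,
    eLpNorm (bDerivWord (List.ofFn (Fin.snocEquiv (fun _ => Fin 5) (i, w))) φ) 2 volume)
    (fun _ _ => zero_le) (Finset.mem_univ i)

theorem test_eq_zero_of_notMem (φ : Test) {q : Spacetime} (hq : q ∉ interiorM) : φ q = 0 :=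
  image_eq_zero_of_notMem_tsupport fun h => hq (φ.tsupport_subset h)

theorem bNorm_lt_top (k : ℕ) (φ : Test) : bNorm k φ < ∞ :=
  ENNReal.sum_lt_top.2 fun _ _ => ENNReal.sum_lt_top.2 fun w _ =>
    ((bDerivWord (List.ofFn w) φ).continuous.memLp_of_hasCompactSupport
      (bDerivWord (List.ofFn w) φ).hasCompactSupport).2

theorem bDualNorm_le {k : ℕ} {u : Distr} {b : ℝ≥0∞} (h : ∀ φ, ‖u φ‖ₑ ≤ b * bNorm k φ) :
    bDualNorm k u ≤ b :=
  iSup_le fun φ => ENNReal.div_le_of_le_mul (h φ)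

theorem exists_bDualNorm_dirac_le : ∃ K : ℝ≥0, ∀ q ∈ interiorM, ∀ z,
    bDualNorm 4 (dirac q z) ≤ K * ‖q.2‖ₑ ^ (-(3 / 2) : ℝ) * ‖z‖ₑ := by
  obtain ⟨K, hK⟩ := exists_enorm_test_le
  refine ⟨K, fun q hq z => bDualNorm_le fun φ => ?_⟩
  rw [dirac_apply, enorm_smul]
  calc ‖φ q‖ₑ * ‖z‖ₑ ≤ K * ‖q.2‖ₑ ^ (-(3 / 2) : ℝ) * bNorm 4 φ * ‖z‖ₑ := by
        gcongr
        exact hK φ q hq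
    _ = _ := by ring

theorem dirac_mem (q : Spacetime) (z : Spinor) : dirac q z ∈ HbcNegInf := by
  refine ⟨⟨4, ?_⟩, ‖q‖, fun φ hφ => ?_⟩
  · by_cases hq : q ∈ interiorM
    · obtain ⟨K, hK⟩ := exists_bDualNorm_dirac_le
      refine (hK q hq z).trans_lt (ENNReal.mul_lt_top (ENNReal.mul_lt_top (by simp) ?_) (by simp))
      exact (ENNReal.rpow_ne_top_of_ne_zero (enorm_ne_zero.2 hq) enorm_ne_top).lt_top
    -- Test functions vanish on the axis, so the distribution is zero there.
    · refine (bDualNorm_le (b := 0) fun φ => ?_).trans_lt (by simp)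
      rw [dirac_apply, test_eq_zero_of_notMem φ hq]
      simp
  · rw [dirac_apply, image_eq_zero_of_notMem_tsupport fun h => disjoint_left.1 hφ h (by simp),
      zero_smul]

theorem dirac_supported {q : Spacetime} {R : ℝ} (hq : ‖q‖ ≤ R) (z : Spinor) :
    SupportedInBall R (dirac q z) := fun φ hφ => by
  rw [dirac_apply, image_eq_zero_of_notMem_tsupport fun h => disjoint_left.1 hφ h (by simpa),
    zero_smul]

theorem SupportedInBall.sub {R : ℝ} {u v : Distr} (hu : SupportedInBall R u)
    (hv : SupportedInBall R v) : SupportedInBall R (u - v) := fun φ hφ => by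
  simp [hu φ hφ, hv φ hφ]

/-- `φ ↦ φ(q) z` as an element of `H_{b,c}^{0,-∞}`. -/
def diracB (q : Spacetime) (z : Spinor) : HbcNegInf := ⟨dirac q z, dirac_mem q z⟩

theorem diracB_add (q : Spacetime) (z z' : Spinor) :
    diracB q (z + z') = diracB q z + diracB q z' := by
  refine Subtype.ext (ContinuousLinearMap.ext fun φ => ?_)
  exact smul_add (φ q) z z'

theorem diracB_smul (q : Spacetime) (c : ℂ) (z : Spinor) :
    diracB q (c • z) = c • diracB q z := by
  refine Subtype.ext (ContinuousLinearMap.ext fun φ => ?_)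
  exact smul_comm (φ q) c z

theorem half_norm_le_of_mem_ball {q₀ q : Spacetime} (h : q ∈ ball q₀ (‖q₀.2‖ / 2)) :
    ‖q₀.2‖ / 2 ≤ ‖q.2‖ := by
  rw [mem_ball_iff_norm] at h
  have h1 : ‖q.2 - q₀.2‖ ≤ ‖q - q₀‖ := norm_snd_le (q - q₀)
  have h2 := norm_sub_norm_le q₀.2 q.2
  rw [norm_sub_rev] at h2
  linarith

/-- Mean value inequality for `φ` on a ball away from the axis. The order is `5 = 4 + 1`: the
gradient is made of single b-derivatives of `φ`, whose point values cost four more. -/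
theorem exists_bDualNorm_dirac_sub_le {q₀ : Spacetime} (hq₀ : q₀ ∈ interiorM) : ∃ C : ℝ≥0,
    ∀ q ∈ ball q₀ (‖q₀.2‖ / 2), ∀ z,
      bDualNorm 5 (dirac q z - dirac q₀ z) ≤ C * ‖q - q₀‖ₑ * ‖z‖ₑ := by
  obtain ⟨K, hK⟩ := exists_enorm_test_le
  have hr : 0 < ‖q₀.2‖ := norm_pos_iff.2 hq₀
  have hr2 : 0 < ‖q₀.2‖ / 2 := by positivity
  set X : ℝ≥0∞ := ∑ _j : Fin 4, ∑ _i : Fin 5, ENNReal.ofReal (1 + (‖q₀.2‖ / 2)⁻¹) *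
    (K * ENNReal.ofReal (‖q₀.2‖ / 2) ^ (-(3 / 2) : ℝ)) with hX
  have hXt : X ≠ ∞ := by
    refine ENNReal.sum_ne_top.2 fun j _ => ENNReal.sum_ne_top.2 fun i _ =>
      ENNReal.mul_ne_top (by simp) (ENNReal.mul_ne_top (by simp)
        (ENNReal.rpow_ne_top_of_ne_zero ?_ (by simp)))
    simpa using hr2
  refine ⟨X.toNNReal, fun q hq z => bDualNorm_le fun φ => ?_⟩
  rw [ENNReal.coe_toNNReal hXt]
  have hgrad : ∀ y ∈ ball q₀ (‖q₀.2‖ / 2), ‖fderiv ℝ φ y‖ₑ ≤ X * bNorm 5 φ := by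
    intro y hy
    have hy2 := half_norm_le_of_mem_ball hy
    have hyM : y ∈ interiorM := norm_pos_iff.1 (hr2.trans_le hy2)
    have hcoef : ∀ j i, ‖dirCoef j i y‖ₑ ≤ ENNReal.ofReal (1 + (‖q₀.2‖ / 2)⁻¹) := fun j i => by
      rw [← ofReal_norm, Real.norm_eq_abs]
      refine ENNReal.ofReal_le_ofReal ?_
      have h1 : ‖y.2‖⁻¹ ≤ (‖q₀.2‖ / 2)⁻¹ := inv_anti₀ hr2 hy2
      refine Fin.cases ?_ (fun j => ?_) j
      · exact (abs_dirCoef_zero_le i y).trans (le_add_of_nonneg_right (by positivity))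
      · exact (abs_dirCoef_succ_le j i hyM).trans (by linarith)
    have hb : ∀ i, ‖bDeriv i φ y‖ₑ ≤
        K * ENNReal.ofReal (‖q₀.2‖ / 2) ^ (-(3 / 2) : ℝ) * bNorm 5 φ := fun i => by
      refine (hK (bDeriv i φ) y hyM).trans ?_
      refine mul_le_mul' (mul_le_mul' le_rfl ?_) ?_
      · rw [ENNReal.rpow_neg, ENNReal.rpow_neg, ← ofReal_norm]
        exact ENNReal.inv_le_inv.2 (ENNReal.rpow_le_rpow (ENNReal.ofReal_le_ofReal hy2)
          (by norm_num))
      · exact bNorm_bDeriv_le 4 i φ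
    calc ‖fderiv ℝ φ y‖ₑ ≤ ∑ j, ‖fderiv ℝ φ y (dir j)‖ₑ := by
          simp only [← ofReal_norm]
          rw [← ENNReal.ofReal_sum_of_nonneg fun _ _ => norm_nonneg _]
          exact ENNReal.ofReal_le_ofReal (norm_clm_le_sum _)
      _ ≤ ∑ j, ∑ i, ENNReal.ofReal (1 + (‖q₀.2‖ / 2)⁻¹) *
          (K * ENNReal.ofReal (‖q₀.2‖ / 2) ^ (-(3 / 2) : ℝ) * bNorm 5 φ) := by
          refine Finset.sum_le_sum fun j _ => ?_
          rw [dir_eq_sum hyM j, map_sum]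
          refine (enorm_sum_le _ _).trans (Finset.sum_le_sum fun i _ => ?_)
          rw [map_smul, enorm_smul]
          exact mul_le_mul' (hcoef j i) (hb i)
      _ = _ := by simp only [hX, Finset.sum_mul, mul_assoc]
  change ‖φ q • z - φ q₀ • z‖ₑ ≤ _
  rw [← sub_smul, enorm_smul]
  set b : ℝ := (X * bNorm 5 φ).toReal with hb
  have hbt : X * bNorm 5 φ ≠ ∞ := ENNReal.mul_ne_top hXt (bNorm_lt_top 5 φ).ne
  have hmv : ‖φ q - φ q₀‖ ≤ b * ‖q - q₀‖ := by
    refine (convex_ball q₀ (‖q₀.2‖ / 2)).norm_image_sub_le_of_norm_fderiv_le (𝕜 := ℝ)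
      (fun y _ => (φ.contDiff.differentiable (by simp)) y) (fun y hy => ?_)
      (mem_ball_self hr2) hq
    rw [← toReal_enorm]
    exact ENNReal.toReal_mono hbt (hgrad y hy)
  calc ‖φ q - φ q₀‖ₑ * ‖z‖ₑ ≤ (X * bNorm 5 φ * ‖q - q₀‖ₑ) * ‖z‖ₑ := by
        gcongr
        rw [← ofReal_norm, ← ofReal_norm, ← ENNReal.ofReal_toReal hbt,
          ← ENNReal.ofReal_mul ENNReal.toReal_nonneg]
        exact ENNReal.ofReal_le_ofReal hmv
    _ = _ := by ring

/-! ### The kernel -/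

/-- The Schwartz kernel of a continuous operator. -/
def kernel (Λ : HbcNegInf →ₗ[ℂ] HbLocInf) (p q : Spacetime) : Spinor →L[ℂ] Spinor :=
  LinearMap.toContinuousLinearMap
  { toFun := fun z => val (Λ (diracB q z)) p
    map_add' := fun z z' => by rw [diracB_add, map_add, val_add]
    map_smul' := fun c z => by rw [diracB_smul, map_smul, val_smul, RingHom.id_apply] }

theorem kernel_apply (Λ : HbcNegInf →ₗ[ℂ] HbLocInf) (p q : Spacetime) (z : Spinor) :
    kernel Λ p q z = val (Λ (diracB q z)) p := rfl

theorem val_neg (u : HbLocInf) (p : Spacetime) : val (-u) p = -val u p := by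
  rw [← neg_one_smul ℂ u, val_smul, neg_one_smul]

theorem val_sub (u v : HbLocInf) (p : Spacetime) : val (u - v) p = val u p - val v p := by
  rw [show u - v = u + -v from sub_eq_add_neg u v, val_add, val_neg, ← sub_eq_add_neg]

theorem tendsto_ennreal_const_mul_zero {X : Type*} {l : Filter X} {g : X → ℝ≥0∞} {c : ℝ≥0∞}
    (hc : c ≠ ∞) (hg : Tendsto g l (𝓝 0)) : Tendsto (fun x => c * g x) l (𝓝 0) := by
  simpa using ENNReal.Tendsto.const_mul hg (Or.inr hc)

/-- Near `(p₀, q₀)`, the difference `Λ(p,q) - Λ(p,q₀)` is `O(|q - q₀|)` uniformly in `p`, by the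
Lipschitz bound on Dirac distributions and continuity of `Λ`; and `Λ(·,q₀) z` is continuous as a
smooth representative. -/
theorem continuousOn_kernel {Λ : HbcNegInf →ₗ[ℂ] HbLocInf} (hΛ : IsContinuousOperator Λ) :
    ContinuousOn (fun z : Spacetime × Spacetime => kernel Λ z.1 z.2)
      ((interiorM : Set Spacetime) ×ˢ (interiorM : Set Spacetime)) := by
  rw [continuousOn_clm_apply]
  rintro z ⟨p₀, q₀⟩ ⟨hp₀ : p₀ ∈ interiorM, hq₀ : q₀ ∈ interiorM⟩
  refine ContinuousAt.continuousWithinAt ?_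
  obtain ⟨K, hK⟩ := exists_val_le
  obtain ⟨C, hC⟩ := exists_bDualNorm_dirac_sub_le hq₀
  have hp2 : 0 < ‖p₀.2‖ / 2 := half_pos (norm_pos_iff.2 hp₀)
  have hq2 : 0 < ‖q₀.2‖ / 2 := half_pos (norm_pos_iff.2 hq₀)
  obtain ⟨D, hD⟩ := hΛ.exists_locNorm_le 5 (‖q₀‖ + ‖q₀.2‖ / 2) (3 * (‖p₀‖ + ‖p₀.2‖ / 2) + 1)
  set c : ℝ≥0∞ := K * ENNReal.ofReal (‖p₀.2‖ / 2) ^ (-(3 / 2) : ℝ) * (D * (C * ‖z‖ₑ)) with hc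
  have hct : c ≠ ∞ := by
    refine ENNReal.mul_ne_top (ENNReal.mul_ne_top (by simp)
      (ENNReal.rpow_ne_top_of_ne_zero (by simpa using hp2) (by simp)))
      (ENNReal.mul_ne_top (by simp) (ENNReal.mul_ne_top (by simp) (by simp)))
  have hdiff : Tendsto (fun y : Spacetime × Spacetime => kernel Λ y.1 y.2 z - kernel Λ y.1 q₀ z)
      (𝓝 (p₀, q₀)) (𝓝 0) := by
    rw [tendsto_zero_iff_enorm_tendsto_zero]
    have hlim : Tendsto (fun y : Spacetime × Spacetime => c * ‖y.2 - q₀‖ₑ) (𝓝 (p₀, q₀))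
        (𝓝 0) := by
      refine tendsto_ennreal_const_mul_zero hct ?_
      have : Tendsto (fun y : Spacetime × Spacetime => y.2 - q₀) (𝓝 (p₀, q₀)) (𝓝 0) :=
        (continuous_snd.sub continuous_const).tendsto' _ _ (sub_self _)
      simpa using this.enorm
    refine tendsto_of_tendsto_of_tendsto_of_le_of_le' tendsto_const_nhds hlim
      (.of_forall fun _ => zero_le) ?_
    filter_upwards [prod_mem_nhds (ball_mem_nhds p₀ hp2) (ball_mem_nhds q₀ hq2)] with y hy
    obtain ⟨hy1, hy2⟩ := hy
    have hr := half_norm_le_of_mem_ball hy1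
    have hn : ∀ {a b : Spacetime} {ε : ℝ}, a ∈ ball b ε → ‖a‖ ≤ ‖b‖ + ε := fun {a b ε} h => by
      rw [mem_ball_iff_norm] at h
      linarith [norm_sub_norm_le a b]
    simp only [kernel_apply]
    rw [← val_sub, show Λ (diracB y.2 z) - Λ (diracB q₀ z) = Λ (diracB y.2 z - diracB q₀ z) from
      (map_sub Λ _ _).symm]
    refine (hK _ (3 * (‖p₀‖ + ‖p₀.2‖ / 2) + 1) y.1 (norm_pos_iff.1 (hp2.trans_le hr))
      (by linarith [hn hy1])).1.trans ?_
    have h1 : bDualNorm 5 ((diracB y.2 z - diracB q₀ z : HbcNegInf) : Distr) ≤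
        C * ‖y.2 - q₀‖ₑ * ‖z‖ₑ := hC y.2 hy2 z
    have h2 : SupportedInBall (‖q₀‖ + ‖q₀.2‖ / 2)
        ((diracB y.2 z - diracB q₀ z : HbcNegInf) : Distr) :=
      (dirac_supported (hn hy2) z).sub (dirac_supported (by linarith) z)
    calc _ ≤ K * ENNReal.ofReal (‖p₀.2‖ / 2) ^ (-(3 / 2) : ℝ) *
          (D * (C * ‖y.2 - q₀‖ₑ * ‖z‖ₑ)) := by
          refine mul_le_mul' (mul_le_mul' le_rfl ?_)
            ((hD _ h2).trans (mul_le_mul' le_rfl h1))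
          rw [ENNReal.rpow_neg, ENNReal.rpow_neg, ← ofReal_norm]
          exact ENNReal.inv_le_inv.2 (ENNReal.rpow_le_rpow (ENNReal.ofReal_le_ofReal hr)
            (by norm_num))
      _ = _ := by rw [hc]; ring
  have hfix : Tendsto (fun y : Spacetime × Spacetime => kernel Λ y.1 q₀ z) (𝓝 (p₀, q₀))
      (𝓝 (kernel Λ p₀ q₀ z)) :=
    (((contDiffOn_val (Λ (diracB q₀ z))).continuousOn.continuousAt
      (interiorM.isOpen.mem_nhds hp₀)).tendsto).comp (continuous_fst.tendsto (p₀, q₀))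
  simpa [ContinuousAt] using hdiff.add hfix

/-! ### The negative order Sobolev spaces as subspaces of a Banach space -/

/-- Hahn-Banach: the bound makes `l` factor through the range of `T`, as a bounded functional there.
-/
theorem exists_dual_comp_eq {V W : Type*} [AddCommGroup V] [Module ℂ V] [NormedAddCommGroup W]
    [NormedSpace ℂ W] (T : V →ₗ[ℂ] W) (l : V →ₗ[ℂ] ℂ) (C : ℝ) (h : ∀ v, ‖l v‖ ≤ C * ‖T v‖) :
    ∃ L : W →L[ℂ] ℂ, ∀ v, L (T v) = l v := by
  obtain ⟨g, hg⟩ := T.rangeRestrict.exists_rightInverse_of_surjective T.range_rangeRestrict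
  have hg' : ∀ w, T (g w) = w := fun w => congrArg Subtype.val (LinearMap.congr_fun hg w)
  obtain ⟨L, hL, -⟩ := exists_extension_norm_eq T.range
    ((l.comp g).mkContinuous C fun w => (h (g w)).trans_eq (by rw [hg']; rfl))
  refine ⟨L, fun v => ?_⟩
  have h1 : L (T v) = l (g (T.rangeRestrict v)) := hL (T.rangeRestrict v)
  -- The choice of preimage does not matter: `T` kills the difference, hence so does `l`.
  have h2 := h (g (T.rangeRestrict v) - v)
  rw [map_sub, map_sub, hg', show (T.rangeRestrict v : W) = T v from rfl, sub_self, norm_zero,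
    mul_zero] at h2
  rw [h1, ← sub_eq_zero, ← norm_le_zero_iff]
  exact h2

/-- The space `H_b^{0,-k}(M; ℂ⁴)`. -/
def HbNeg (k : ℕ) : Submodule ℂ Distr where
  carrier := {u | bDualNorm k u < ∞}
  zero_mem' := by simp [bDualNorm]
  add_mem' := fun {u v} hu hv => (bDualNorm_add_le k u v).trans_lt (ENNReal.add_lt_top.2 ⟨hu, hv⟩)
  smul_mem' := fun c u hu =>
    (bDualNorm_smul_le k c u).trans_lt (ENNReal.mul_lt_top enorm_lt_top hu)

theorem enorm_div_bNorm_le (k : ℕ) (u : Distr) (φ : Test) :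
    ‖u φ‖ₑ / bNorm k φ ≤ bDualNorm k u := le_iSup (fun φ => ‖u φ‖ₑ / bNorm k φ) φ

theorem enorm_normalized {k : ℕ} {u : Distr} (hu : u ∈ HbNeg k) (φ : Test) :
    ‖(((bNorm k φ).toReal⁻¹ : ℝ) : ℂ) • u φ‖ₑ = ‖u φ‖ₑ / bNorm k φ := by
  rw [enorm_smul, show ‖(((bNorm k φ).toReal⁻¹ : ℝ) : ℂ)‖ₑ = ‖(bNorm k φ).toReal⁻¹‖ₑ by
    rw [← ofReal_norm, ← ofReal_norm, Complex.norm_real]]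
  -- If the norm of `φ` vanishes, finiteness of the dual norm forces `u φ = 0`, and both sides are
  -- `0`.
  rcases eq_or_ne (bNorm k φ) 0 with h | h
  · have h1 := (enorm_div_bNorm_le k u φ).trans_lt hu
    rw [h] at h1 ⊢
    rcases eq_or_ne ‖u φ‖ₑ 0 with h2 | h2
    · simp [h2]
    · rw [ENNReal.div_zero h2] at h1
      exact absurd h1 (lt_irrefl _)
  · have h3 := ENNReal.toReal_pos h (bNorm_lt_top k φ).ne
    rw [Real.enorm_of_nonneg (by positivity), ENNReal.ofReal_inv_of_pos h3,
      ENNReal.ofReal_toReal (bNorm_lt_top k φ).ne, mul_comm, ENNReal.div_eq_inv_mul, mul_comm]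

theorem norm_normalized_le {k : ℕ} {u : Distr} (hu : u ∈ HbNeg k) (φ : Test) :
    ‖(((bNorm k φ).toReal⁻¹ : ℝ) : ℂ) • u φ‖ ≤ (bDualNorm k u).toReal := by
  rw [← toReal_enorm, enorm_normalized hu]
  exact ENNReal.toReal_mono (ne_of_lt hu) (enorm_div_bNorm_le k u φ)

/-- The isometric embedding of `H_b^{0,-k}(M; ℂ⁴)` in the bounded functions on the set of test
functions. -/
def HbNeg.embed (k : ℕ) : HbNeg k →ₗ[ℂ] lp (fun _ : Test => Spinor) ∞ where
  toFun u := ⟨fun φ => (((bNorm k φ).toReal⁻¹ : ℝ) : ℂ) • (u : Distr) φ,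
    memℓp_infty ⟨_, forall_mem_range.2 (norm_normalized_le u.2)⟩⟩
  map_add' u v := by
    ext1
    funext φ
    exact smul_add _ _ _
  map_smul' c u := by
    ext1
    funext φ
    exact smul_comm (((bNorm k φ).toReal⁻¹ : ℝ) : ℂ) c ((u : Distr) φ)

theorem HbNeg.embed_apply {k : ℕ} (u : HbNeg k) (φ : Test) :
    HbNeg.embed k u φ = (((bNorm k φ).toReal⁻¹ : ℝ) : ℂ) • (u : Distr) φ := rfl

theorem HbNeg.enorm_embed {k : ℕ} (u : HbNeg k) : ‖HbNeg.embed k u‖ₑ = bDualNorm k u := by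
  refine le_antisymm ?_ (bDualNorm_le fun φ => ?_)
  · rw [← ofReal_norm, ← ENNReal.ofReal_toReal (ne_of_lt u.2)]
    exact ENNReal.ofReal_le_ofReal
      (lp.norm_le_of_forall_le ENNReal.toReal_nonneg (norm_normalized_le u.2))
  · have h1 : ‖(u : Distr) φ‖ₑ / bNorm k φ ≤ ‖HbNeg.embed k u‖ₑ := by
      rw [← enorm_normalized u.2, ← ofReal_norm, ← ofReal_norm]
      exact ENNReal.ofReal_le_ofReal
        (lp.norm_apply_le_norm ENNReal.top_ne_zero (HbNeg.embed k u) φ)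
    rcases eq_or_ne (bNorm k φ) 0 with h | h
    · have h2 := (enorm_div_bNorm_le k u φ).trans_lt u.2
      rcases eq_or_ne ‖(u : Distr) φ‖ₑ 0 with h3 | h3
      · simp [h3]
      · rw [h, ENNReal.div_zero h3] at h2
        exact absurd h2 (lt_irrefl _)
    · exact (ENNReal.div_le_iff h (bNorm_lt_top k φ).ne).1 h1

theorem dirac_mem_HbNeg {k : ℕ} (hk : 4 ≤ k) (q : Spacetime) (z : Spinor) :
    dirac q z ∈ HbNeg k := by
  refine (bDualNorm_anti hk _).trans_lt ?_
  by_cases hq : q ∈ interiorM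
  · obtain ⟨K, hK⟩ := exists_bDualNorm_dirac_le
    refine (hK q hq z).trans_lt (ENNReal.mul_lt_top (ENNReal.mul_lt_top (by simp) ?_) (by simp))
    exact (ENNReal.rpow_ne_top_of_ne_zero (enorm_ne_zero.2 hq) enorm_ne_top).lt_top
  · refine (bDualNorm_le (b := 0) fun φ => ?_).trans_lt (by simp)
    rw [dirac_apply, test_eq_zero_of_notMem φ hq]
    simp

theorem continuousOn_embed_dirac {k : ℕ} (hk : 5 ≤ k) (z : Spinor) :
    ContinuousOn (fun q => HbNeg.embed k ⟨dirac q z, dirac_mem_HbNeg (by omega) q z⟩)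
      interiorM := by
  intro q₀ hq₀
  refine ContinuousAt.continuousWithinAt ?_
  obtain ⟨C, hC⟩ := exists_bDualNorm_dirac_sub_le hq₀
  rw [ContinuousAt, tendsto_iff_norm_sub_tendsto_zero]
  simp_rw [← map_sub]
  rw [← tendsto_zero_iff_norm_tendsto_zero, tendsto_zero_iff_enorm_tendsto_zero]
  have hlim : Tendsto (fun q => C * ‖z‖ₑ * ‖q - q₀‖ₑ) (𝓝 q₀) (𝓝 0) := by
    refine tendsto_ennreal_const_mul_zero (by finiteness) ?_
    have : Tendsto (fun q => q - q₀) (𝓝 q₀) (𝓝 0) :=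
      (continuous_id.sub continuous_const).tendsto' _ _ (sub_self _)
    simpa using this.enorm
  refine tendsto_of_tendsto_of_tendsto_of_le_of_le' tendsto_const_nhds hlim
    (.of_forall fun _ => zero_le) ?_
  filter_upwards [ball_mem_nhds q₀ (half_pos (norm_pos_iff.2 hq₀))] with q hq
  rw [HbNeg.enorm_embed]
  calc _ ≤ bDualNorm 5 (dirac q z - dirac q₀ z) := bDualNorm_anti hk _
    _ ≤ _ := hC q hq z
    _ = _ := by ring

/-- Expanding `f q` in the standard basis reduces to fixed spinors; the coefficients vanish near the
axis, where Dirac distributions need not depend continuously on `q`. -/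
theorem continuous_embed_dirac {k : ℕ} (hk : 5 ≤ k) (f : 𝓓(interiorM, Spinor)) :
    Continuous fun q => HbNeg.embed k ⟨dirac q (f q), dirac_mem_HbNeg (by omega) q (f q)⟩ := by
  set e : Fin 4 → Spinor := fun i => EuclideanSpace.single i 1 with he
  have hsum : ∀ q, HbNeg.embed k ⟨dirac q (f q), dirac_mem_HbNeg (by omega) q (f q)⟩ =
      ∑ i, f q i • HbNeg.embed k ⟨dirac q (e i), dirac_mem_HbNeg (by omega) q (e i)⟩ := fun q => by
    simp_rw [← map_smul, ← map_sum]
    congr 1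
    ext1
    rw [Submodule.coe_sum]
    ext1 φ
    simp only [Submodule.coe_smul, sum_apply, smul_apply, dirac_apply]
    simp_rw [smul_comm _ (φ q), ← Finset.smul_sum]
    congr 1
    ext j
    simp [he, Pi.single_apply]
  simp_rw [hsum]
  refine continuous_finsetSum _ fun i _ => continuous_of_tsupport fun q hq => ?_
  have hq' : q ∈ interiorM := by
    by_contra h
    refine h (f.tsupport_subset (closure_mono (fun x hx => ?_) hq))
    intro h0
    exact hx (by simp [h0])
  exact (((EuclideanSpace.proj (𝕜 := ℂ) i).continuous.comp f.continuous).continuousAt).smul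
    ((continuousOn_embed_dirac hk (e i)).continuousAt (interiorM.isOpen.mem_nhds hq'))

/-- The superposition `f = ∫ δ_q f(q) dq` as a Bochner integral. Coordinates of the sequence space
are evaluations at test functions, so the identity is checked on each `φ`. -/
theorem integral_embed_dirac {k : ℕ} (hk : 5 ≤ k) (f : 𝓓(interiorM, Spinor))
    (hf : toDistr f ∈ HbNeg k) :
    Integrable (fun q => HbNeg.embed k ⟨dirac q (f q), dirac_mem_HbNeg (by omega) q (f q)⟩) ∧
    ∫ q, HbNeg.embed k ⟨dirac q (f q), dirac_mem_HbNeg (by omega) q (f q)⟩ =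
      HbNeg.embed k ⟨toDistr f, hf⟩ := by
  have hi : Integrable fun q =>
      HbNeg.embed k ⟨dirac q (f q), dirac_mem_HbNeg (by omega) q (f q)⟩ := by
    refine (continuous_embed_dirac hk f).integrable_of_hasCompactSupport
      (f.hasCompactSupport.mono fun q hq h => hq ?_)
    ext1
    funext φ
    rw [HbNeg.embed_apply]
    simp [dirac_apply, h]
  refine ⟨hi, ?_⟩
  ext1
  funext φ
  have h := (lp.evalCLM ℂ (fun _ : Test => Spinor) ∞ φ).integral_comp_comm hi
  refine h.symm.trans ?_
  change ∫ q, (((bNorm k φ).toReal⁻¹ : ℝ) : ℂ) • φ q • f q = _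
  rw [integral_smul, ← toDistr_apply, HbNeg.embed_apply]

/-! ### The kernel represents the operator -/

/-- Cauchy-Schwarz on the support of `φ`: pairing with `φ` is continuous on `H_{b,loc}^{1,∞}`. -/
theorem exists_enorm_apply_le (φ : Test) : ∃ S : ℝ, ∀ u : HbLocInf,
    ‖(u : Distr) φ‖ₑ ≤ eLpNorm φ 2 volume * localL2Norm S (bWeak [] u) := by
  obtain ⟨S, hS⟩ := φ.hasCompactSupport.isCompact.isBounded.subset_closedBall 0
  refine ⟨S, fun u => ?_⟩
  obtain ⟨f, hf⟩ := (u.2 []).1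
  rw [localL2Norm_eq hf (ae_eq_refl f)]
  have h1 : (u : Distr) φ = ∫ p in closedBall 0 S, φ p • f p := by
    rw [setIntegral_eq_integral_of_forall_compl_eq_zero]
    · exact hf.eq_integral φ
    · intro p hp
      rw [image_eq_zero_of_notMem_tsupport fun h => hp (hS h), zero_smul]
  rw [h1]
  calc ‖∫ p in closedBall 0 S, φ p • f p‖ₑ ≤ ∫⁻ p in closedBall 0 S, ‖φ p • f p‖ₑ :=
        enorm_integral_le_lintegral_enorm _
    _ = eLpNorm ((φ : Spacetime → ℝ) • f) 1 (volume.restrict (closedBall 0 S)) := by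
        rw [eLpNorm_one_eq_lintegral_enorm]
        rfl
    _ ≤ eLpNorm φ 2 (volume.restrict (closedBall 0 S)) *
          eLpNorm f 2 (volume.restrict (closedBall 0 S)) :=
        eLpNorm_smul_le_mul_eLpNorm (hf.memLp S).1 φ.continuous.aestronglyMeasurable
    _ ≤ _ := by
        gcongr
        exact Measure.restrict_le_self

/-- The elements of `H_b^{0,-k}(M; ℂ⁴)` supported in `{|t| ≤ R, r ≤ R}`. -/
def HbNegSupported (k : ℕ) (R : ℝ) : Submodule ℂ Distr where
  carrier := {u | u ∈ HbNeg k ∧ SupportedInBall R u}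
  zero_mem' := ⟨zero_mem _, fun _ _ => rfl⟩
  add_mem' := fun {u v} hu hv => ⟨add_mem hu.1 hv.1, fun ψ hψ => by
    rw [add_apply, hu.2 ψ hψ, hv.2 ψ hψ, add_zero]⟩
  smul_mem' := fun c u hu => ⟨Submodule.smul_mem _ c hu.1, fun ψ hψ => by
    rw [smul_apply, hu.2 ψ hψ, smul_zero]⟩

theorem HbNegSupported.le (k : ℕ) (R : ℝ) : HbNegSupported k R ≤ HbNeg k := fun _ h => h.1

/-- The inclusion in `H_{b,c}^{0,-∞}(M; ℂ⁴)`. -/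
def HbNegSupported.toHbcNegInf (k : ℕ) (R : ℝ) : HbNegSupported k R →ₗ[ℂ] HbcNegInf :=
  Submodule.inclusion fun _ hu => ⟨⟨k, hu.1⟩, R, hu.2⟩

/-- The scalar functional `u ↦ (Λ u)(φ)_i` is bounded on each step of the source, hence extends to
the ambient Banach space, where it commutes with Bochner integrals. -/
theorem exists_dual_embed {Λ : HbcNegInf →ₗ[ℂ] HbLocInf} (hΛ : IsContinuousOperator Λ)
    (φ : Test) (i : Fin 4) (k : ℕ) (R : ℝ) :
    ∃ L : lp (fun _ : Test => Spinor) ∞ →L[ℂ] ℂ, ∀ u : HbNegSupported k R,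
      L (HbNeg.embed k ⟨u, u.2.1⟩) = (Λ (HbNegSupported.toHbcNegInf k R u) : Distr) φ i := by
  obtain ⟨S, hS⟩ := exists_enorm_apply_le φ
  obtain ⟨C, hC⟩ := (hΛ k R [] S).1
  have hφ : eLpNorm φ 2 volume < ∞ :=
    (φ.continuous.memLp_of_hasCompactSupport φ.hasCompactSupport).2
  refine exists_dual_comp_eq ((HbNeg.embed k).comp (Submodule.inclusion (HbNegSupported.le k R)))
    { toFun := fun u => (Λ (HbNegSupported.toHbcNegInf k R u) : Distr) φ i
      map_add' := fun u v => by
        rw [map_add, map_add]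
        rfl
      map_smul' := fun c u => by
        rw [map_smul, map_smul]
        rfl }
    ((eLpNorm φ 2 volume).toReal * C) fun u => ?_
  have h1 : ‖(Λ (HbNegSupported.toHbcNegInf k R u) : Distr) φ i‖ ≤
      ‖(Λ (HbNegSupported.toHbcNegInf k R u) : Distr) φ‖ := PiLp.norm_apply_le _ i
  refine h1.trans ?_
  rw [← toReal_enorm, ← toReal_enorm, LinearMap.comp_apply, HbNeg.enorm_embed,
    ← ENNReal.coe_toReal, ← ENNReal.toReal_mul, ← ENNReal.toReal_mul]
  refine ENNReal.toReal_mono (ENNReal.mul_ne_top (ENNReal.mul_ne_top hφ.ne (by simp))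
    (ne_of_lt u.2.1)) ((hS _).trans ?_)
  rw [mul_assoc]
  exact mul_le_mul' le_rfl (hC (HbNegSupported.toHbcNegInf k R u) u.2.2)

theorem integral_apply_diracB {Λ : HbcNegInf →ₗ[ℂ] HbLocInf} (hΛ : IsContinuousOperator Λ)
    (f : 𝓓(interiorM, Spinor)) (φ : Test) (i : Fin 4) :
    (Λ (ofTest f) : Distr) φ i = ∫ q, (Λ (diracB q (f q)) : Distr) φ i := by
  obtain ⟨⟨k₀, hk₀⟩, R₁, hR₁⟩ := toDistr_mem f
  obtain ⟨R₂, hR₂⟩ := f.hasCompactSupport.isCompact.isBounded.subset_closedBall 0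
  -- Order `5` makes `q ↦ δ_q f(q)` continuous; `k₀` accommodates `f` itself.
  have hk5 : 5 ≤ max 5 k₀ := le_max_left _ _
  obtain ⟨L, hL⟩ := exists_dual_embed hΛ φ i (max 5 k₀) (max R₁ R₂)
  have hf : toDistr f ∈ HbNeg (max 5 k₀) := (bDualNorm_anti (le_max_right _ _) _).trans_lt hk₀
  have hfR : SupportedInBall (max R₁ R₂) (toDistr f) := fun ψ hψ =>
    hR₁ ψ (hψ.mono_right (closedBall_subset_closedBall (le_max_left _ _)))
  have hd : ∀ q, SupportedInBall (max R₁ R₂) (dirac q (f q)) := fun q ψ hψ => by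
    by_cases hq : f q = 0
    · simp [hq, dirac_apply]
    · have hq' : q ∈ closedBall (0 : Spacetime) (max R₁ R₂) :=
        closedBall_subset_closedBall (le_max_right _ _) (hR₂ (subset_tsupport _ hq))
      exact dirac_supported (by simpa using hq') (f q) ψ hψ
  obtain ⟨hi, hint⟩ := integral_embed_dirac hk5 f hf
  have h1 := L.integral_comp_comm hi
  have h2 : L (HbNeg.embed _ ⟨toDistr f, hf⟩) = (Λ (ofTest f) : Distr) φ i :=
    hL ⟨toDistr f, hf, hfR⟩
  rw [← h2, ← hint, ← h1]
  exact integral_congr_ae (.of_forall fun q =>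
    hL ⟨dirac q (f q), dirac_mem_HbNeg (by omega) q (f q), hd q⟩)

theorem integrable_test_smul_kernel {k : Spacetime → Spacetime → Spinor →L[ℂ] Spinor}
    (hk : ContinuousOn (fun z : Spacetime × Spacetime => k z.1 z.2)
      ((interiorM : Set Spacetime) ×ˢ (interiorM : Set Spacetime)))
    (f : 𝓓(interiorM, Spinor)) (φ : Test) :
    Integrable fun z : Spacetime × Spacetime => φ z.1 • k z.1 z.2 (f z.2) := by
  have hsub : Function.support (fun z : Spacetime × Spacetime => φ z.1 • k z.1 z.2 (f z.2)) ⊆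
      tsupport φ ×ˢ tsupport f := fun z hz =>
    ⟨subset_tsupport _ fun h => hz (by simp [h]), subset_tsupport _ fun h => hz (by simp [h])⟩
  have hcpt : IsCompact (tsupport φ ×ˢ tsupport f) :=
    φ.hasCompactSupport.isCompact.prod f.hasCompactSupport.isCompact
  have hts := closure_minimal hsub hcpt.isClosed
  refine Continuous.integrable_of_hasCompactSupport (continuous_of_tsupport fun z hz => ?_)
    (HasCompactSupport.of_support_subset_isCompact hcpt hsub)
  obtain ⟨h1, h2⟩ := hts hz
  have h3 := hk.continuousAt ((interiorM.isOpen.prod interiorM.isOpen).mem_nhds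
    ⟨φ.tsupport_subset h1, f.tsupport_subset h2⟩)
  exact ((φ.continuous.comp continuous_fst).continuousAt).smul
    (h3.clm_apply (f.continuous.comp continuous_snd).continuousAt)

/-- Superposition of Dirac distributions, then Fubini, which compact supports in `M°` justify. -/
theorem isContinuousKernel_kernel {Λ : HbcNegInf →ₗ[ℂ] HbLocInf} (hΛ : IsContinuousOperator Λ) :
    IsContinuousKernel Λ (kernel Λ) where
  continuousOn := continuousOn_kernel hΛ
  eq_integral f φ := by
    have hi := integrable_test_smul_kernel (continuousOn_kernel hΛ) f φ
    have h1 : ∀ q, (Λ (diracB q (f q)) : Distr) φ = ∫ p, φ p • kernel Λ p q (f q) := fun q =>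
      val_integral _ φ
    have h2 : (Λ (ofTest f) : Distr) φ = ∫ q, ∫ p, φ p • kernel Λ p q (f q) := by
      ext i
      rw [integral_apply_diracB hΛ f φ i]
      simp_rw [h1]
      exact (EuclideanSpace.proj (𝕜 := ℂ) i).integral_comp_comm hi.integral_prod_right
    rw [h2, ← integral_integral_swap (f := fun p q => φ p • kernel Λ p q (f q)) hi]
    simp_rw [integral_smul]

/-! ### Uniqueness of the kernel -/

theorem continuousOn_integral_kernel {k : Spacetime → Spacetime → Spinor →L[ℂ] Spinor}
    (hk : ContinuousOn (fun z : Spacetime × Spacetime => k z.1 z.2)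
      ((interiorM : Set Spacetime) ×ˢ (interiorM : Set Spacetime)))
    (f : 𝓓(interiorM, Spinor)) : ContinuousOn (fun p => ∫ q, k p q (f q)) interiorM := by
  refine continuousOn_integral_of_compact_support (k := tsupport f) f.hasCompactSupport.isCompact
    ?_ fun p q _ hq => by rw [image_eq_zero_of_notMem_tsupport hq, map_zero]
  rintro ⟨p, q⟩ ⟨hp, -⟩
  refine ContinuousAt.continuousWithinAt ?_
  by_cases hq : q ∈ tsupport f
  · exact (hk.continuousAt ((interiorM.isOpen.prod interiorM.isOpen).mem_nhds
      ⟨hp, f.tsupport_subset hq⟩)).clm_apply (f.continuous.comp continuous_snd).continuousAt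
  · refine (continuousAt_const (y := (0 : Spinor))).congr ?_
    have h1 := (notMem_tsupport_iff_eventuallyEq.1 hq).comp_tendsto
      (continuous_snd.tendsto (p, q))
    filter_upwards [h1] with z hz
    have hz' : f z.2 = 0 := hz
    change 0 = k z.1 z.2 (f z.2)
    rw [hz', map_zero]

/-- The `ℂ⁴`-valued test function `ψ z`. -/
def testSmul (ψ : Test) (z : Spinor) : 𝓓(interiorM, Spinor) where
  toFun q := ψ q • z
  contDiff' := ψ.contDiff.smul contDiff_const
  hasCompactSupport' := ψ.hasCompactSupport.smul_right
  tsupport_subset' := (tsupport_smul_subset_left _ _).trans ψ.tsupport_subset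

theorem IsContinuousKernel.eq {Λ : HbcNegInf →ₗ[ℂ] HbLocInf}
    {k k' : Spacetime → Spacetime → Spinor →L[ℂ] Spinor} (hk : IsContinuousKernel Λ k)
    (hk' : IsContinuousKernel Λ k') {p q : Spacetime} (hp : p ∈ interiorM) (hq : q ∈ interiorM) :
    k p q = k' p q := by
  ext1 z
  have hc : ∀ {k : Spacetime → Spacetime → Spinor →L[ℂ] Spinor}, IsContinuousKernel Λ k →
      ContinuousOn (fun q => k p q z) interiorM := fun h =>
    (h.continuousOn.comp (continuousOn_const.prodMk continuousOn_id) fun q hq =>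
      ⟨hp, hq⟩).clm_apply continuousOn_const
  -- Two rounds of testing: in `q` against `ψ z` here, and in `p` against `φ` in the next step.
  refine eqOn_of_integral_test (hc hk) (hc hk') (fun ψ => ?_) hq
  have h := eqOn_of_integral_test (continuousOn_integral_kernel hk.continuousOn (testSmul ψ z))
    (continuousOn_integral_kernel hk'.continuousOn (testSmul ψ z))
    (fun φ => by rw [← hk.eq_integral, ← hk'.eq_integral]) hp
  have e : ∀ k : Spacetime → Spacetime → Spinor →L[ℂ] Spinor,
      ∫ q, k p q (testSmul ψ z q) = ∫ q, ψ q • k p q z := fun k =>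
    integral_congr_ae (.of_forall fun q => (k p q).map_smul_of_tower (ψ q) z)
  rw [← e, ← e]
  exact h

/-! ### The trace density -/

theorem traceDensity_eq_sum (k : Spacetime → Spacetime → Spinor →L[ℂ] Spinor) (p : Spacetime) :
    traceDensity k p = ∑ j, k p p (EuclideanSpace.single j 1) j := by
  rw [traceDensity,
    LinearMap.trace_eq_matrix_trace ℂ (EuclideanSpace.basisFun (Fin 4) ℂ).toBasis]
  simp [Matrix.trace, LinearMap.toMatrix_apply]

theorem IsContinuousKernel.traceDensity_eq {Λ : HbcNegInf →ₗ[ℂ] HbLocInf}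
    {k k' : Spacetime → Spacetime → Spinor →L[ℂ] Spinor} (hk : IsContinuousKernel Λ k)
    (hk' : IsContinuousKernel Λ k') {p : Spacetime} (hp : p ∈ interiorM) :
    traceDensity k p = traceDensity k' p := by
  rw [traceDensity, traceDensity, hk.eq hk' hp hp]

/-- The exponent is `-2 = -1/2 - 3/2`: the target bound at `p` times the `H_b^{0,-4}` norm of `δ_p
z`. -/
theorem exists_norm_kernel_apply_le {Λ : HbcNegInf →ₗ[ℂ] HbLocInf} (hΛ : IsContinuousOperator Λ)
    (R : ℝ) : ∃ C : ℝ, 0 ≤ C ∧ ∀ p : Spacetime, |p.1| ≤ R → 0 < ‖p.2‖ → ‖p.2‖ ≤ R → ∀ z,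
      ‖kernel Λ p p z‖ ≤ C * ‖p.2‖ ^ (-2 : ℝ) * ‖z‖ := by
  obtain ⟨K, hK0, hK⟩ := exists_val_le_rpow R
  obtain ⟨B, hB⟩ := exists_bDualNorm_dirac_le
  obtain ⟨D, hD⟩ := hΛ.exists_locNorm_le 4 R (3 * R + 1)
  refine ⟨K * (D * B), by positivity, fun p h1 h2 h3 z => ?_⟩
  have hp : ‖p‖ ≤ R := by
    rw [Prod.norm_def]
    exact sup_le h1 h3
  have hb : locNorm (3 * R + 1) (Λ (diracB p z) : Distr) ≤
      ENNReal.ofReal (D * (B * ‖p.2‖ ^ (-(3 / 2) : ℝ) * ‖z‖)) := by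
    refine (hD _ (dirac_supported hp z)).trans ?_
    rw [ENNReal.ofReal_mul (by positivity), ENNReal.ofReal_mul (by positivity),
      ENNReal.ofReal_mul (by positivity), ENNReal.ofReal_coe_nnreal, ENNReal.ofReal_coe_nnreal,
      ← ENNReal.ofReal_rpow_of_pos h2, ofReal_norm, ofReal_norm]
    exact mul_le_mul' le_rfl (hB p (norm_pos_iff.1 h2) z)
  refine (hK _ _ (by positivity) hb p h1 h2 h3).trans_eq ?_
  have e : ‖p.2‖ ^ (-2 : ℝ) = ‖p.2‖ ^ (-(1 / 2) : ℝ) * ‖p.2‖ ^ (-(3 / 2) : ℝ) := by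
    rw [← Real.rpow_add h2]
    norm_num
  rw [e]
  ring

theorem exists_norm_traceDensity_le {Λ : HbcNegInf →ₗ[ℂ] HbLocInf}
    (hΛ : IsContinuousOperator Λ) {k : Spacetime → Spacetime → Spinor →L[ℂ] Spinor}
    (hk : IsContinuousKernel Λ k) (R : ℝ) : ∃ C : ℝ, 0 ≤ C ∧ ∀ p : Spacetime, |p.1| ≤ R →
      0 < ‖p.2‖ → ‖p.2‖ ≤ R → ‖traceDensity k p‖ ≤ C * ‖p.2‖ ^ (-2 : ℝ) := by
  obtain ⟨C, hC0, hC⟩ := exists_norm_kernel_apply_le hΛ R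
  refine ⟨4 * C, by positivity, fun p h1 h2 h3 => ?_⟩
  rw [hk.traceDensity_eq (isContinuousKernel_kernel hΛ) (norm_pos_iff.1 h2), traceDensity_eq_sum]
  calc _ ≤ ∑ _j : Fin 4, C * ‖p.2‖ ^ (-2 : ℝ) := norm_sum_le_of_le _ fun j _ =>
        (PiLp.norm_apply_le _ j).trans ((hC p h1 h2 h3 _).trans_eq (by simp))
    _ = _ := by
        simp
        ring

theorem continuousOn_traceDensity {k : Spacetime → Spacetime → Spinor →L[ℂ] Spinor}
    (hk : ContinuousOn (fun z : Spacetime × Spacetime => k z.1 z.2)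
      ((interiorM : Set Spacetime) ×ˢ (interiorM : Set Spacetime))) :
    ContinuousOn (traceDensity k) interiorM := by
  have h : ContinuousOn (fun p => k p p) interiorM :=
    hk.comp (continuousOn_id.prodMk continuousOn_id) fun p hp => ⟨hp, hp⟩
  simp_rw [funext (traceDensity_eq_sum k)]
  exact continuousOn_finsetSum _ fun j _ =>
    (EuclideanSpace.proj (𝕜 := ℂ) j).continuous.comp_continuousOn (h.clm_apply continuousOn_const)

/-- The exponent `2` is below the space dimension `3`; balls of the sup norm are products. -/
theorem integrableOn_norm_rpow_neg_two (R : ℝ) :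
    IntegrableOn (fun p : Spacetime => ‖p.2‖ ^ (-2 : ℝ)) (ball 0 R) := by
  have h1 : IntegrableOn (fun x : EuclideanSpace ℝ (Fin 3) => ‖x‖ ^ (-2 : ℝ)) (ball 0 R) := by
    refine integrableOn_ball_of_norm_le_rpow (C := 1) (α := 2) (by simp) (by simp; norm_num)
      (.of_forall fun x => ?_) (by measurability)
    rw [Real.norm_of_nonneg (by positivity), one_mul]
  have h2 : IntegrableOn (fun _ : ℝ => (1 : ℝ)) (ball 0 R) :=
    integrableOn_const measure_ball_lt_top.ne
  have h3 := h2.mul_prod h1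
  rw [Measure.prod_restrict, ← Measure.volume_eq_prod, ball_prod_same] at h3
  simp only [one_mul] at h3
  exact h3

theorem locallyIntegrable_traceDensity {Λ : HbcNegInf →ₗ[ℂ] HbLocInf}
    (hΛ : IsContinuousOperator Λ) {k : Spacetime → Spacetime → Spinor →L[ℂ] Spinor}
    (hk : IsContinuousKernel Λ k) : LocallyIntegrable (traceDensity k) := fun p => by
  obtain ⟨C, -, hC⟩ := exists_norm_traceDensity_le hΛ hk (‖p‖ + 1)
  refine ⟨ball 0 (‖p‖ + 1), isOpen_ball.mem_nhds (by simp), ?_⟩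
  have hmeas : AEStronglyMeasurable (traceDensity k) := by
    have h1 := (continuousOn_traceDensity hk.continuousOn).aestronglyMeasurable (μ := volume)
      interiorM.isOpen.measurableSet
    rwa [Measure.restrict_eq_self_of_ae_mem ae_mem_interiorM] at h1
  refine ((integrableOn_norm_rpow_neg_two (‖p‖ + 1)).const_mul C).mono' hmeas.restrict ?_
  filter_upwards [ae_restrict_mem measurableSet_ball, ae_restrict_of_ae ae_mem_interiorM]
    with q hq hqM
  rw [mem_ball_zero_iff, Prod.norm_def, max_lt_iff] at hq
  exact hC q hq.1.le (norm_pos_iff.2 hqM) hq.2.le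

/-- The bound `r^{-2}` holds without loss; the factor `r^{2δ} ≤ R^{2δ}` is absorbed in the constant.
-/
theorem exists_norm_traceDensity_le_rpow {Λ : HbcNegInf →ₗ[ℂ] HbLocInf}
    (hΛ : IsContinuousOperator Λ) {k : Spacetime → Spacetime → Spinor →L[ℂ] Spinor}
    (hk : IsContinuousKernel Λ k) {δ : ℝ} (hδ : 0 < δ) (R : ℝ) : ∃ C : ℝ, ∀ p : Spacetime,
      |p.1| ≤ R → 0 < ‖p.2‖ → ‖p.2‖ ≤ R →
        ‖traceDensity k p‖ ≤ C * ‖p.2‖ ^ (-2 - 2 * δ) := by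
  obtain ⟨C, hC0, hC⟩ := exists_norm_traceDensity_le hΛ hk R
  refine ⟨C * R ^ (2 * δ), fun p h1 h2 h3 => (hC p h1 h2 h3).trans ?_⟩
  have e : ‖p.2‖ ^ (-2 : ℝ) = ‖p.2‖ ^ (2 * δ) * ‖p.2‖ ^ (-2 - 2 * δ) := by
    rw [← Real.rpow_add h2]
    ring_nf
  rw [e, mul_assoc]
  gcongr

end DiracCoulomb

end

/-! ### The proposition. -/

theorem mainTheorem9
    (Λ : DiracCoulomb.HbcNegInf →ₗ[ℂ] DiracCoulomb.HbLocInf)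
    (hΛ : DiracCoulomb.IsContinuousOperator Λ) :
    (∃ k : DiracCoulomb.Spacetime → DiracCoulomb.Spacetime →
        DiracCoulomb.Spinor →L[ℂ] DiracCoulomb.Spinor,
      DiracCoulomb.IsContinuousKernel Λ k) ∧
    ∀ k : DiracCoulomb.Spacetime → DiracCoulomb.Spacetime →
        DiracCoulomb.Spinor →L[ℂ] DiracCoulomb.Spinor,
      DiracCoulomb.IsContinuousKernel Λ k →
        LocallyIntegrable (DiracCoulomb.traceDensity k) volume ∧
        ∀ δ : ℝ, 0 < δ → ∀ R : ℝ, ∃ C : ℝ, ∀ (t : ℝ) (x : EuclideanSpace ℝ (Fin 3)),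
          |t| ≤ R → 0 < ‖x‖ → ‖x‖ ≤ R →
            ‖DiracCoulomb.traceDensity k (t, x)‖ ≤ C * ‖x‖ ^ (-2 - 2 * δ) := by
  refine ⟨⟨_, DiracCoulomb.isContinuousKernel_kernel hΛ⟩, fun k hk =>
    ⟨DiracCoulomb.locallyIntegrable_traceDensity hΛ hk, fun δ hδ R => ?_⟩⟩
  obtain ⟨C, hC⟩ := DiracCoulomb.exists_norm_traceDensity_le_rpow hΛ hk hδ R
  exact ⟨C, fun t x => hC (t, x)⟩
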